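/- Let $\mathscr V$ be a symmetric monoidal closed category. A monoidal $\mathscr V$-category $\mathscr A$, with tensor product $\star:\mathscr A\otimes\mathscr A\to\mathscr A$ and unit $N:\mathscr I\to\mathscr A$ (where $\mathscr I$ is the unit $\mathscr V$-category), is called \emph{cartesian} when the $\mathscr V$-functors $\star$ and $N$ have left $\mathscr V$-adjoints $\Delta:\mathscr A\to\mathscr A\otimes\mathscr A$ and $E:\mathscr A\to\mathscr I$. Then $(\Delta,E)$, with the constraints that correspond under the adjunctions to the associativity and unit constraints of $\mathscr A$, makes $\mathscr A$ a comonoidal $\mathscr V$-category. A $\mathscr V$-functor $J:\mathscr A\to\mathscr B$ between cartesian monoidal $\mathscr V$-categories is \emph{strong comonoidal} when it is equipped with $\mathscr V$-natural isomorphisms $\Delta J\cong (J\otimes J)\Delta$ and $EJ\cong E$ that are compatible with the coassociativity and counit constraints. For $\mathscr V$-functors $W:\mathscr C^{\mathrm{op}}\to\mathscr V$ and $G:\mathscr C\to\mathscr X$, the weighted colimit $\mathrm{colim}(W,G)$ is an object of $\mathscr X$ with an isomorphism $\mathscr X(\mathrm{colim}(W,G),X)\cong[\mathscr C^{\mathrm{op}},\mathscr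 V](W,\mathscr X(G,X))$, $\mathscr V$-natural in $X$. A \emph{pointwise left Kan extension} of $F:\mathscr A\to\mathscr X$ along $J:\mathscr A\to\mathscr B$ is a $\mathscr V$-functor $K:\mathscr B\to\mathscr X$ with an isomorphism $KB\cong\mathrm{colim}_A(\mathscr B(JA,B),FA)$, $\mathscr V$-natural in $B$. \textbf{Theorem.} Let $J:\mathscr A\to\mathscr B$ be a strong comonoidal $\mathscr V$-functor between cartesian monoidal $\mathscr V$-categories. Let $\mathscr X$ be a monoidal $\mathscr V$-category such that, for every object $X$ of $\mathscr X$, the $\mathscr V$-functors $-\otimes X$ and $X\otimes -:\mathscr X\to\mathscr X$ preserve all (weighted) colimits that exist in $\mathscr X$. Let $F:\mathscr A\to\mathscr X$ be a strong monoidal $\mathscr V$-functor. If $K:\mathscr B\to\mathscr X$ is a pointwise left Kan extension of $F$ along $J$, then $K$ admits the structure of a strong monoidal $\mathscr V$-functor. -/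

import Mathlib

open CategoryTheory MonoidalCategory Opposite

universe w v u u₁ u₂ u₃ u₄

namespace EnrichedKan

noncomputable section

/-! ### The tensor product of `V`-categories and the unit `V`-category -/

/-- Objects of the tensor product `A ⊗ B` of two `V`-categories. -/
structure TensorCat (A : Type u₁) (B : Type u₂) where
  /-- the object of `A` -/
  fst : A
  /-- the object of `B` -/
  snd : B

/-- The unique object of the unit `V`-category. -/
structure UnitCat : Type where

section Basic

variable {V : Type v} [Category.{w} V] [MonoidalCategory V] [SymmetricCategory V]

instance tensorCatEnriched (A : Type u₁) (B : Type u₂) [EnrichedCategory V A]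
    [EnrichedCategory V B] : EnrichedCategory V (TensorCat A B) where
  Hom x y := (x.fst ⟶[V] y.fst) ⊗ (x.snd ⟶[V] y.snd)
  id x := (λ_ (𝟙_ V)).inv ≫ (eId V x.fst ⊗ₘ eId V x.snd)
  comp x y z := tensorμ (x.fst ⟶[V] y.fst) (x.snd ⟶[V] y.snd) (y.fst ⟶[V] z.fst)
    (y.snd ⟶[V] z.snd) ≫ (eComp V x.fst y.fst z.fst ⊗ₘ eComp V x.snd y.snd z.snd)
  id_comp x y := by
    have h (a b : A) : eId V a ▷ (a ⟶[V] b) ≫ eComp V a a b = (λ_ _).hom := by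
      rw [← cancel_epi (λ_ _).inv, e_id_comp, Iso.inv_hom_id]
    have h' (a b : B) : eId V a ▷ (a ⟶[V] b) ≫ eComp V a a b = (λ_ _).hom := by
      rw [← cancel_epi (λ_ _).inv, e_id_comp, Iso.inv_hom_id]
    rw [comp_whiskerRight_assoc, tensorμ_natural_left_assoc, tensorHom_comp_tensorHom, h, h',
      ← tensor_left_unitality, Iso.inv_hom_id]
  comp_id x y := by
    have h (a b : A) : (a ⟶[V] b) ◁ eId V b ≫ eComp V a b b = (ρ_ _).hom := by
      rw [← cancel_epi (ρ_ _).inv, e_comp_id, Iso.inv_hom_id]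
    have h' (a b : B) : (a ⟶[V] b) ◁ eId V b ≫ eComp V a b b = (ρ_ _).hom := by
      rw [← cancel_epi (ρ_ _).inv, e_comp_id, Iso.inv_hom_id]
    rw [MonoidalCategory.whiskerLeft_comp_assoc, tensorμ_natural_right_assoc,
      tensorHom_comp_tensorHom, h, h', ← tensor_right_unitality, Iso.inv_hom_id]
  assoc w x y z := by
    rw [comp_whiskerRight_assoc, tensorμ_natural_left_assoc, tensorHom_comp_tensorHom,
      MonoidalCategory.whiskerLeft_comp_assoc, tensorμ_natural_right_assoc,
      tensorHom_comp_tensorHom, ← e_assoc', ← e_assoc', ← tensorHom_comp_tensorHom,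
      tensor_associativity_assoc, Iso.inv_hom_id_assoc]

instance unitCatEnriched : EnrichedCategory V UnitCat where
  Hom _ _ := 𝟙_ V
  id _ := 𝟙 (𝟙_ V)
  comp _ _ _ := (λ_ (𝟙_ V)).hom
  id_comp _ _ := by simp
  comp_id _ _ := by simp [unitors_equal]
  assoc _ _ _ _ := by simp [unitors_equal]

section Functors

variable {A : Type u₁} {B : Type u₂} {C : Type u₃} {D : Type u₄}
  [EnrichedCategory V A] [EnrichedCategory V B] [EnrichedCategory V C] [EnrichedCategory V D]

/-- The tensor product `F ⊗ G : A ⊗ B ⟶ C ⊗ D` of two `V`-functors. -/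
abbrev tensorFunctor (F : EnrichedFunctor V A C) (G : EnrichedFunctor V B D) :
    EnrichedFunctor V (TensorCat A B) (TensorCat C D) where
  obj x := ⟨F.obj x.fst, G.obj x.snd⟩
  map x y := F.map x.fst y.fst ⊗ₘ G.map x.snd y.snd
  map_id x := by
    change ((λ_ (𝟙_ V)).inv ≫ (eId V x.fst ⊗ₘ eId V x.snd)) ≫ _ =
      (λ_ (𝟙_ V)).inv ≫ (eId V (F.obj x.fst) ⊗ₘ eId V (G.obj x.snd))
    simp
  map_comp x y z := by
    change (tensorμ _ _ _ _ ≫ (eComp V x.fst y.fst z.fst ⊗ₘ eComp V x.snd y.snd z.snd)) ≫ _ =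
      _ ≫ tensorμ _ _ _ _ ≫ (eComp V (F.obj x.fst) (F.obj y.fst) (F.obj z.fst) ⊗ₘ
        eComp V (G.obj x.snd) (G.obj y.snd) (G.obj z.snd))
    rw [tensorμ_natural_assoc, Category.assoc, tensorHom_comp_tensorHom,
      tensorHom_comp_tensorHom, F.map_comp, G.map_comp]

variable (V A B C) in
/-- The associativity isomorphism `(A ⊗ B) ⊗ C ⟶ A ⊗ (B ⊗ C)` of `V`-categories. -/
abbrev assocFunctor :
    EnrichedFunctor V (TensorCat (TensorCat A B) C) (TensorCat A (TensorCat B C)) where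
  obj x := ⟨x.fst.fst, ⟨x.fst.snd, x.snd⟩⟩
  map x y := (α_ (x.fst.fst ⟶[V] y.fst.fst) (x.fst.snd ⟶[V] y.fst.snd) (x.snd ⟶[V] y.snd)).hom
  map_id x := by
    change ((λ_ (𝟙_ V)).inv ≫ (((λ_ (𝟙_ V)).inv ≫ (eId V x.fst.fst ⊗ₘ eId V x.fst.snd)) ⊗ₘ
        eId V x.snd)) ≫ _ =
      (λ_ (𝟙_ V)).inv ≫ (eId V x.fst.fst ⊗ₘ ((λ_ (𝟙_ V)).inv ≫
        (eId V x.fst.snd ⊗ₘ eId V x.snd)))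
    have h : (λ_ (𝟙_ V)).inv ≫ (λ_ (𝟙_ V)).inv ▷ 𝟙_ V ≫ (α_ _ _ _).hom =
        (λ_ (𝟙_ V)).inv ≫ 𝟙_ V ◁ (λ_ (𝟙_ V)).inv := by monoidal
    rw [← whiskerRight_comp_tensorHom, ← whiskerLeft_comp_tensorHom, Category.assoc,
      Category.assoc, associator_naturality, reassoc_of% h]
  map_comp x y z := by
    change (tensorμ _ _ _ _ ≫ ((tensorμ _ _ _ _ ≫ (eComp V x.fst.fst y.fst.fst z.fst.fst ⊗ₘ
        eComp V x.fst.snd y.fst.snd z.fst.snd)) ⊗ₘ eComp V x.snd y.snd z.snd)) ≫ _ =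
      _ ≫ tensorμ _ _ _ _ ≫ (eComp V x.fst.fst y.fst.fst z.fst.fst ⊗ₘ (tensorμ _ _ _ _ ≫
        (eComp V x.fst.snd y.fst.snd z.fst.snd ⊗ₘ eComp V x.snd y.snd z.snd)))
    rw [← whiskerRight_comp_tensorHom, ← whiskerLeft_comp_tensorHom, Category.assoc,
      Category.assoc, associator_naturality, associator_monoidal_assoc]

variable (V A) in
/-- The isomorphism `I ⊗ A ⟶ A` of `V`-categories. -/
abbrev leftUnitFunctor : EnrichedFunctor V (TensorCat UnitCat A) A where
  obj x := x.snd
  map x y := (λ_ (x.snd ⟶[V] y.snd)).hom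
  map_id x := by
    change ((λ_ (𝟙_ V)).inv ≫ (𝟙 (𝟙_ V) ⊗ₘ eId V x.snd)) ≫ _ = _
    simp
  map_comp x y z := by
    change (tensorμ _ _ _ _ ≫ ((λ_ (𝟙_ V)).hom ⊗ₘ eComp V x.snd y.snd z.snd)) ≫ _ = _
    change _ = ((λ_ _).hom ⊗ₘ (λ_ _).hom) ≫ eComp V x.snd y.snd z.snd
    rw [leftUnitor_monoidal_assoc, MonoidalCategory.tensorHom_def, Category.assoc, Category.assoc,
      leftUnitor_naturality]

variable (V A) in
/-- The isomorphism `A ⊗ I ⟶ A` of `V`-categories. -/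
abbrev rightUnitFunctor : EnrichedFunctor V (TensorCat A UnitCat) A where
  obj x := x.fst
  map x y := (ρ_ (x.fst ⟶[V] y.fst)).hom
  map_id x := by
    change ((λ_ (𝟙_ V)).inv ≫ (eId V x.fst ⊗ₘ 𝟙 (𝟙_ V))) ≫ _ = _
    simp [← unitors_equal]
  map_comp x y z := by
    change (tensorμ _ _ _ _ ≫ (eComp V x.fst y.fst z.fst ⊗ₘ (λ_ (𝟙_ V)).hom)) ≫ _ = _
    change _ = ((ρ_ _).hom ⊗ₘ (ρ_ _).hom) ≫ eComp V x.fst y.fst z.fst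
    rw [rightUnitor_monoidal_assoc, MonoidalCategory.tensorHom_def', Category.assoc,
      Category.assoc, rightUnitor_naturality]

variable (V B) in
/-- The isomorphism `B ⟶ I ⊗ B` of `V`-categories. -/
abbrev leftUnitInvFunctor : EnrichedFunctor V B (TensorCat UnitCat B) where
  obj b := ⟨⟨⟩, b⟩
  map b b' := (λ_ (b ⟶[V] b')).inv
  map_id b := by
    change _ = (λ_ (𝟙_ V)).inv ≫ (𝟙 (𝟙_ V) ⊗ₘ eId V b)
    simp
  map_comp x y z := by
    change _ = _ ≫ tensorμ _ _ _ _ ≫ ((λ_ (𝟙_ V)).hom ⊗ₘ eComp V x y z)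
    have h := leftUnitor_monoidal (x ⟶[V] y) (y ⟶[V] z)
    rw [MonoidalCategory.tensorHom_def (λ_ (𝟙_ V)).hom, ← cancel_mono (λ_ (x ⟶[V] z)).hom]
    simp only [Category.assoc, leftUnitor_naturality, Iso.inv_hom_id, Category.comp_id]
    rw [← leftUnitor_monoidal_assoc, tensorHom_comp_tensorHom_assoc]
    simp

variable (V A) in
/-- The isomorphism `A ⟶ A ⊗ I` of `V`-categories. -/
abbrev rightUnitInvFunctor : EnrichedFunctor V A (TensorCat A UnitCat) where
  obj a := ⟨a, ⟨⟩⟩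
  map a a' := (ρ_ (a ⟶[V] a')).inv
  map_id a := by
    change _ = (λ_ (𝟙_ V)).inv ≫ (eId V a ⊗ₘ 𝟙 (𝟙_ V))
    simp [unitors_inv_equal]
  map_comp x y z := by
    change _ = _ ≫ tensorμ _ _ _ _ ≫ (eComp V x y z ⊗ₘ (λ_ (𝟙_ V)).hom)
    rw [← cancel_mono (ρ_ (x ⟶[V] z)).hom, MonoidalCategory.tensorHom_def' (eComp V x y z),
      Category.assoc, Category.assoc, Category.assoc, Category.assoc, Iso.inv_hom_id,
      Category.comp_id, rightUnitor_naturality, ← rightUnitor_monoidal_assoc]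
    change _ = ((ρ_ _).inv ⊗ₘ (ρ_ _).inv) ≫ _
    rw [tensorHom_comp_tensorHom_assoc]
    simp

variable (V) in
/-- The `V`-functor `I ⟶ A` that picks out the object `a`. -/
abbrev constFunctor (a : A) : EnrichedFunctor V UnitCat A where
  obj _ := a
  map _ _ := eId V a
  map_id _ := Category.id_comp _
  map_comp _ _ _ := by
    change (λ_ (𝟙_ V)).hom ≫ _ = _
    change _ = ((eId V a : 𝟙_ V ⟶ _) ⊗ₘ (eId V a : 𝟙_ V ⟶ _)) ≫ _
    rw [MonoidalCategory.tensorHom_def', Category.assoc, ← cancel_epi (λ_ (𝟙_ V)).inv,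
      Iso.inv_hom_id_assoc, ← leftUnitor_inv_naturality_assoc, e_id_comp, Category.comp_id]

variable (V B) in
/-- The `V`-functor `B ⟶ A ⊗ B`, `b ↦ (a, b)`. -/
abbrev pairLeft (a : A) : EnrichedFunctor V B (TensorCat A B) :=
  (leftUnitInvFunctor V B).comp V (tensorFunctor (constFunctor V a) (EnrichedFunctor.id V B))

variable (V A) in
/-- The `V`-functor `A ⟶ A ⊗ B`, `a ↦ (a, b)`. -/
abbrev pairRight (b : B) : EnrichedFunctor V A (TensorCat A B) :=
  (rightUnitInvFunctor V A).comp V (tensorFunctor (EnrichedFunctor.id V A) (constFunctor V b))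

/-- The opposite `Aᵒᵖ ⟶ Cᵒᵖ` of a `V`-functor `A ⟶ C`. -/
abbrev opFunctor (F : EnrichedFunctor V A C) : EnrichedFunctor V Aᵒᵖ Cᵒᵖ where
  obj a := op (F.obj a.unop)
  map a a' := F.map a'.unop a.unop
  map_id a := F.map_id a.unop
  map_comp x y z := by
    change ((β_ _ _).hom ≫ eComp V z.unop y.unop x.unop) ≫ _ =
      _ ≫ (β_ _ _).hom ≫ eComp V (F.obj z.unop) (F.obj y.unop) (F.obj x.unop)
    rw [Category.assoc, F.map_comp]
    exact (BraidedCategory.braiding_naturality_assoc _ _ _).symm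

/-- The pair of two morphisms, as a morphism in the underlying category of `A ⊗ B`. -/
def pairHom {a a' : ForgetEnrichment V A} {b b' : ForgetEnrichment V B}
    (f : a ⟶ a') (g : b ⟶ b') :
    ForgetEnrichment.of V
        (⟨ForgetEnrichment.to V a, ForgetEnrichment.to V b⟩ : TensorCat A B) ⟶
      ForgetEnrichment.of V
        (⟨ForgetEnrichment.to V a', ForgetEnrichment.to V b'⟩ : TensorCat A B) :=
  ForgetEnrichment.homOf V
    ((λ_ (𝟙_ V)).inv ≫ (ForgetEnrichment.homTo V f ⊗ₘ ForgetEnrichment.homTo V g))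

/-! ### `V`-natural transformations and `V`-adjunctions -/

/-- `V`-naturality of a family `τ d : Z ⟶ C(P d, Q d)` indexed by the objects of `D`.
For `Z` the unit of `V`, such a family is a `V`-natural transformation from `P` to `Q`; for
general `Z` it is a `Z`-indexed generalized element of the `V`-object of `V`-natural
transformations from `P` to `Q`. -/
def VNatural (P Q : EnrichedFunctor V D C) (Z : V)
    (τ : ∀ d : D, Z ⟶ (P.obj d ⟶[V] Q.obj d)) : Prop :=
  ∀ d d' : D,
    (τ d ⊗ₘ Q.map d d') ≫ eComp V (P.obj d) (Q.obj d) (Q.obj d') =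
      (β_ Z (d ⟶[V] d')).hom ≫ (P.map d d' ⊗ₘ τ d') ≫
        eComp V (P.obj d) (P.obj d') (Q.obj d')

/-- A `V`-natural isomorphism between `V`-functors. (Its components are isomorphisms in the
underlying category, and their inverses are then automatically `V`-natural.) -/
structure VNatIso (P Q : EnrichedFunctor V D C) where
  /-- the components -/
  iso : ∀ d : D, ForgetEnrichment.of V (P.obj d) ≅ ForgetEnrichment.of V (Q.obj d)
  natural : VNatural P Q (𝟙_ V) fun d => ForgetEnrichment.homTo V (iso d).hom

/-- A `V`-adjunction `L ⊣ R`: isomorphisms `C(L d, c) ≅ D(d, R c)` in `V`, which are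
`V`-natural in `c` and in `d`. -/
structure VAdjunction (L : EnrichedFunctor V D C) (R : EnrichedFunctor V C D) where
  /-- the isomorphism of hom-objects -/
  homIso : ∀ (d : D) (c : C), (L.obj d ⟶[V] c) ≅ (d ⟶[V] R.obj c)
  natural_right : ∀ (d : D) (c c' : C),
    eComp V (L.obj d) c c' ≫ (homIso d c').hom =
      ((homIso d c).hom ⊗ₘ R.map c c') ≫ eComp V d (R.obj c) (R.obj c')
  natural_left : ∀ (d' d : D) (c : C),
    (L.map d' d ▷ (L.obj d ⟶[V] c)) ≫ eComp V (L.obj d') (L.obj d) c ≫ (homIso d' c).hom =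
      ((d' ⟶[V] d) ◁ (homIso d c).hom) ≫ eComp V d' d (R.obj c)

end Functors

/-! ### Monoidal `V`-categories and strong monoidal `V`-functors -/

variable (V) in
/-- A monoidal structure on a `V`-category `A`. -/
class MonoidalVCategory (A : Type u) [EnrichedCategory V A] where
  /-- the tensor product `A ⊗ A ⟶ A` -/
  tensor : EnrichedFunctor V (TensorCat A A) A
  /-- the unit object, as a `V`-functor from the unit `V`-category -/
  unit : EnrichedFunctor V UnitCat A
  /-- the associativity constraint `(x ⋆ y) ⋆ z ≅ x ⋆ (y ⋆ z)` -/
  associator : VNatIso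
    ((tensorFunctor tensor (EnrichedFunctor.id V A)).comp V tensor)
    ((assocFunctor V A A A).comp V
      ((tensorFunctor (EnrichedFunctor.id V A) tensor).comp V tensor))
  /-- the left unit constraint `N ⋆ x ≅ x` -/
  leftUnitor : VNatIso
    ((tensorFunctor unit (EnrichedFunctor.id V A)).comp V tensor) (leftUnitFunctor V A)
  /-- the right unit constraint `x ⋆ N ≅ x` -/
  rightUnitor : VNatIso
    ((tensorFunctor (EnrichedFunctor.id V A) unit).comp V tensor) (rightUnitFunctor V A)
  pentagon : ∀ x y z t : A,
    tensor.forget.map (pairHom (associator.iso ⟨⟨x, y⟩, z⟩).hom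
        (𝟙 (ForgetEnrichment.of V t))) ≫
      (associator.iso ⟨⟨x, tensor.obj ⟨y, z⟩⟩, t⟩).hom ≫
      tensor.forget.map (pairHom (𝟙 (ForgetEnrichment.of V x))
        (associator.iso ⟨⟨y, z⟩, t⟩).hom) =
    (associator.iso ⟨⟨tensor.obj ⟨x, y⟩, z⟩, t⟩).hom ≫
      (associator.iso ⟨⟨x, y⟩, tensor.obj ⟨z, t⟩⟩).hom
  triangle : ∀ x y : A,
    (associator.iso ⟨⟨x, unit.obj ⟨⟩⟩, y⟩).hom ≫
      tensor.forget.map (pairHom (𝟙 (ForgetEnrichment.of V x)) (leftUnitor.iso ⟨⟨⟩, y⟩).hom) =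
    tensor.forget.map (pairHom (rightUnitor.iso ⟨x, ⟨⟩⟩).hom (𝟙 (ForgetEnrichment.of V y)))

open MonoidalVCategory

section

variable {A : Type u₁} {X : Type u₂} [EnrichedCategory V A] [EnrichedCategory V X]

/-- A strong monoidal structure on a `V`-functor `F`. -/
structure StrongMonoidal [MonoidalVCategory V A] [MonoidalVCategory V X]
    (F : EnrichedFunctor V A X) where
  /-- the constraint `F x ⋆ F y ≅ F (x ⋆ y)` -/
  μ : VNatIso ((tensorFunctor F F).comp V (tensor (V := V) (A := X)))
    ((tensor (V := V) (A := A)).comp V F)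
  /-- the constraint `N ≅ F N` -/
  ε : VNatIso (unit (V := V) (A := X)) ((unit (V := V) (A := A)).comp V F)
  associativity : ∀ x y z : A,
    (tensor (V := V) (A := X)).forget.map
        (pairHom (μ.iso ⟨x, y⟩).hom (𝟙 (ForgetEnrichment.of V (F.obj z)))) ≫
      (μ.iso ⟨(tensor (V := V) (A := A)).obj ⟨x, y⟩, z⟩).hom ≫
      F.forget.map ((associator (V := V) (A := A)).iso ⟨⟨x, y⟩, z⟩).hom =
    ((associator (V := V) (A := X)).iso ⟨⟨F.obj x, F.obj y⟩, F.obj z⟩).hom ≫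
      (tensor (V := V) (A := X)).forget.map
        (pairHom (𝟙 (ForgetEnrichment.of V (F.obj x))) (μ.iso ⟨y, z⟩).hom) ≫
      (μ.iso ⟨x, (tensor (V := V) (A := A)).obj ⟨y, z⟩⟩).hom
  left_unitality : ∀ x : A,
    (tensor (V := V) (A := X)).forget.map
        (pairHom (ε.iso ⟨⟩).hom (𝟙 (ForgetEnrichment.of V (F.obj x)))) ≫
      (μ.iso ⟨(unit (V := V) (A := A)).obj ⟨⟩, x⟩).hom ≫
      F.forget.map ((leftUnitor (V := V) (A := A)).iso ⟨⟨⟩, x⟩).hom =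
    ((leftUnitor (V := V) (A := X)).iso ⟨⟨⟩, F.obj x⟩).hom
  right_unitality : ∀ x : A,
    (tensor (V := V) (A := X)).forget.map
        (pairHom (𝟙 (ForgetEnrichment.of V (F.obj x))) (ε.iso ⟨⟩).hom) ≫
      (μ.iso ⟨x, (unit (V := V) (A := A)).obj ⟨⟩⟩).hom ≫
      F.forget.map ((rightUnitor (V := V) (A := A)).iso ⟨x, ⟨⟩⟩).hom =
    ((rightUnitor (V := V) (A := X)).iso ⟨F.obj x, ⟨⟩⟩).hom

end

/-! ### Cartesian monoidal `V`-categories and strong comonoidal `V`-functors -/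

variable (V) in
/-- A monoidal `V`-category is cartesian when its tensor product and its unit have left
adjoints `Δ` and `E`. -/
class CartesianVCategory (A : Type u) [EnrichedCategory V A] extends MonoidalVCategory V A where
  /-- the left adjoint `Δ` of the tensor product -/
  diag : EnrichedFunctor V A (TensorCat A A)
  /-- the left adjoint `E` of the unit -/
  aug : EnrichedFunctor V A UnitCat
  /-- the adjunction `Δ ⊣ ⋆` -/
  diagAdj : VAdjunction diag tensor
  /-- the adjunction `E ⊣ N` -/
  augAdj : VAdjunction aug unit

namespace CartesianVCategory

variable (V) {A : Type u} [EnrichedCategory V A] [CartesianVCategory V A]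

/-- The hom-isomorphism of the composite adjunction `(Δ ⊗ 1) Δ ⊣ (- ⋆ -) ⋆ -`
(with the source reassociated). -/
def diagLeftIso (a x y z : A) :
    ((assocFunctor V A A A).obj
        ((tensorFunctor (diag (V := V) (A := A)) (EnrichedFunctor.id V A)).obj
          ((diag (V := V) (A := A)).obj a)) ⟶[V] (⟨x, ⟨y, z⟩⟩ : TensorCat A (TensorCat A A))) ≅
      (a ⟶[V] (tensor (V := V) (A := A)).obj ⟨(tensor (V := V) (A := A)).obj ⟨x, y⟩, z⟩) :=
  (α_ _ _ _).symm ≪≫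
    whiskerRightIso ((diagAdj (V := V) (A := A)).homIso
      ((diag (V := V) (A := A)).obj a).fst ⟨x, y⟩)
      (((diag (V := V) (A := A)).obj a).snd ⟶[V] z) ≪≫
    (diagAdj (V := V) (A := A)).homIso a ⟨(tensor (V := V) (A := A)).obj ⟨x, y⟩, z⟩

/-- The hom-isomorphism of the composite adjunction `(1 ⊗ Δ) Δ ⊣ - ⋆ (- ⋆ -)`. -/
def diagRightIso (a x y z : A) :
    ((tensorFunctor (EnrichedFunctor.id V A) (diag (V := V) (A := A))).obj
          ((diag (V := V) (A := A)).obj a) ⟶[V] (⟨x, ⟨y, z⟩⟩ : TensorCat A (TensorCat A A))) ≅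
      (a ⟶[V] (tensor (V := V) (A := A)).obj ⟨x, (tensor (V := V) (A := A)).obj ⟨y, z⟩⟩) :=
  whiskerLeftIso (((diag (V := V) (A := A)).obj a).fst ⟶[V] x)
      ((diagAdj (V := V) (A := A)).homIso ((diag (V := V) (A := A)).obj a).snd ⟨y, z⟩) ≪≫
    (diagAdj (V := V) (A := A)).homIso a ⟨x, (tensor (V := V) (A := A)).obj ⟨y, z⟩⟩

/-- The hom-isomorphism of the composite adjunction `(E ⊗ 1) Δ ⊣ N ⋆ -`. -/
def counitLeftIso (a x : A) :
    ((tensorFunctor (aug (V := V) (A := A)) (EnrichedFunctor.id V A)).obj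
          ((diag (V := V) (A := A)).obj a) ⟶[V] (⟨⟨⟩, x⟩ : TensorCat UnitCat A)) ≅
      (a ⟶[V] (tensor (V := V) (A := A)).obj ⟨(unit (V := V) (A := A)).obj ⟨⟩, x⟩) :=
  whiskerRightIso ((augAdj (V := V) (A := A)).homIso ((diag (V := V) (A := A)).obj a).fst ⟨⟩)
      (((diag (V := V) (A := A)).obj a).snd ⟶[V] x) ≪≫
    (diagAdj (V := V) (A := A)).homIso a ⟨(unit (V := V) (A := A)).obj ⟨⟩, x⟩

/-- The hom-isomorphism of the composite adjunction `(1 ⊗ E) Δ ⊣ - ⋆ N`. -/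
def counitRightIso (a x : A) :
    ((tensorFunctor (EnrichedFunctor.id V A) (aug (V := V) (A := A))).obj
          ((diag (V := V) (A := A)).obj a) ⟶[V] (⟨x, ⟨⟩⟩ : TensorCat A UnitCat)) ≅
      (a ⟶[V] (tensor (V := V) (A := A)).obj ⟨x, (unit (V := V) (A := A)).obj ⟨⟩⟩) :=
  whiskerLeftIso (((diag (V := V) (A := A)).obj a).fst ⟶[V] x)
      ((augAdj (V := V) (A := A)).homIso ((diag (V := V) (A := A)).obj a).snd ⟨⟩) ≪≫
    (diagAdj (V := V) (A := A)).homIso a ⟨x, (unit (V := V) (A := A)).obj ⟨⟩⟩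

/-- The unit `a ⟶ Δ₁ a ⋆ (Δ Δ₂ a)` of the composite adjunction `(1 ⊗ Δ) Δ ⊣ - ⋆ (- ⋆ -)`. -/
def diagRightUnit (a : A) :
    ForgetEnrichment.of V a ⟶ ForgetEnrichment.of V
      ((tensor (V := V) (A := A)).obj
        ((tensorFunctor (EnrichedFunctor.id V A) (tensor (V := V) (A := A))).obj
        ((tensorFunctor (EnrichedFunctor.id V A) (diag (V := V) (A := A))).obj
          ((diag (V := V) (A := A)).obj a)))) :=
  ForgetEnrichment.homOf V (eId V ((tensorFunctor (EnrichedFunctor.id V A)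
    (diag (V := V) (A := A))).obj ((diag (V := V) (A := A)).obj a)) ≫
      (diagRightIso V a _ _ _).hom)

/-- The coassociativity constraint `(Δ ⊗ 1) Δ ⟶ (1 ⊗ Δ) Δ` of the comonoidal structure
`(Δ, E)` on `A`: it corresponds, under the adjunctions, to the inverse of the associativity
constraint of the tensor product. -/
def coassoc (a : A) :
    ForgetEnrichment.of V ((assocFunctor V A A A).obj
        ((tensorFunctor (diag (V := V) (A := A)) (EnrichedFunctor.id V A)).obj
          ((diag (V := V) (A := A)).obj a))) ⟶
      ForgetEnrichment.of V
        ((tensorFunctor (EnrichedFunctor.id V A) (diag (V := V) (A := A))).obj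
          ((diag (V := V) (A := A)).obj a)) :=
  ForgetEnrichment.homOf V (ForgetEnrichment.homTo V (diagRightUnit V a ≫
    ((associator (V := V) (A := A)).iso ⟨⟨_, _⟩, _⟩).inv) ≫ (diagLeftIso V a _ _ _).inv)

/-- The left counit constraint `(E ⊗ 1) Δ a ⟶ (0, a)` in `I ⊗ A`: it corresponds, under the
adjunctions, to the inverse of the left unit constraint of the tensor product. -/
def counitLeft (a : A) :
    ForgetEnrichment.of V
        ((tensorFunctor (aug (V := V) (A := A)) (EnrichedFunctor.id V A)).obj
          ((diag (V := V) (A := A)).obj a)) ⟶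
      ForgetEnrichment.of V (⟨⟨⟩, a⟩ : TensorCat UnitCat A) :=
  ForgetEnrichment.homOf V (ForgetEnrichment.homTo V
    ((leftUnitor (V := V) (A := A)).iso ⟨⟨⟩, a⟩).inv ≫ (counitLeftIso V a a).inv)

/-- The right counit constraint `(1 ⊗ E) Δ a ⟶ (a, 0)` in `A ⊗ I`: it corresponds, under the
adjunctions, to the inverse of the right unit constraint of the tensor product. -/
def counitRight (a : A) :
    ForgetEnrichment.of V
        ((tensorFunctor (EnrichedFunctor.id V A) (aug (V := V) (A := A))).obj
          ((diag (V := V) (A := A)).obj a)) ⟶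
      ForgetEnrichment.of V (⟨a, ⟨⟩⟩ : TensorCat A UnitCat) :=
  ForgetEnrichment.homOf V (ForgetEnrichment.homTo V
    ((rightUnitor (V := V) (A := A)).iso ⟨a, ⟨⟩⟩).inv ≫ (counitRightIso V a a).inv)

end CartesianVCategory

open CartesianVCategory

section

variable {A : Type u₁} {B : Type u₂} [EnrichedCategory V A] [EnrichedCategory V B]

/-- A strong comonoidal structure on a `V`-functor `J : A ⟶ B` between cartesian monoidal
`V`-categories, that is, the structure of a strong morphism between the comonoidal
`V`-categories `(A, Δ, E)` and `(B, Δ, E)`. -/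
structure StrongComonoidal [CartesianVCategory V A] [CartesianVCategory V B]
    (J : EnrichedFunctor V A B) where
  /-- the constraint `Δ J ≅ (J ⊗ J) Δ` -/
  ψ : VNatIso (J.comp V (diag (V := V) (A := B)))
    ((diag (V := V) (A := A)).comp V (tensorFunctor J J))
  /-- the constraint `E J ≅ E` -/
  ψ₀ : VNatIso (J.comp V (aug (V := V) (A := B))) (aug (V := V) (A := A))
  coassociativity : ∀ a : A,
    (assocFunctor V B B B).forget.map
        ((tensorFunctor (diag (V := V) (A := B)) (EnrichedFunctor.id V B)).forget.map
          (ψ.iso a).hom) ≫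
      (assocFunctor V B B B).forget.map
        (pairHom (ψ.iso ((diag (V := V) (A := A)).obj a).fst).hom
          (𝟙 (ForgetEnrichment.of V (J.obj ((diag (V := V) (A := A)).obj a).snd)))) ≫
      (tensorFunctor J (tensorFunctor J J)).forget.map (coassoc V a) =
    coassoc V (J.obj a) ≫
      (tensorFunctor (EnrichedFunctor.id V B) (diag (V := V) (A := B))).forget.map
        (ψ.iso a).hom ≫
      pairHom (𝟙 (ForgetEnrichment.of V (J.obj ((diag (V := V) (A := A)).obj a).fst)))
        (ψ.iso ((diag (V := V) (A := A)).obj a).snd).hom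
  left_counitality : ∀ a : A,
    (tensorFunctor (aug (V := V) (A := B)) (EnrichedFunctor.id V B)).forget.map
        (ψ.iso a).hom ≫
      pairHom (ψ₀.iso ((diag (V := V) (A := A)).obj a).fst).hom
        (𝟙 (ForgetEnrichment.of V (J.obj ((diag (V := V) (A := A)).obj a).snd))) ≫
      (tensorFunctor (EnrichedFunctor.id V UnitCat) J).forget.map (counitLeft V a) =
    counitLeft V (J.obj a)
  right_counitality : ∀ a : A,
    (tensorFunctor (EnrichedFunctor.id V B) (aug (V := V) (A := B))).forget.map
        (ψ.iso a).hom ≫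
      pairHom (𝟙 (ForgetEnrichment.of V (J.obj ((diag (V := V) (A := A)).obj a).fst)))
        (ψ₀.iso ((diag (V := V) (A := A)).obj a).snd).hom ≫
      (tensorFunctor J (EnrichedFunctor.id V UnitCat)).forget.map (counitRight V a) =
    counitRight V (J.obj a)

end

end Basic

/-! ### Weighted colimits and pointwise left Kan extensions -/

section Colimits

open MonoidalClosed

variable {V : Type v} [Category.{w} V] [MonoidalCategory V] [SymmetricCategory V]
  [MonoidalClosed V]

section

variable {C : Type u₁} {X : Type u₂} {Y : Type u₃}
  [EnrichedCategory V C] [EnrichedCategory V X] [EnrichedCategory V Y]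

variable (V) in
/-- The representable `V`-functor `X(-, x) : Xᵒᵖ ⟶ V`. -/
abbrev representable (x : X) : EnrichedFunctor V Xᵒᵖ V where
  obj y := y.unop ⟶[V] x
  map y z := curry ((β_ (y.unop ⟶[V] x) (z.unop ⟶[V] y.unop)).hom ≫ eComp V z.unop y.unop x)
  map_id y := by
    have h : eId V y.unop ▷ (y.unop ⟶[V] x) ≫ eComp V y.unop y.unop x = (λ_ _).hom := by
      rw [← cancel_epi (λ_ _).inv, e_id_comp, Iso.inv_hom_id]
    change eId V y.unop ≫ _ = curry (ρ_ (y.unop ⟶[V] x)).hom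
    rw [← curry_natural_left, BraidedCategory.braiding_naturality_right_assoc, h,
      braiding_leftUnitor]
  map_comp y z t := by
    let f : (y.unop ⟶[V] x) ⊗ (z.unop ⟶[V] y.unop) ⟶ (z.unop ⟶[V] x) :=
      (β_ _ _).hom ≫ eComp V z.unop y.unop x
    let g : (z.unop ⟶[V] x) ⊗ (t.unop ⟶[V] z.unop) ⟶ (t.unop ⟶[V] x) :=
      (β_ _ _).hom ≫ eComp V t.unop z.unop x
    have hfg : (curry f ⊗ₘ curry g) ≫ comp _ _ _ = curry ((α_ _ _ _).inv ≫ f ▷ _ ≫ g) := by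
      rw [comp_eq, ← curry_natural_left, compTranspose_eq]
      congr 1
      rw [MonoidalCategory.tensorHom_def, MonoidalCategory.whiskerLeft_comp_assoc,
        associator_inv_naturality_right_assoc, associator_inv_naturality_middle_assoc,
        whisker_exchange_assoc, ← comp_whiskerRight_assoc, whiskerLeft_curry_ihom_ev_app]
      congr 2
      exact whiskerLeft_curry_ihom_ev_app _ _ g
    have hb : (y.unop ⟶[V] x) ◁ (β_ (z.unop ⟶[V] y.unop) (t.unop ⟶[V] z.unop)).hom ≫
        (β_ _ _).hom ≫ (α_ _ _ _).hom = (α_ _ _ _).inv ≫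
          (β_ _ _).hom ≫ (t.unop ⟶[V] z.unop) ◁ (β_ _ _).hom := by
      simp
    change ((β_ _ _).hom ≫ eComp V t.unop z.unop y.unop) ≫ curry _ =
      (curry f ⊗ₘ curry g) ≫ comp _ _ _
    rw [hfg, ← curry_natural_left]
    congr 1
    rw [MonoidalCategory.whiskerLeft_comp_assoc, BraidedCategory.braiding_naturality_right_assoc,
      ← e_assoc', reassoc_of% hb]
    simp only [f, g, BraidedCategory.braiding_naturality_left_assoc,
      MonoidalCategory.whiskerLeft_comp_assoc]

/-- The `V`-functor `X(G -, x) : Cᵒᵖ ⟶ V`, the composite of `Gᵒᵖ` and `X(-, x)`. -/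
abbrev homInto (G : EnrichedFunctor V C X) (x : X) : EnrichedFunctor V Cᵒᵖ V where
  obj c := G.obj c.unop ⟶[V] x
  map c d := (opFunctor G).map c d ≫ (representable V x).map (op (G.obj c.unop)) (op (G.obj d.unop))
  map_id c := ((opFunctor G).comp V (representable V x)).map_id c
  map_comp c d e := ((opFunctor G).comp V (representable V x)).map_comp c d e

/-- The `V`-natural transformation `l : W ⟶ X(G -, x)` exhibits `x` as the colimit of `G`
weighted by `W : Cᵒᵖ ⟶ V`: for every `y`, composition with `l` exhibits the hom-object
`X(x, y)` as the `V`-object `[Cᵒᵖ, V](W, X(G -, y))` of `V`-natural transformations. -/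
structure IsWeightedColimit (W : EnrichedFunctor V Cᵒᵖ V) (G : EnrichedFunctor V C X) (x : X)
    (l : ∀ c : C, W.obj (op c) ⟶ (G.obj c ⟶[V] x)) : Prop where
  natural : VNatural W (homInto G x) (𝟙_ V) fun c => curry' (l c.unop)
  universal : ∀ (y : X) (Z : V)
    (τ : ∀ c : Cᵒᵖ, Z ⟶ (ihom (W.obj c)).obj ((homInto G y).obj c)), VNatural W (homInto G y) Z τ →
    ∃! f : Z ⟶ (x ⟶[V] y), ∀ c : C,
      f ≫ curry ((l c ▷ (x ⟶[V] y)) ≫ eComp V (G.obj c) x y) = τ (op c)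

/-- The `V`-functor `H` preserves all weighted colimits (indexed by `V`-categories whose
objects form a type in the universe `u`) that exist in `X`. -/
def PreservesColimits (H : EnrichedFunctor V X Y) : Prop :=
  ∀ (D : Type u) [EnrichedCategory V D] (W : EnrichedFunctor V Dᵒᵖ V)
    (G : EnrichedFunctor V D X) (x : X) (l : ∀ d : D, W.obj (op d) ⟶ (G.obj d ⟶[V] x)),
    IsWeightedColimit W G x l →
      IsWeightedColimit W (G.comp V H) (H.obj x) fun d => l d ≫ H.map (G.obj d) x

end

section

variable {A : Type u₁} {B : Type u₂} {X : Type u₃}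
  [EnrichedCategory V A] [EnrichedCategory V B] [EnrichedCategory V X]

/-- The data exhibiting `K` as a pointwise left Kan extension of `F` along `J`: an isomorphism
`K b ≅ colim_a (B(J a, b), F a)`, given by colimiting transformations
`B(J a, b) ⟶ X(F a, K b)`, that is `V`-natural in `b`. -/
structure PointwiseLeftKanExtension (J : EnrichedFunctor V A B) (F : EnrichedFunctor V A X)
    (K : EnrichedFunctor V B X) where
  /-- the colimiting transformations -/
  κ : ∀ (b : B) (a : A), (J.obj a ⟶[V] b) ⟶ (F.obj a ⟶[V] K.obj b)
  natural : ∀ (a : A) (b b' : B),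
    eComp V (J.obj a) b b' ≫ κ b' a =
      (κ b a ⊗ₘ K.map b b') ≫ eComp V (F.obj a) (K.obj b) (K.obj b')
  isColimit : ∀ b : B, IsWeightedColimit (homInto J b) F (K.obj b) (κ b)

end

section

variable {X : Type u₁} [EnrichedCategory V X] [MonoidalVCategory V X]

variable (V) in
/-- The `V`-functor `x ⋆ - : X ⟶ X`. -/
abbrev tensorLeftFunctor (x : X) : EnrichedFunctor V X X :=
  (pairLeft V X x).comp V (MonoidalVCategory.tensor (V := V) (A := X))

variable (V) in
/-- The `V`-functor `- ⋆ x : X ⟶ X`. -/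
abbrev tensorRightFunctor (x : X) : EnrichedFunctor V X X :=
  (pairRight V X x).comp V (MonoidalVCategory.tensor (V := V) (A := X))

end

end Colimits

end

end EnrichedKan

/-! Because `Δ ⊣ ⋆`, left Kan extension along `Δ` is restriction along `⋆`. In the notation of
weighted colimits, `K (b ⋆ b')` is the colimit of `F a` weighted by `B(J a, b ⋆ b') ≅ (B ⊗ B)(Δ J a,
(b, b')) ≅ (B ⊗ B)((J ⊗ J) Δ a, (b, b'))`. Hence `K ∘ ⋆` extends `F` along `(J ⊗ J) Δ`, and so
extends `F ∘ ⋆ ≅ ⋆ ∘ (F ⊗ F)` along `J ⊗ J`. Since `⋆` on `X` preserves colimits in each variable,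
`⋆ ∘ (K ⊗ K)` is an extension of the same functor along `J ⊗ J`. The two are therefore isomorphic,
and `E ⊣ N` gives the unit comparison in the same way. `exists_comparison` carries out this argument
for an arbitrary pair of adjunctions; `IsColim.tensor` is the Fubini statement behind the extension
property of `⋆ ∘ (K ⊗ K)`. No copowers in `X` are assumed, so all work is done with colimiting
families of maps between hom-objects.

For coherence, the comparison is pinned down by its effect on the colimiting families. That formula
involves `F` through its constraint `μ`, and `J` through the mate `χ : J (a ⋆ a') ⟶ J a ⋆ J a'` of
`Δ J ≅ (J ⊗ J) Δ`; `χ` makes `J` colax monoidal and need not be invertible. The colimiting families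
stay jointly epimorphic after tensoring, so each axiom for `K` may be tested on them, where it
splits into the axiom for `F` and the corresponding axiom for `χ` (`comparison_associativity`,
`comparison_leftUnitor`, `comparison_rightUnitor`). The axioms for `χ` are the comonoidal axioms for
`J` transposed along composite adjunctions; pasting of mates (`AreMates.comp`) does the
transposition, and `assocInv_map_χ`, `leftInv_map_χ` and `rightInv_map_χ` are the outcome. -/

namespace EnrichedKan

noncomputable section

variable {V : Type v} [Category.{w} V] [MonoidalCategory V]

/-! ### Composites and identities of `V`-functors. -/

section Functor

variable {C : Type*} {D : Type*} {E : Type*} [EnrichedCategory V C] [EnrichedCategory V D]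
  [EnrichedCategory V E]

/-- Composition of `V`-functors, reducible so that objects and maps of composites unfold. -/
abbrev vcomp (F : EnrichedFunctor V C D) (G : EnrichedFunctor V D E) : EnrichedFunctor V C E where
  obj x := G.obj (F.obj x)
  map x y := F.map x y ≫ G.map (F.obj x) (F.obj y)
  map_id := (F.comp V G).map_id
  map_comp := (F.comp V G).map_comp

variable (V C) in
/-- The identity `V`-functor, reducible so that its objects and maps unfold. -/
abbrev vid : EnrichedFunctor V C C where
  obj x := x
  map x y := 𝟙 (x ⟶[V] y)
  map_id := (EnrichedFunctor.id V C).map_id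
  map_comp := (EnrichedFunctor.id V C).map_comp

/-- Composition of `V`-functors. -/
infixr:80 " ⋙ᵥ " => vcomp

end Functor

/-! ### Action of underlying morphisms on hom-objects -/

section Action

variable {C : Type*} {D : Type*} [EnrichedCategory V C] [EnrichedCategory V D]

/-- Precomposition `C(y, z) ⟶ C(x, z)` with an underlying morphism `x ⟶ y`. -/
def pre {x y : C} (u : 𝟙_ V ⟶ (x ⟶[V] y)) (z : C) : (y ⟶[V] z) ⟶ (x ⟶[V] z) :=
  (λ_ _).inv ≫ u ▷ _ ≫ eComp V x y z

/-- Postcomposition `C(x, y) ⟶ C(x, z)` with an underlying morphism `y ⟶ z`. -/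
def post (x : C) {y z : C} (v : 𝟙_ V ⟶ (y ⟶[V] z)) : (x ⟶[V] y) ⟶ (x ⟶[V] z) :=
  (ρ_ _).inv ≫ _ ◁ v ≫ eComp V x y z

theorem whiskerRight_pre_eComp {x y : C} (u : 𝟙_ V ⟶ (x ⟶[V] y)) (z t : C) :
    pre u z ▷ (z ⟶[V] t) ≫ eComp V x z t = eComp V y z t ≫ pre u t := by
  simp only [pre, comp_whiskerRight, Category.assoc, ← e_assoc']
  rw [associator_naturality_left_assoc, leftUnitor_inv_naturality_assoc, whisker_exchange_assoc]
  simp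

theorem whiskerLeft_post_eComp (x y : C) {z t : C} (v : 𝟙_ V ⟶ (z ⟶[V] t)) :
    (x ⟶[V] y) ◁ post y v ≫ eComp V x y t = eComp V x y z ≫ post x v := by
  simp only [post, MonoidalCategory.whiskerLeft_comp, Category.assoc, ← e_assoc]
  rw [associator_inv_naturality_right_assoc, rightUnitor_inv_naturality_assoc,
    ← whisker_exchange_assoc]
  simp

/-- Associativity with the inserted morphism in the middle: it can be absorbed into either factor.
-/
theorem whiskerRight_post_eComp (x : C) {y z : C} (v : 𝟙_ V ⟶ (y ⟶[V] z)) (t : C) :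
    post x v ▷ (z ⟶[V] t) ≫ eComp V x z t = (x ⟶[V] y) ◁ pre v t ≫ eComp V x y t := by
  simp only [pre, post, comp_whiskerRight, MonoidalCategory.whiskerLeft_comp, Category.assoc,
    ← e_assoc']
  simp

theorem eId_post {x y : C} (v : 𝟙_ V ⟶ (x ⟶[V] y)) : eId V x ≫ post x v = v := by
  rw [post, rightUnitor_inv_naturality_assoc, ← whisker_exchange_assoc, ← unitors_inv_equal,
    ← leftUnitor_inv_naturality_assoc, e_id_comp, Category.comp_id]

theorem eId_post_assoc {x y : C} (v : 𝟙_ V ⟶ (x ⟶[V] y)) {Z : V} (k : (x ⟶[V] y) ⟶ Z) :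
    eId V x ≫ post x v ≫ k = v ≫ k := by
  rw [← Category.assoc, eId_post]

theorem eId_pre {x y : C} (u : 𝟙_ V ⟶ (x ⟶[V] y)) : eId V y ≫ pre u y = u := by
  rw [pre, leftUnitor_inv_naturality_assoc, whisker_exchange_assoc, unitors_inv_equal,
    ← rightUnitor_inv_naturality_assoc, e_comp_id, Category.comp_id]

theorem eId_pre_assoc {x y : C} (u : 𝟙_ V ⟶ (x ⟶[V] y)) {Z : V} (k : (x ⟶[V] y) ⟶ Z) :
    eId V y ≫ pre u y ≫ k = u ≫ k := by
  rw [← Category.assoc, eId_pre]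

@[simp]
theorem pre_id (x z : C) : pre (eId V x) z = 𝟙 _ :=
  e_id_comp V x z

@[simp]
theorem post_id (x z : C) : post x (eId V z) = 𝟙 _ :=
  e_comp_id V x z

/-- Both sides are the composite of `u` and `v` in the underlying category. The form `u ≫ post x v`
serves as the normal form of such composites in what follows. -/
theorem comp_pre {x y z : C} (u : 𝟙_ V ⟶ (x ⟶[V] y)) (v : 𝟙_ V ⟶ (y ⟶[V] z)) :
    v ≫ pre u z = u ≫ post x v := by
  rw [post, pre, leftUnitor_inv_naturality_assoc, rightUnitor_inv_naturality_assoc,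
    unitors_inv_equal, whisker_exchange_assoc]

theorem comp_pre_assoc {x y z : C} (u : 𝟙_ V ⟶ (x ⟶[V] y)) (v : 𝟙_ V ⟶ (y ⟶[V] z)) {Z : V}
    (k : (x ⟶[V] z) ⟶ Z) : v ≫ pre u z ≫ k = u ≫ post x v ≫ k := by
  rw [← Category.assoc, comp_pre, Category.assoc]

theorem post_comp (x : C) {y z t : C} (u : 𝟙_ V ⟶ (y ⟶[V] z)) (v : 𝟙_ V ⟶ (z ⟶[V] t)) :
    post x (u ≫ post y v) = post x u ≫ post x v := by
  rw [post, MonoidalCategory.whiskerLeft_comp, Category.assoc, whiskerLeft_post_eComp]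
  simp [post]

theorem pre_comp {x y z : C} (u : 𝟙_ V ⟶ (x ⟶[V] y)) (v : 𝟙_ V ⟶ (y ⟶[V] z)) (t : C) :
    pre (u ≫ post x v) t = pre v t ≫ pre u t := by
  rw [pre, ← comp_pre, comp_whiskerRight, Category.assoc, whiskerRight_pre_eComp]
  simp [pre]

theorem pre_comp_assoc {x y z : C} (u : 𝟙_ V ⟶ (x ⟶[V] y)) (v : 𝟙_ V ⟶ (y ⟶[V] z)) (t : C)
    {Z : V} (k : (x ⟶[V] t) ⟶ Z) : pre (u ≫ post x v) t ≫ k = pre v t ≫ pre u t ≫ k := by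
  rw [pre_comp, Category.assoc]

theorem pre_post {x y z t : C} (u : 𝟙_ V ⟶ (x ⟶[V] y)) (v : 𝟙_ V ⟶ (z ⟶[V] t)) :
    pre u z ≫ post x v = post y v ≫ pre u t := by
  simp only [post, rightUnitor_inv_naturality_assoc, Category.assoc, ← whiskerRight_pre_eComp]
  rw [whisker_exchange_assoc]

theorem pre_post_assoc {x y z t : C} (u : 𝟙_ V ⟶ (x ⟶[V] y)) (v : 𝟙_ V ⟶ (z ⟶[V] t)) {Z : V}
    (k : (x ⟶[V] t) ⟶ Z) : pre u z ≫ post x v ≫ k = post y v ≫ pre u t ≫ k := by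
  rw [← Category.assoc, pre_post, Category.assoc]

/-- This is `map_comp` with one argument specialised to a global element of a hom-object. -/
theorem pre_map (F : EnrichedFunctor V C D) {x y : C} (u : 𝟙_ V ⟶ (x ⟶[V] y)) (z : C) :
    pre u z ≫ F.map x z = F.map y z ≫ pre (u ≫ F.map x y) (F.obj z) := by
  simp only [pre, Category.assoc, F.map_comp, leftUnitor_inv_naturality_assoc,
    MonoidalCategory.tensorHom_def, comp_whiskerRight]
  rw [whisker_exchange_assoc, whisker_exchange_assoc]

theorem pre_map_assoc (F : EnrichedFunctor V C D) {x y : C} (u : 𝟙_ V ⟶ (x ⟶[V] y)) (z : C)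
    {Z : V} (k : (F.obj x ⟶[V] F.obj z) ⟶ Z) :
    pre u z ≫ F.map x z ≫ k = F.map y z ≫ pre (u ≫ F.map x y) (F.obj z) ≫ k := by
  rw [← Category.assoc, pre_map, Category.assoc]

theorem post_map (F : EnrichedFunctor V C D) (x : C) {y z : C} (v : 𝟙_ V ⟶ (y ⟶[V] z)) :
    post x v ≫ F.map x z = F.map x y ≫ post (F.obj x) (v ≫ F.map y z) := by
  simp only [post, Category.assoc, F.map_comp, rightUnitor_inv_naturality_assoc,
    MonoidalCategory.tensorHom_def', MonoidalCategory.whiskerLeft_comp]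
  rw [← whisker_exchange_assoc, ← whisker_exchange_assoc]

theorem post_map_assoc (F : EnrichedFunctor V C D) (x : C) {y z : C} (v : 𝟙_ V ⟶ (y ⟶[V] z))
    {Z : V} (k : (F.obj x ⟶[V] F.obj z) ⟶ Z) :
    post x v ≫ F.map x z ≫ k = F.map x y ≫ post (F.obj x) (v ≫ F.map y z) ≫ k := by
  rw [← Category.assoc, post_map, Category.assoc]

/-- An underlying morphism with a two-sided inverse, as data on `x, y`. -/
structure IsInverse {x y : C} (u : 𝟙_ V ⟶ (x ⟶[V] y)) (v : 𝟙_ V ⟶ (y ⟶[V] x)) : Prop where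
  hom_inv : u ≫ post x v = eId V x
  inv_hom : v ≫ post y u = eId V y

theorem IsInverse.symm {x y : C} {u : 𝟙_ V ⟶ (x ⟶[V] y)} {v : 𝟙_ V ⟶ (y ⟶[V] x)}
    (h : IsInverse u v) : IsInverse v u := ⟨h.2, h.1⟩

section

variable {x y : C} {u : 𝟙_ V ⟶ (x ⟶[V] y)} {v : 𝟙_ V ⟶ (y ⟶[V] x)} (h : IsInverse u v)
include h

theorem IsInverse.pre_pre (z : C) : pre u z ≫ pre v z = 𝟙 _ := by
  rw [← pre_comp, h.inv_hom, pre_id]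

theorem IsInverse.pre_pre_assoc (z : C) {Z : V} (k : (y ⟶[V] z) ⟶ Z) :
    pre u z ≫ pre v z ≫ k = k := by
  rw [← Category.assoc, h.pre_pre, Category.id_comp]

theorem IsInverse.post_post (z : C) : post z u ≫ post z v = 𝟙 _ := by
  rw [← post_comp, h.hom_inv, post_id]

theorem IsInverse.post_post_assoc (z : C) {Z : V} (k : (z ⟶[V] x) ⟶ Z) :
    post z u ≫ post z v ≫ k = k := by
  rw [← Category.assoc, h.post_post, Category.id_comp]

theorem IsInverse.map (F : EnrichedFunctor V C D) : IsInverse (u ≫ F.map x y) (v ≫ F.map y x) where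
  hom_inv := by rw [Category.assoc, ← post_map, reassoc_of% h.hom_inv, F.map_id]
  inv_hom := by rw [Category.assoc, ← post_map, reassoc_of% h.inv_hom, F.map_id]

end

end Action

/-! ### Families of morphisms of hom-objects that are natural in one argument -/

section Nat

variable {C : Type*} {C' : Type*} {C'' : Type*} {D : Type*} {D' : Type*} [EnrichedCategory V C]
  [EnrichedCategory V C'] [EnrichedCategory V C''] [EnrichedCategory V D] [EnrichedCategory V D']

/-- `V`-naturality in `d` of a family `C(G d, x) ⟶ C'(H d, y)`. -/
def IsNat (G : EnrichedFunctor V D C) (H : EnrichedFunctor V D C') (x : C) (y : C')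
    (m : ∀ d, (G.obj d ⟶[V] x) ⟶ (H.obj d ⟶[V] y)) : Prop :=
  ∀ d' d : D, G.map d' d ▷ (G.obj d ⟶[V] x) ≫ eComp V (G.obj d') (G.obj d) x ≫ m d' =
    (H.map d' d ⊗ₘ m d) ≫ eComp V (H.obj d') (H.obj d) y

/-- `V`-naturality in `d` of a family `C(x, P d) ⟶ C'(y, Q d)`. -/
def IsConat (P : EnrichedFunctor V D C) (Q : EnrichedFunctor V D C') (x : C) (y : C')
    (n : ∀ d, (x ⟶[V] P.obj d) ⟶ (y ⟶[V] Q.obj d)) : Prop :=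
  ∀ d d' : D, (x ⟶[V] P.obj d) ◁ P.map d d' ≫ eComp V x (P.obj d) (P.obj d') ≫ n d' =
    (n d ⊗ₘ Q.map d d') ≫ eComp V y (Q.obj d) (Q.obj d')

/-- `V`-naturality of a family of underlying morphisms. -/
def IsVTrans (P Q : EnrichedFunctor V D C) (θ : ∀ d, 𝟙_ V ⟶ (P.obj d ⟶[V] Q.obj d)) : Prop :=
  ∀ d d' : D, P.map d d' ≫ post (P.obj d) (θ d') = Q.map d d' ≫ pre (θ d) (Q.obj d')

theorem IsNat.comp {G : EnrichedFunctor V D C} {H : EnrichedFunctor V D C'}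
    {K : EnrichedFunctor V D C''} {x : C} {y : C'} {z : C''}
    {m : ∀ d, (G.obj d ⟶[V] x) ⟶ (H.obj d ⟶[V] y)} {n : ∀ d, (H.obj d ⟶[V] y) ⟶ (K.obj d ⟶[V] z)}
    (hm : IsNat G H x y m) (hn : IsNat H K y z n) : IsNat G K x z fun d => m d ≫ n d := by
  intro d' d
  have h := hn d' d
  rw [reassoc_of% hm d' d, MonoidalCategory.tensorHom_def', Category.assoc, h,
    whiskerLeft_comp_tensorHom_assoc]

theorem IsConat.comp {G : EnrichedFunctor V D C} {H : EnrichedFunctor V D C'}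
    {K : EnrichedFunctor V D C''} {x : C} {y : C'} {z : C''}
    {m : ∀ d, (x ⟶[V] G.obj d) ⟶ (y ⟶[V] H.obj d)} {n : ∀ d, (y ⟶[V] H.obj d) ⟶ (z ⟶[V] K.obj d)}
    (hm : IsConat G H x y m) (hn : IsConat H K y z n) : IsConat G K x z fun d => m d ≫ n d := by
  intro d d'
  have h := hn d d'
  rw [reassoc_of% hm d d', MonoidalCategory.tensorHom_def, Category.assoc, h,
    whiskerRight_comp_tensorHom_assoc]

theorem IsNat.restrict {G : EnrichedFunctor V D C} {H : EnrichedFunctor V D C'} {x : C} {y : C'}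
    {m : ∀ d, (G.obj d ⟶[V] x) ⟶ (H.obj d ⟶[V] y)} (hm : IsNat G H x y m)
    (E : EnrichedFunctor V D' D) :
    IsNat (E ⋙ᵥ G) (E ⋙ᵥ H) x y fun d => m (E.obj d) := by
  intro d' d
  have h := hm (E.obj d') (E.obj d)
  dsimp
  rw [comp_whiskerRight_assoc, h, whiskerRight_comp_tensorHom_assoc]

theorem IsConat.restrict {G : EnrichedFunctor V D C} {H : EnrichedFunctor V D C'} {x : C} {y : C'}
    {m : ∀ d, (x ⟶[V] G.obj d) ⟶ (y ⟶[V] H.obj d)} (hm : IsConat G H x y m)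
    (E : EnrichedFunctor V D' D) :
    IsConat (E ⋙ᵥ G) (E ⋙ᵥ H) x y fun d => m (E.obj d) := by
  intro d' d
  have h := hm (E.obj d') (E.obj d)
  dsimp
  rw [MonoidalCategory.whiskerLeft_comp_assoc, h, whiskerLeft_comp_tensorHom_assoc]

theorem isNat_map (G : EnrichedFunctor V D C) (R : EnrichedFunctor V C C') (x : C) :
    IsNat G (G ⋙ᵥ R) x (R.obj x) fun d => R.map (G.obj d) x := by
  intro d' d
  rw [R.map_comp, whiskerRight_comp_tensorHom_assoc]

theorem isConat_map (G : EnrichedFunctor V D C) (R : EnrichedFunctor V C C') (x : C) :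
    IsConat G (G ⋙ᵥ R) x (R.obj x) fun d => R.map x (G.obj d) := by
  intro d' d
  rw [R.map_comp, whiskerLeft_comp_tensorHom_assoc]

theorem isNat_post (G : EnrichedFunctor V D C) {x y : C} (u : 𝟙_ V ⟶ (x ⟶[V] y)) :
    IsNat G G x y fun d => post (G.obj d) u := by
  intro d' d
  dsimp only
  rw [← whiskerLeft_post_eComp, MonoidalCategory.tensorHom_def, Category.assoc]

theorem isConat_pre (G : EnrichedFunctor V D C) {x y : C} (u : 𝟙_ V ⟶ (x ⟶[V] y)) :
    IsConat G G y x fun d => pre u (G.obj d) := by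
  intro d' d
  dsimp only
  rw [← whiskerRight_pre_eComp, MonoidalCategory.tensorHom_def', Category.assoc]

/-- The square for `θ` lets `θ` slide across the middle of a composition. The variance flips because
precomposition with `P d ⟶ Q d` turns maps out of `Q d` into maps out of `P d`. -/
theorem IsVTrans.isNat {P Q : EnrichedFunctor V D C} {θ : ∀ d, 𝟙_ V ⟶ (P.obj d ⟶[V] Q.obj d)}
    (h : IsVTrans P Q θ) (x : C) : IsNat Q P x x fun d => pre (θ d) x := by
  intro d' d
  rw [← whiskerRight_pre_eComp, ← comp_whiskerRight_assoc, ← h d' d, comp_whiskerRight_assoc,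
    whiskerRight_post_eComp, MonoidalCategory.tensorHom_def, Category.assoc]

theorem IsVTrans.restrict {P Q : EnrichedFunctor V D C} {θ : ∀ d, 𝟙_ V ⟶ (P.obj d ⟶[V] Q.obj d)}
    (h : IsVTrans P Q θ) (E : EnrichedFunctor V D' D) :
    IsVTrans (E ⋙ᵥ P) (E ⋙ᵥ Q) fun d => θ (E.obj d) := by
  intro d d'
  have h' := h (E.obj d) (E.obj d')
  dsimp
  rw [Category.assoc, Category.assoc, h']

theorem IsVTrans.map {P Q : EnrichedFunctor V D C} {θ : ∀ d, 𝟙_ V ⟶ (P.obj d ⟶[V] Q.obj d)}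
    (h : IsVTrans P Q θ) (R : EnrichedFunctor V C C') :
    IsVTrans (P ⋙ᵥ R) (Q ⋙ᵥ R) fun d => θ d ≫ R.map _ _ := by
  intro d d'
  have h' := h d d'
  dsimp
  rw [Category.assoc, Category.assoc, ← post_map, ← pre_map, reassoc_of% h']

theorem IsVTrans.symm {P Q : EnrichedFunctor V D C} {θ : ∀ d, 𝟙_ V ⟶ (P.obj d ⟶[V] Q.obj d)}
    {η : ∀ d, 𝟙_ V ⟶ (Q.obj d ⟶[V] P.obj d)} (h : IsVTrans P Q θ)
    (h' : ∀ d, IsInverse (θ d) (η d)) : IsVTrans Q P η := by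
  intro d d'
  have h1 := eq_whisker (h d d') (post (P.obj d) (η d') ≫ pre (η d) (P.obj d'))
  rw [Category.assoc, Category.assoc, (h' d').post_post_assoc, pre_post_assoc,
    (h' d).pre_pre, Category.comp_id] at h1
  exact h1.symm

end Nat
end
end EnrichedKan

namespace EnrichedKan

noncomputable section

variable {V : Type v} [Category.{w} V] [MonoidalCategory V] [SymmetricCategory V]

/-! ### `V`-natural isomorphisms and `V`-adjunctions in terms of underlying morphisms -/

section

variable {C : Type*} {D : Type*} [EnrichedCategory V C] [EnrichedCategory V D]

/-- When the parameter object is the unit of `V`, unitors remove both the extra tensor factor and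
the braiding. -/
theorem vNatural_iff_isVTrans {P Q : EnrichedFunctor V D C}
    (θ : ∀ d, 𝟙_ V ⟶ (P.obj d ⟶[V] Q.obj d)) : VNatural P Q (𝟙_ V) θ ↔ IsVTrans P Q θ := by
  refine forall_congr' fun d => forall_congr' fun d' => ?_
  have h1 : (λ_ _).inv ≫ (θ d ⊗ₘ Q.map d d') ≫ eComp V (P.obj d) (Q.obj d) (Q.obj d') =
      Q.map d d' ≫ pre (θ d) (Q.obj d') := by
    rw [pre, leftUnitor_inv_naturality_assoc, MonoidalCategory.tensorHom_def', Category.assoc]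
  have h2 : (λ_ _).inv ≫ (β_ (𝟙_ V) (d ⟶[V] d')).hom ≫ (P.map d d' ⊗ₘ θ d') ≫
        eComp V (P.obj d) (P.obj d') (Q.obj d') =
      P.map d d' ≫ post (P.obj d) (θ d') := by
    rw [post, rightUnitor_inv_naturality_assoc, MonoidalCategory.tensorHom_def, Category.assoc,
      leftUnitor_inv_braiding_assoc]
  rw [← cancel_epi (λ_ (d ⟶[V] d')).inv, h1, h2, eq_comm]

namespace VNatIso

variable {P Q : EnrichedFunctor V D C} (i : VNatIso P Q)

/-- The components of a `V`-natural isomorphism, as morphisms of `V`. -/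
def hom (d : D) : 𝟙_ V ⟶ (P.obj d ⟶[V] Q.obj d) := ForgetEnrichment.homTo V (i.iso d).hom

/-- The inverses of the components of a `V`-natural isomorphism, as morphisms of `V`. -/
def inv (d : D) : 𝟙_ V ⟶ (Q.obj d ⟶[V] P.obj d) := ForgetEnrichment.homTo V (i.iso d).inv

end VNatIso

omit [SymmetricCategory V] in
theorem homTo_comp' {x y z : C} (f : ForgetEnrichment.of V x ⟶ ForgetEnrichment.of V y)
    (g : ForgetEnrichment.of V y ⟶ ForgetEnrichment.of V z) :
    (ForgetEnrichment.homTo V (f ≫ g) : 𝟙_ V ⟶ (x ⟶[V] z)) =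
      (ForgetEnrichment.homTo V f : 𝟙_ V ⟶ (x ⟶[V] y)) ≫
        post x (ForgetEnrichment.homTo V g : 𝟙_ V ⟶ (y ⟶[V] z)) := by
  have h (f : 𝟙_ V ⟶ (x ⟶[V] y)) (g : 𝟙_ V ⟶ (y ⟶[V] z)) :
      ((λ_ (𝟙_ V)).inv ≫ (f ⊗ₘ g)) ≫ eComp V x y z = f ≫ post x g := by
    rw [post, rightUnitor_inv_naturality_assoc, unitors_inv_equal, Category.assoc,
      MonoidalCategory.tensorHom_def, Category.assoc]
  -- Composition in the underlying category unfolds definitionally to the left-hand side of `h`.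
  exact h _ _

namespace VNatIso

variable {P Q : EnrichedFunctor V D C} (i : VNatIso P Q)

theorem isInverse (d : D) : IsInverse (i.hom d) (i.inv d) where
  hom_inv := by
    refine (homTo_comp' _ _).symm.trans ?_
    exact (congrArg _ (i.iso d).hom_inv_id).trans (ForgetEnrichment.homTo_id V _)
  inv_hom := by
    refine (homTo_comp' _ _).symm.trans ?_
    exact (congrArg _ (i.iso d).inv_hom_id).trans (ForgetEnrichment.homTo_id V _)

theorem isVTrans_hom : IsVTrans P Q i.hom := (vNatural_iff_isVTrans _).1 i.natural

/-- A `V`-natural isomorphism from a `V`-natural family of morphisms of `V` and inverses. -/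
def mk' (θ : ∀ d, 𝟙_ V ⟶ (P.obj d ⟶[V] Q.obj d)) (η : ∀ d, 𝟙_ V ⟶ (Q.obj d ⟶[V] P.obj d))
    (h : ∀ d, IsInverse (θ d) (η d)) (hθ : IsVTrans P Q θ) : VNatIso P Q where
  iso d :=
    { hom := ForgetEnrichment.homOf V (θ d)
      inv := ForgetEnrichment.homOf V (η d)
      hom_inv_id := (homTo_comp' _ _).trans ((h d).hom_inv.trans
        (ForgetEnrichment.homTo_id V _).symm)
      inv_hom_id := (homTo_comp' _ _).trans ((h d).inv_hom.trans
        (ForgetEnrichment.homTo_id V _).symm) }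
  natural := (vNatural_iff_isVTrans _).2 hθ

end VNatIso

namespace VAdjunction

variable {L : EnrichedFunctor V D C} {R : EnrichedFunctor V C D} (h : VAdjunction L R)

/-- The unit of a `V`-adjunction. -/
def unit (d : D) : 𝟙_ V ⟶ (d ⟶[V] R.obj (L.obj d)) := eId V (L.obj d) ≫ (h.homIso d _).hom

/-- The counit of a `V`-adjunction. -/
def counit (c : C) : 𝟙_ V ⟶ (L.obj (R.obj c) ⟶[V] c) := eId V (R.obj c) ≫ (h.homIso _ c).inv

omit [SymmetricCategory V] in
-- The Yoneda argument: naturality in `c`, evaluated at the identity of `L d`, shows that the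
-- isomorphism is determined by the image of that identity.
theorem homIso_hom (d : D) (c : C) :
    (h.homIso d c).hom = R.map (L.obj d) c ≫ pre (h.unit d) (R.obj c) := by
  have h1 := (λ_ _).inv ≫= eId V (L.obj d) ▷ _ ≫= h.natural_right d (L.obj d) c
  rw [e_id_comp_assoc, whiskerRight_comp_tensorHom_assoc] at h1
  rw [h1, pre, leftUnitor_inv_naturality_assoc, MonoidalCategory.tensorHom_def', Category.assoc]
  rfl

omit [SymmetricCategory V] in
theorem homIso_hom_assoc (d : D) (c : C) {Z : V} (k : (d ⟶[V] R.obj c) ⟶ Z) :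
    (h.homIso d c).hom ≫ k = R.map (L.obj d) c ≫ pre (h.unit d) (R.obj c) ≫ k := by
  rw [homIso_hom, Category.assoc]

omit [SymmetricCategory V] in
-- Naturality in `d`, evaluated at the identity of `L d'`.
theorem isVTrans_unit : IsVTrans (vid V D) (L ⋙ᵥ R) h.unit := by
  intro d d'
  have h1 := (ρ_ _).inv ≫= _ ◁ eId V (L.obj d') ≫= h.natural_left d d' (L.obj d')
  rw [whisker_exchange_assoc, ← rightUnitor_inv_naturality_assoc, e_comp_id_assoc,
    ← MonoidalCategory.whiskerLeft_comp_assoc] at h1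
  rw [Category.id_comp, Category.assoc, ← homIso_hom, h1, post]
  rfl

omit [SymmetricCategory V] in
theorem homIso_hom_post (d : D) {c c' : C} (u : 𝟙_ V ⟶ (c ⟶[V] c')) :
    post (L.obj d) u ≫ (h.homIso d c').hom = (h.homIso d c).hom ≫ post d (u ≫ R.map c c') := by
  rw [homIso_hom, homIso_hom, post_map_assoc, Category.assoc, pre_post]

omit [SymmetricCategory V] in
theorem unit_counit (c : C) :
    h.unit (R.obj c) ≫ post _ (h.counit c ≫ R.map _ c) = eId V (R.obj c) := by
  have h1 : h.counit c ≫ (h.homIso _ c).hom = eId V (R.obj c) := by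
    rw [counit, Category.assoc, Iso.inv_hom_id, Category.comp_id]
  rw [homIso_hom, ← Category.assoc, comp_pre] at h1
  exact h1

/-- It suffices that the right-hand side followed by `homIso.hom` is the identity, and this follows
from naturality of the unit and one triangle identity. -/
theorem homIso_inv (d : D) (c : C) :
    (h.homIso d c).inv = L.map d (R.obj c) ≫ post (L.obj d) (h.counit c) := by
  rw [← cancel_mono (h.homIso d c).hom, Iso.inv_hom_id, Category.assoc, homIso_hom_post,
    homIso_hom]
  have h1 := h.isVTrans_unit d (R.obj c)
  rw [Category.id_comp, Category.assoc] at h1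
  rw [Category.assoc, ← reassoc_of% h1, ← post_comp, unit_counit, post_id]

theorem unit_map_counit (d : D) :
    (h.unit d ≫ L.map d _) ≫ post _ (h.counit (L.obj d)) = eId V (L.obj d) := by
  rw [Category.assoc, ← homIso_inv, unit, Category.assoc, Iso.hom_inv_id, Category.comp_id]

theorem isVTrans_counit : IsVTrans (R ⋙ᵥ L) (vid V C) h.counit := by
  intro c c'
  rw [Category.assoc, ← homIso_inv, Iso.comp_inv_eq, homIso_hom, Category.id_comp, pre_map_assoc,
    ← pre_comp, unit_counit, pre_id, Category.comp_id]

end VAdjunction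

end

/-! ### The tensor product of `V`-categories -/

section Tensor

variable {C : Type*} {C' : Type*} {D : Type*} {D' : Type*} {E : Type*} {E' : Type*}
  [EnrichedCategory V C] [EnrichedCategory V C'] [EnrichedCategory V D] [EnrichedCategory V D']
  [EnrichedCategory V E] [EnrichedCategory V E']

/-- The pair of two underlying morphisms. -/
def upair {x y : C} {x' y' : C'} (u : 𝟙_ V ⟶ (x ⟶[V] y)) (v : 𝟙_ V ⟶ (x' ⟶[V] y')) :
    𝟙_ V ⟶ ((⟨x, x'⟩ : TensorCat C C') ⟶[V] ⟨y, y'⟩) :=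
  (λ_ (𝟙_ V)).inv ≫ (u ⊗ₘ v)

/-- With unit objects in its first two slots, the interchange `tensorμ` is built from unitors alone,
so underlying morphisms act componentwise. -/
theorem pre_upair {x y : C} {x' y' : C'} (u : 𝟙_ V ⟶ (x ⟶[V] y)) (v : 𝟙_ V ⟶ (x' ⟶[V] y'))
    (z : TensorCat C C') : pre (upair u v) z = pre u z.fst ⊗ₘ pre v z.snd := by
  change (λ_ _).inv ≫ ((λ_ (𝟙_ V)).inv ≫ (u ⊗ₘ v)) ▷ _ ≫ tensorμ _ _ _ _ ≫
    (eComp V _ _ _ ⊗ₘ eComp V _ _ _) = _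
  have h : (λ_ _).inv ≫ (λ_ (𝟙_ V)).inv ▷ _ ≫ tensorμ _ _ (y ⟶[V] z.fst) (y' ⟶[V] z.snd) =
      (λ_ _).inv ⊗ₘ (λ_ _).inv := by
    rw [Iso.inv_comp_eq, tensor_left_unitality, Category.assoc, Category.assoc,
      tensorHom_comp_tensorHom, Iso.hom_inv_id, Iso.hom_inv_id, id_tensorHom_id, Category.comp_id]
  rw [comp_whiskerRight_assoc, tensorμ_natural_left_assoc, reassoc_of% h,
    tensorHom_comp_tensorHom, tensorHom_comp_tensorHom, pre, pre]

theorem post_upair {x y : C} {x' y' : C'} (u : 𝟙_ V ⟶ (x ⟶[V] y)) (v : 𝟙_ V ⟶ (x' ⟶[V] y'))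
    (z : TensorCat C C') : post z (upair u v) = post z.fst u ⊗ₘ post z.snd v := by
  change (ρ_ _).inv ≫ _ ◁ ((λ_ (𝟙_ V)).inv ≫ (u ⊗ₘ v)) ≫ tensorμ _ _ _ _ ≫
    (eComp V _ _ _ ⊗ₘ eComp V _ _ _) = _
  have h : (ρ_ _).inv ≫ _ ◁ (λ_ (𝟙_ V)).inv ≫ tensorμ (z.fst ⟶[V] x) (z.snd ⟶[V] x') _ _ =
      (ρ_ _).inv ⊗ₘ (ρ_ _).inv := by
    rw [Iso.inv_comp_eq, tensor_right_unitality, Category.assoc, Category.assoc,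
      tensorHom_comp_tensorHom, Iso.hom_inv_id, Iso.hom_inv_id, id_tensorHom_id, Category.comp_id]
  rw [MonoidalCategory.whiskerLeft_comp_assoc, tensorμ_natural_right_assoc, reassoc_of% h,
    tensorHom_comp_tensorHom, tensorHom_comp_tensorHom, post, post]

theorem IsNat.tensor {G : EnrichedFunctor V D C} {H : EnrichedFunctor V D E}
    {G' : EnrichedFunctor V D' C'} {H' : EnrichedFunctor V D' E'} {x : C} {y : E} {x' : C'}
    {y' : E'}
    {m : ∀ d, (G.obj d ⟶[V] x) ⟶ (H.obj d ⟶[V] y)}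
    {m' : ∀ d, (G'.obj d ⟶[V] x') ⟶ (H'.obj d ⟶[V] y')} (h : IsNat G H x y m)
    (h' : IsNat G' H' x' y' m') :
    IsNat (tensorFunctor G G') (tensorFunctor H H') ⟨x, x'⟩ ⟨y, y'⟩
      fun d => m d.fst ⊗ₘ m' d.snd := by
  intro d d'
  change (_ ⊗ₘ _) ▷ _ ≫ (tensorμ _ _ _ _ ≫ (_ ⊗ₘ _)) ≫ _ =
    (_ ⊗ₘ _) ≫ tensorμ _ _ _ _ ≫ (_ ⊗ₘ _)
  rw [Category.assoc, tensorμ_natural_left_assoc, tensorHom_comp_tensorHom,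
    tensorHom_comp_tensorHom, h, h', tensorμ_natural_assoc, tensorHom_comp_tensorHom]

theorem IsConat.tensor {G : EnrichedFunctor V D C} {H : EnrichedFunctor V D E}
    {G' : EnrichedFunctor V D' C'} {H' : EnrichedFunctor V D' E'} {x : C} {y : E} {x' : C'}
    {y' : E'}
    {m : ∀ d, (x ⟶[V] G.obj d) ⟶ (y ⟶[V] H.obj d)}
    {m' : ∀ d, (x' ⟶[V] G'.obj d) ⟶ (y' ⟶[V] H'.obj d)} (h : IsConat G H x y m)
    (h' : IsConat G' H' x' y' m') :
    IsConat (tensorFunctor G G') (tensorFunctor H H') ⟨x, x'⟩ ⟨y, y'⟩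
      fun d => m d.fst ⊗ₘ m' d.snd := by
  intro d d'
  change _ ◁ (_ ⊗ₘ _) ≫ (tensorμ _ _ _ _ ≫ (_ ⊗ₘ _)) ≫ _ =
    (_ ⊗ₘ _) ≫ tensorμ _ _ _ _ ≫ (_ ⊗ₘ _)
  rw [Category.assoc, tensorμ_natural_right_assoc, tensorHom_comp_tensorHom,
    tensorHom_comp_tensorHom, h, h', tensorμ_natural_assoc, tensorHom_comp_tensorHom]

end Tensor

end
end EnrichedKan

namespace EnrichedKan

noncomputable section

variable {V : Type v} [Category.{w} V] [MonoidalCategory V]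

/-! ### Colimits weighted by `C(G -, q)` -/

section Colimit

variable {C : Type*} {D : Type*} {X : Type*} [EnrichedCategory V C] [EnrichedCategory V D]
  [EnrichedCategory V X]

/-- A family `W i ⟶ X(G i, x)` is jointly epimorphic when generalized elements of the
hom-objects `X(x, y)` are determined by their composites with the family. -/
def JointEpi {I : Type*} {W : I → V} {G : I → X} {x : X} (l : ∀ i, W i ⟶ (G i ⟶[V] x)) : Prop :=
  ∀ (y : X) (Z : V) (f g : Z ⟶ (x ⟶[V] y)),
    (∀ i, (l i ⊗ₘ f) ≫ eComp V (G i) x y = (l i ⊗ₘ g) ≫ eComp V (G i) x y) → f = g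

theorem comp_post {W : V} {x y z : X} (l : W ⟶ (x ⟶[V] y)) (f : 𝟙_ V ⟶ (y ⟶[V] z)) :
    l ≫ post x f = (ρ_ W).inv ≫ (l ⊗ₘ f) ≫ eComp V x y z := by
  rw [post, rightUnitor_inv_naturality_assoc, MonoidalCategory.tensorHom_def, Category.assoc]

theorem JointEpi.ext {I : Type*} {W : I → V} {G : I → X} {x : X} {l : ∀ i, W i ⟶ (G i ⟶[V] x)}
    (h : JointEpi l) {y : X} {f g : 𝟙_ V ⟶ (x ⟶[V] y)}
    (hfg : ∀ i, l i ≫ post (G i) f = l i ≫ post (G i) g) : f = g := by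
  refine h y _ f g fun i => ?_
  rw [← cancel_epi (ρ_ (W i)).inv, ← comp_post, ← comp_post, hfg]

/-- The family `l` exhibits `x` as the colimit of `F` weighted by `C(G -, q)`. -/
structure IsColim (G : EnrichedFunctor V D C) (q : C) (F : EnrichedFunctor V D X) (x : X)
    (l : ∀ d, (G.obj d ⟶[V] q) ⟶ (F.obj d ⟶[V] x)) : Prop where
  nat : IsNat G F q x l
  jointEpi : JointEpi l
  desc : ∀ (y : X) (m : ∀ d, (G.obj d ⟶[V] q) ⟶ (F.obj d ⟶[V] y)), IsNat G F q y m →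
    ∃ f : 𝟙_ V ⟶ (x ⟶[V] y), ∀ d, l d ≫ post (F.obj d) f = m d

/-- The family `κ` exhibits `K` as a pointwise left Kan extension of `F` along `J`. -/
structure IsKan {A : Type*} {B : Type*} [EnrichedCategory V A] [EnrichedCategory V B]
    (J : EnrichedFunctor V A B) (F : EnrichedFunctor V A X) (K : EnrichedFunctor V B X)
    (κ : ∀ b a, (J.obj a ⟶[V] b) ⟶ (F.obj a ⟶[V] K.obj b)) : Prop where
  conat : ∀ a, IsConat (vid V B) K (J.obj a) (F.obj a) fun b => κ b a
  isColim : ∀ b, IsColim J b F (K.obj b) (κ b)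

/-- `restrict` leaves a spurious composite with an identity, coming from `vid`; it is absorbed here.
-/
theorem IsConat.of_vid {B : Type*} [EnrichedCategory V B] {K : EnrichedFunctor V B X} {b : B}
    {x : X} {κ : ∀ b', (b ⟶[V] b') ⟶ (x ⟶[V] K.obj b')} (h : IsConat (vid V B) K b x κ)
    (R : EnrichedFunctor V D B) : IsConat R (R ⋙ᵥ K) b x fun d => κ (R.obj d) := by
  have h1 := h.restrict R
  intro d d'
  have h2 := h1 d d'
  simp only [Category.comp_id] at h2
  exact h2

theorem isConat_vid_map (R : EnrichedFunctor V C X) (x : C) :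
    IsConat (vid V C) R x (R.obj x) fun c => R.map x c := by
  intro d d'
  have h := isConat_map (vid V C) R x d d'
  simp only [Category.id_comp] at h ⊢
  exact h

theorem IsConat.post {B : Type*} [EnrichedCategory V B] {K : EnrichedFunctor V B X} {b : B} {x : X}
    {κ : ∀ b', (b ⟶[V] b') ⟶ (x ⟶[V] K.obj b')} (h : IsConat (vid V B) K b x κ) {b₁ b₂ : B}
    (u : 𝟙_ V ⟶ (b₁ ⟶[V] b₂)) :
    post b u ≫ κ b₂ = κ b₁ ≫ EnrichedKan.post x (u ≫ K.map b₁ b₂) := by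
  have h1 := h b₁ b₂
  simp only [MonoidalCategory.whiskerLeft_id, Category.id_comp] at h1
  rw [EnrichedKan.post, Category.assoc, Category.assoc, h1, EnrichedKan.post,
    MonoidalCategory.whiskerLeft_comp, rightUnitor_inv_naturality_assoc,
    MonoidalCategory.tensorHom_def, Category.assoc, whisker_exchange_assoc, Category.assoc,
    ← whisker_exchange_assoc, ← whisker_exchange_assoc]

theorem IsNat.pre {G : EnrichedFunctor V D C} {F : EnrichedFunctor V D X} {q : C} {x : X}
    {l : ∀ d, (G.obj d ⟶[V] q) ⟶ (F.obj d ⟶[V] x)} (h : IsNat G F q x l) {d₁ d₂ : D}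
    (u : 𝟙_ V ⟶ (d₁ ⟶[V] d₂)) :
    pre (u ≫ G.map d₁ d₂) q ≫ l d₁ = l d₂ ≫ EnrichedKan.pre (u ≫ F.map d₁ d₂) x := by
  have h1 := h d₁ d₂
  rw [EnrichedKan.pre, comp_whiskerRight, Category.assoc, Category.assoc, Category.assoc, h1,
    EnrichedKan.pre, leftUnitor_inv_naturality_assoc, comp_whiskerRight_assoc,
    MonoidalCategory.tensorHom_def, Category.assoc, whisker_exchange_assoc,
    whisker_exchange_assoc]

end Colimit

/-! ### Comparison of pointwise left Kan extensions along a pair of adjunctions -/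

section Transfer

variable {A : Type*} {A₂ : Type*} {B : Type*} {B₂ : Type*} {X : Type*}
  [EnrichedCategory V A] [EnrichedCategory V A₂] [EnrichedCategory V B] [EnrichedCategory V B₂]
  [EnrichedCategory V X] [SymmetricCategory V]
  {LA : EnrichedFunctor V A A₂} {RA : EnrichedFunctor V A₂ A} (hA : VAdjunction LA RA)
  {LB : EnrichedFunctor V B B₂} {RB : EnrichedFunctor V B₂ B} (hB : VAdjunction LB RB)
  {J : EnrichedFunctor V A B} {J₂ : EnrichedFunctor V A₂ B₂}
  (ψ : ∀ a, 𝟙_ V ⟶ (LB.obj (J.obj a) ⟶[V] J₂.obj (LA.obj a)))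

/-- The mate `J R ⟶ R J₂` of a transformation `ψ : L J ⟶ J₂ L`. -/
def mate (p : A₂) : 𝟙_ V ⟶ (J.obj (RA.obj p) ⟶[V] RB.obj (J₂.obj p)) :=
  (hB.unit (J.obj (RA.obj p)) ≫ post _ (ψ (RA.obj p) ≫ RB.map _ _)) ≫
    post _ ((hA.counit p ≫ J₂.map _ _) ≫ RB.map _ _)

/-- The mate is the transpose under `LB ⊣ RB` of `ψ` followed by the counit of the other adjunction;
transposing back recovers that composite. -/
theorem mate_counit (p : A₂) :
    (mate hA hB ψ p ≫ LB.map _ _) ≫ post _ (hB.counit (J₂.obj p)) =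
      ψ (RA.obj p) ≫ post _ (hA.counit p ≫ J₂.map _ _) := by
  rw [Category.assoc, ← hB.homIso_inv, Iso.comp_inv_eq, hB.homIso_hom, ← Category.assoc, comp_pre,
    mate, Category.assoc, ← post_comp, Category.assoc (ψ _), ← post_map, Category.assoc]

variable {ψ}

/-- The mate is a composite of three natural pieces: the unit of `LB ⊣ RB`, the image of `ψ` under
`RB`, and the image of the counit of `LA ⊣ RA` under `J₂` and `RB`. Their squares are pasted. -/
theorem isVTrans_mate (hψ : IsVTrans (J ⋙ᵥ LB) (LA ⋙ᵥ J₂) ψ) :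
    IsVTrans (RA ⋙ᵥ J) (J₂ ⋙ᵥ RB) (mate hA hB ψ) := by
  intro d d'
  have h1 := RA.map d d' ≫= J.map _ _ ≫= hB.isVTrans_unit (J.obj (RA.obj d)) (J.obj (RA.obj d'))
  have h2 := ((hψ.restrict RA).map RB) d d'
  have h3 := ((hA.isVTrans_counit.map J₂).map RB) d d'
  simp only [Category.assoc, Category.id_comp] at h1 h2 h3
  rw [mate, mate, post_comp, post_comp, pre_comp, pre_comp]
  simp only [Category.assoc]
  rw [reassoc_of% h1, pre_post_assoc, reassoc_of% h2, pre_post, pre_post_assoc, reassoc_of% h3]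

/-- The counit of `LA ⊣ RA` hidden in the mate cancels against the unit by a triangle identity, once
naturality has brought them together. -/
theorem unit_mate (hψ : IsVTrans (J ⋙ᵥ LB) (LA ⋙ᵥ J₂) ψ) (a : A) :
    (hA.unit a ≫ J.map _ _) ≫ post _ (mate hA hB ψ (LA.obj a)) =
      hB.unit (J.obj a) ≫ post _ (ψ a ≫ RB.map _ _) := by
  have h1 := hA.unit a ≫= J.map _ _ ≫= hB.isVTrans_unit (J.obj a) (J.obj (RA.obj (LA.obj a)))
  have h2 := hA.unit a ≫= hψ a (RA.obj (LA.obj a))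
  have h3 := hA.unit_map_counit a
  rw [Category.id_comp] at h1
  simp only [Category.assoc] at h1 h2 h3
  rw [mate, post_comp, post_comp, Category.assoc, Category.assoc, reassoc_of% h1,
    pre_post_assoc, pre_post, ← post_map_assoc, ← post_map_assoc, reassoc_of% h2,
    pre_post_assoc, ← post_map_assoc, reassoc_of% h3, EnrichedFunctor.map_id_assoc,
    eId_pre_assoc, ← Category.assoc, comp_pre]

variable {F : EnrichedFunctor V A X} {F₂ : EnrichedFunctor V A₂ X}
  {K : EnrichedFunctor V B X} {K₂ : EnrichedFunctor V B₂ X}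
  {κ : ∀ b a, (J.obj a ⟶[V] b) ⟶ (F.obj a ⟶[V] K.obj b)}
  {κ₂ : ∀ q p, (J₂.obj p ⟶[V] q) ⟶ (F₂.obj p ⟶[V] K₂.obj q)}
  {φ : ∀ p, 𝟙_ V ⟶ (F₂.obj p ⟶[V] F.obj (RA.obj p))}
  {φ' : ∀ p, 𝟙_ V ⟶ (F.obj (RA.obj p) ⟶[V] F₂.obj p)}
  {ψ' : ∀ a, 𝟙_ V ⟶ (J₂.obj (LA.obj a) ⟶[V] LB.obj (J.obj a))}

omit [EnrichedCategory V B] [EnrichedCategory V B₂] in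
-- Last step of the family that induces the inverse comparison in `exists_comparison`.
theorem isNat_pre_unit (F : EnrichedFunctor V A X) (x : X) :
    IsNat (LA ⋙ᵥ RA ⋙ᵥ F) F x x fun a => pre (hA.unit a ≫ F.map _ _) x := by
  have h : IsVTrans F (LA ⋙ᵥ RA ⋙ᵥ F) fun a => hA.unit a ≫ F.map _ _ := by
    intro a a'
    have h1 := (hA.isVTrans_unit.map F) a a'
    simp only [Category.id_comp, Category.assoc] at h1 ⊢
    exact h1
  exact h.isNat x

/-- Restriction along `RA` is left Kan extension along `LA`, so `K ∘ RB` and `K₂` both extend `F ∘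
RA ≅ F₂` along `J₂`. The universal property of `K ∘ RB` is not established separately: maps in both
directions are induced from the two given universal properties and are checked to be inverse on the
colimiting families. The last clause determines `M` and is what the coherence arguments use. -/
theorem exists_comparison (hψ : IsVTrans (J ⋙ᵥ LB) (LA ⋙ᵥ J₂) ψ)
    (hψ' : ∀ a, IsInverse (ψ a) (ψ' a)) (hφ : IsVTrans F₂ (RA ⋙ᵥ F) φ)
    (hφ' : ∀ p, IsInverse (φ p) (φ' p)) (hκ : IsKan J F K κ) (hκ₂ : IsKan J₂ F₂ K₂ κ₂) :
    ∃ (M : ∀ q, 𝟙_ V ⟶ (K₂.obj q ⟶[V] K.obj (RB.obj q)))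
      (N : ∀ q, 𝟙_ V ⟶ (K.obj (RB.obj q) ⟶[V] K₂.obj q)),
      (∀ q, IsInverse (M q) (N q)) ∧ IsVTrans K₂ (RB ⋙ᵥ K) M ∧
      ∀ q p, κ₂ q p ≫ post _ (M q) = RB.map (J₂.obj p) q ≫ pre (mate hA hB ψ p) _ ≫
        κ (RB.obj q) (RA.obj p) ≫ pre (φ p) _ := by
  -- Apply `RB` to a map `J₂ p ⟶ q`, precompose with the mate to get `J (RA p) ⟶ RB q`, apply `κ`,
  -- and precompose with `φ`.
  have hm q : IsNat J₂ F₂ q (K.obj (RB.obj q)) fun p => RB.map (J₂.obj p) q ≫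
      pre (mate hA hB ψ p) _ ≫ κ (RB.obj q) (RA.obj p) ≫ pre (φ p) _ :=
    (isNat_map J₂ RB q).comp (((isVTrans_mate hA hB hψ).isNat _).comp
      ((((hκ.isColim (RB.obj q)).nat.restrict RA)).comp (hφ.isNat _)))
  have hm' p : IsConat (vid V B₂) (RB ⋙ᵥ K) (J₂.obj p) (F₂.obj p) fun q => RB.map (J₂.obj p) q ≫
      pre (mate hA hB ψ p) _ ≫ κ (RB.obj q) (RA.obj p) ≫ pre (φ p) _ :=
    (isConat_vid_map RB (J₂.obj p)).comp ((isConat_pre RB _).comp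
      (((hκ.conat (RA.obj p)).of_vid RB).comp (isConat_pre _ _)))
  -- Transpose a map `J a ⟶ RB q` to `LB (J a) ⟶ q`, precompose with the inverse of `ψ`, apply `κ₂`,
  -- and return to `F a` through `φ'` and the unit of `LA ⊣ RA`.
  have hn q : IsNat J F (RB.obj q) (K₂.obj q) fun a => LB.map (J.obj a) (RB.obj q) ≫
      post _ (hB.counit q) ≫ pre (ψ' a) q ≫ κ₂ q (LA.obj a) ≫ pre (φ' (LA.obj a)) _ ≫
        pre (hA.unit a ≫ F.map _ _) _ :=
    (isNat_map J LB (RB.obj q)).comp ((isNat_post _ _).comp (((hψ.symm hψ').isNat _).comp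
      (((hκ₂.isColim q).nat.restrict LA).comp ((((hφ.symm hφ').restrict LA).isNat _).comp
        (isNat_pre_unit hA F _)))))
  choose M hM using fun q => (hκ₂.isColim q).desc _ _ (hm q)
  choose N hN using fun q => (hκ.isColim (RB.obj q)).desc _ _ (hn q)
  refine ⟨M, N, fun q => ⟨?_, ?_⟩, ?_, hM⟩
  -- On the family `κ₂`, `mate_counit` exposes a `ψ` that cancels `ψ'`. The remaining counit of `LA
  -- ⊣ RA` passes through `κ₂` and `φ'` by naturality and meets the unit in a triangle identity.
  · refine (hκ₂.isColim q).jointEpi.ext fun p => ?_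
    have h1 := mate_counit hA hB ψ p
    have h2 := (hκ₂.isColim q).nat.pre (hA.counit p)
    have h3 := hA.counit p ≫= (hφ.symm hφ') (LA.obj (RA.obj p)) p
    have h4 := hA.unit_counit p
    have h5 := hB.isVTrans_counit (J₂.obj p) q
    rw [Category.assoc, Category.id_comp] at h5
    rw [← Category.assoc, ← Category.assoc (hA.counit p) (F₂.map _ _), comp_pre] at h3
    dsimp only at h3
    have h6 : pre (hA.counit p ≫ RA.map _ _ ≫ F.map _ _) (K₂.obj q) ≫
        pre (hA.unit (RA.obj p) ≫ F.map _ _) _ = 𝟙 _ := by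
      rw [← pre_comp, Category.assoc, ← Category.assoc (hA.counit p), ← post_map,
        reassoc_of% h4, EnrichedFunctor.map_id, pre_id]
    rw [post_comp, reassoc_of% hM, post_id, Category.comp_id, pre_post, reassoc_of% hN,
      pre_map_assoc, pre_post_assoc, reassoc_of% h5, ← pre_comp_assoc, h1, pre_comp_assoc,
      (hψ' _).pre_pre_assoc, reassoc_of% h2, ← pre_comp_assoc, ← h3, pre_comp_assoc,
      reassoc_of% h6, (hφ' _).symm.pre_pre, Category.comp_id]
  -- On the family `κ`, the unit of `LA ⊣ RA` passes through `κ`, and `unit_mate` replaces it by the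
  -- unit of `LB ⊣ RB` and `ψ`. What remains is transposition followed by its inverse.
  · refine (hκ.isColim (RB.obj q)).jointEpi.ext fun a => ?_
    have h1 := (hκ.isColim (RB.obj q)).nat.pre (hA.unit a)
    have h2 := unit_mate hA hB hψ a
    rw [post_comp, reassoc_of% hN, post_id, Category.comp_id, pre_post, pre_post_assoc,
      reassoc_of% hM, (hφ' _).pre_pre_assoc, ← h1, ← pre_comp_assoc, h2, pre_comp_assoc,
      ← pre_map_assoc, (hψ' _).symm.pre_pre_assoc, ← hB.homIso_hom_assoc, ← Category.assoc,
      ← Category.assoc, ← hB.homIso_inv, Iso.inv_hom_id, Category.id_comp]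
  -- Naturality of `M` is an equation of maps out of `B₂(q, q')`, so joint epimorphy is needed with
  -- this object as parameter. Both sides agree because `κ₂` and the family in `hm'` are natural in
  -- `q`.
  · intro q q'
    refine (hκ₂.isColim q).jointEpi _ _ _ _ fun p => ?_
    have h1 := hκ₂.conat p q q'
    have h2 := hm' p q q'
    simp only [MonoidalCategory.whiskerLeft_id, Category.id_comp, ← hM] at h1 h2
    have h3 : (κ₂ q p ⊗ₘ K₂.map q q' ≫ post _ (M q')) ≫ eComp V _ _ _ =
        (κ₂ q p ⊗ₘ K₂.map q q') ≫ eComp V _ _ _ ≫ post _ (M q') := by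
      rw [← tensorHom_comp_whiskerLeft_assoc, whiskerLeft_post_eComp]
    have h4 : (κ₂ q p ⊗ₘ (RB ⋙ᵥ K).map q q' ≫ pre (M q) _) ≫ eComp V _ _ _ =
        (κ₂ q p ≫ post _ (M q) ⊗ₘ (RB ⋙ᵥ K).map q q') ≫ eComp V _ _ _ := by
      rw [← tensorHom_comp_whiskerLeft_assoc, ← whiskerRight_post_eComp,
        tensorHom_comp_whiskerRight_assoc]
    rw [h3, ← reassoc_of% h1, h4, h2]

end Transfer

end
end EnrichedKan

namespace EnrichedKan

noncomputable section

variable {V : Type v} [Category.{w} V] [MonoidalCategory V]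

/-- Associativity of composition for generalized elements. -/
theorem eComp_assoc_tensorHom {C : Type*} [EnrichedCategory V C] {x y z t : C} {P Q R : V}
    (f : P ⟶ (x ⟶[V] y)) (g : Q ⟶ (y ⟶[V] z)) (h : R ⟶ (z ⟶[V] t)) :
    ((f ⊗ₘ g) ≫ eComp V x y z ⊗ₘ h) ≫ eComp V x z t =
      (α_ P Q R).hom ≫ (f ⊗ₘ (g ⊗ₘ h) ≫ eComp V y z t) ≫ eComp V x y t := by
  rw [← tensorHom_comp_whiskerRight_assoc, ← e_assoc', associator_naturality_assoc,
    tensorHom_comp_whiskerLeft_assoc]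

/-! ### Weighted colimits in uncurried form -/

section Weighted

variable {C : Type*} {D : Type*} {X : Type*} [EnrichedCategory V C] [EnrichedCategory V D]
  [EnrichedCategory V X]

/-- `V`-naturality in `d` of a family `C(G d, q) ⊗ Z ⟶ X(F d, y)`. -/
def IsParamNat (G : EnrichedFunctor V D C) (q : C) (F : EnrichedFunctor V D X) (y : X) (Z : V)
    (m : ∀ d, (G.obj d ⟶[V] q) ⊗ Z ⟶ (F.obj d ⟶[V] y)) : Prop :=
  ∀ d' d : D, (G.map d' d ▷ (G.obj d ⟶[V] q) ≫ eComp V (G.obj d') (G.obj d) q) ▷ Z ≫ m d' =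
    (α_ _ _ _).hom ≫ (F.map d' d ⊗ₘ m d) ≫ eComp V (F.obj d') (F.obj d) y

/-- The existence part of the universal property of a colimit weighted by `C(G -, q)`. -/
def HasParamDesc (G : EnrichedFunctor V D C) (q : C) (F : EnrichedFunctor V D X) (x : X)
    (l : ∀ d, (G.obj d ⟶[V] q) ⟶ (F.obj d ⟶[V] x)) : Prop :=
  ∀ (y : X) (Z : V) (m : ∀ d, (G.obj d ⟶[V] q) ⊗ Z ⟶ (F.obj d ⟶[V] y)), IsParamNat G q F y Z m →
    ∃ f : Z ⟶ (x ⟶[V] y), ∀ d, (l d ⊗ₘ f) ≫ eComp V (F.obj d) x y = m d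

theorem isParamNat_unit_iff (G : EnrichedFunctor V D C) (q : C) (F : EnrichedFunctor V D X) (y : X)
    (m : ∀ d, (G.obj d ⟶[V] q) ⟶ (F.obj d ⟶[V] y)) :
    IsParamNat G q F y (𝟙_ V) (fun d => (ρ_ _).hom ≫ m d) ↔ IsNat G F q y m := by
  refine forall_congr' fun d' => forall_congr' fun d => ?_
  have h : (α_ _ _ (𝟙_ V)).hom ≫ (F.map d' d ⊗ₘ (ρ_ (G.obj d ⟶[V] q)).hom ≫ m d) =
      (ρ_ _).hom ≫ (F.map d' d ⊗ₘ m d) := by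
    rw [← whiskerLeft_comp_tensorHom, rightUnitor_tensor_hom_assoc]
  rw [rightUnitor_naturality_assoc, reassoc_of% h, cancel_epi, Category.assoc]

theorem IsNat.isParamNat {G : EnrichedFunctor V D C} {q : C} {F : EnrichedFunctor V D X} {x : X}
    {l : ∀ d, (G.obj d ⟶[V] q) ⟶ (F.obj d ⟶[V] x)} (h : IsNat G F q x l) {y : X} {Z : V}
    (f : Z ⟶ (x ⟶[V] y)) :
    IsParamNat G q F y Z fun d => (l d ⊗ₘ f) ≫ eComp V (F.obj d) x y := by
  intro d' d
  have h1 := h d' d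
  dsimp only
  rw [whiskerRight_comp_tensorHom_assoc, Category.assoc, h1, eComp_assoc_tensorHom]

end Weighted

/-! ### From the curried universal property of weighted colimits to generalized elements. -/

section Closed

open MonoidalClosed

variable [SymmetricCategory V] [MonoidalClosed V]

omit [SymmetricCategory V] in
theorem curry_tensorHom_curry_comp {P Q R S T : V} (f : P ⊗ Q ⟶ R) (g : R ⊗ S ⟶ T) :
    (curry f ⊗ₘ curry g) ≫ comp P R T = curry ((α_ _ _ _).inv ≫ f ▷ _ ≫ g) := by
  rw [comp_eq, ← curry_natural_left, compTranspose_eq]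
  congr 1
  rw [MonoidalCategory.tensorHom_def, MonoidalCategory.whiskerLeft_comp_assoc,
    associator_inv_naturality_right_assoc, associator_inv_naturality_middle_assoc,
    whisker_exchange_assoc, ← comp_whiskerRight_assoc, whiskerLeft_curry_ihom_ev_app]
  congr 2
  exact whiskerLeft_curry_ihom_ev_app _ _ g

variable {C : Type u₁} {D : Type u₂} {X : Type u₃} [EnrichedCategory V C] [EnrichedCategory V D]
  [EnrichedCategory V X]

/-- Currying is injective, so the two equations can be compared uncurried. They then differ only in
the braidings contributed by `VNatural` and by the representables, which match by a hexagon
identity. -/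
theorem vNatural_curry_iff (G : EnrichedFunctor V D C) (q : C) (F : EnrichedFunctor V D X) (y : X)
    (Z : V) (m : ∀ d, (G.obj d ⟶[V] q) ⊗ Z ⟶ (F.obj d ⟶[V] y)) :
    VNatural (homInto G q) (homInto F y) Z (fun c => curry (m c.unop)) ↔
      IsParamNat G q F y Z m := by
  have key (d' d : D) :
      (curry (m d) ⊗ₘ (F.map d' d ≫ curry ((β_ _ _).hom ≫ eComp V (F.obj d') (F.obj d) y))) ≫
          comp _ _ _ =
        (β_ Z _).hom ≫ ((G.map d' d ≫ curry ((β_ _ _).hom ≫ eComp V (G.obj d') (G.obj d) q)) ⊗ₘ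
          curry (m d')) ≫ comp _ _ _ ↔
      (G.map d' d ▷ (G.obj d ⟶[V] q) ≫ eComp V (G.obj d') (G.obj d) q) ▷ Z ≫ m d' =
        (α_ _ _ _).hom ≫ (F.map d' d ⊗ₘ m d) ≫ eComp V (F.obj d') (F.obj d) y := by
    rw [← curry_natural_left, ← curry_natural_left, curry_tensorHom_curry_comp,
      curry_tensorHom_curry_comp, ← curry_natural_left, curry_injective.eq_iff,
      BraidedCategory.braiding_naturality_right_assoc,
      BraidedCategory.braiding_naturality_right_assoc,
      BraidedCategory.braiding_naturality_left_assoc]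
    have h : (G.obj d ⟶[V] q) ◁ (β_ Z (d' ⟶[V] d)).hom ≫ (α_ _ _ _).inv ≫ (β_ _ _).hom ▷ Z ≫
        (α_ _ _ _).hom = (α_ _ _ _).inv ≫ (β_ (_ ⊗ Z) (d' ⟶[V] d)).hom := by
      simp
    rw [← MonoidalCategory.tensorHom_def'_assoc, ← reassoc_of% h, comp_whiskerRight_assoc, cancel_epi, cancel_epi, cancel_epi, eq_comm]
  constructor
  · intro h d' d
    exact (key d' d).1 (h (op d) (op d'))
  · intro h d d'
    exact (key d'.unop d.unop).2 (h d'.unop d.unop)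

omit [SymmetricCategory V] in
theorem curry_whiskerRight_eComp {W Z : V} {x y z : X} (l : W ⟶ (x ⟶[V] y)) (f : Z ⟶ (y ⟶[V] z)) :
    f ≫ curry (l ▷ _ ≫ eComp V x y z) = curry ((l ⊗ₘ f) ≫ eComp V x y z) := by
  rw [← curry_natural_left, MonoidalCategory.tensorHom_def', Category.assoc]

variable {G : EnrichedFunctor V D C} {q : C} {F : EnrichedFunctor V D X} {x : X}
  {l : ∀ d, (G.obj d ⟶[V] q) ⟶ (F.obj d ⟶[V] x)}

theorem IsWeightedColimit.isNat (h : IsWeightedColimit (homInto G q) F x l) : IsNat G F q x l :=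
  (isParamNat_unit_iff G q F x l).1 ((vNatural_curry_iff G q F x _ _).1 h.natural)

/-- The uniqueness clause is applied to the family induced by `g`; by assumption `f` induces the
same family. -/
theorem IsWeightedColimit.jointEpi (h : IsWeightedColimit (homInto G q) F x l) : JointEpi l := by
  intro y Z f g hfg
  refine (h.universal y Z (fun c => curry ((l c.unop ⊗ₘ g) ≫ eComp V _ x y))
    ((vNatural_curry_iff G q F y Z _).2 (h.isNat.isParamNat g))).unique (fun c => ?_) fun c => ?_
  · rw [curry_whiskerRight_eComp, hfg]
  · rw [curry_whiskerRight_eComp]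

theorem IsWeightedColimit.hasParamDesc (h : IsWeightedColimit (homInto G q) F x l) :
    HasParamDesc G q F x l := by
  intro y Z m hm
  obtain ⟨f, hf, -⟩ := h.universal y Z _ ((vNatural_curry_iff G q F y Z m).2 hm)
  refine ⟨f, fun d => curry_injective ?_⟩
  rw [← curry_whiskerRight_eComp, hf]

end Closed

section

variable {C : Type*} {D : Type*} {X : Type*} [EnrichedCategory V C] [EnrichedCategory V D]
  [EnrichedCategory V X]
  {G : EnrichedFunctor V D C} {q : C} {F : EnrichedFunctor V D X} {x : X}
  {l : ∀ d, (G.obj d ⟶[V] q) ⟶ (F.obj d ⟶[V] x)}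

theorem HasParamDesc.desc (h : HasParamDesc G q F x l) (y : X)
    (m : ∀ d, (G.obj d ⟶[V] q) ⟶ (F.obj d ⟶[V] y)) (hm : IsNat G F q y m) :
    ∃ f : 𝟙_ V ⟶ (x ⟶[V] y), ∀ d, l d ≫ post (F.obj d) f = m d := by
  obtain ⟨f, hf⟩ := h y _ _ ((isParamNat_unit_iff G q F y m).2 hm)
  refine ⟨f, fun d => ?_⟩
  rw [comp_post, hf, Iso.inv_hom_id_assoc]

end

/-! ### Colimits in two variables -/

section TwoVar

variable [SymmetricCategory V] {C : Type*} {C' : Type*} {E : Type*} [EnrichedCategory V C]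
  [EnrichedCategory V C'] [EnrichedCategory V E]

/-- The `V`-functor `P(-, x')`. -/
abbrev partialFst (P : EnrichedFunctor V (TensorCat C C') E) (x' : C') : EnrichedFunctor V C E where
  obj x := P.obj ⟨x, x'⟩
  map x y := ((ρ_ (x ⟶[V] y)).inv ≫ (𝟙 (x ⟶[V] y) ⊗ₘ eId V x')) ≫ P.map ⟨x, x'⟩ ⟨y, x'⟩
  map_id := ((pairRight V C x').comp V P).map_id
  map_comp := ((pairRight V C x').comp V P).map_comp

/-- The `V`-functor `P(x, -)`. -/
abbrev partialSnd (P : EnrichedFunctor V (TensorCat C C') E) (x : C) : EnrichedFunctor V C' E where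
  obj x' := P.obj ⟨x, x'⟩
  map x' y' := ((λ_ (x' ⟶[V] y')).inv ≫ (eId V x ⊗ₘ 𝟙 (x' ⟶[V] y'))) ≫ P.map ⟨x, x'⟩ ⟨x, y'⟩
  map_id := ((pairLeft V C' x).comp V P).map_id
  map_comp := ((pairLeft V C' x).comp V P).map_comp

/-- A pair of morphisms factors as the first with an identity, followed by an identity with the
second. The interchange is trivial here because its two middle factors are unit objects. -/
theorem map_eq_fst_snd (P : EnrichedFunctor V (TensorCat C C') E) (x y : C) (x' y' : C') :
    P.map ⟨x, x'⟩ ⟨y, y'⟩ = ((partialFst P x').map x y ⊗ₘ (partialSnd P y).map x' y') ≫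
      eComp V (P.obj ⟨x, x'⟩) (P.obj ⟨y, x'⟩) (P.obj ⟨y, y'⟩) := by
  rw [← tensorHom_comp_tensorHom, Category.assoc, ← P.map_comp]
  change _ = _ ≫ (tensorμ _ _ _ _ ≫ (eComp V _ _ _ ⊗ₘ eComp V _ _ _)) ≫ _
  have h : ((ρ_ (x ⟶[V] y)).inv ⊗ₘ (λ_ (x' ⟶[V] y')).inv) ≫ tensorμ _ _ _ _ =
      ((ρ_ (x ⟶[V] y)).inv ⊗ₘ (λ_ (x' ⟶[V] y')).inv) := by
    simp only [tensorμ, braiding_tensorUnit_left]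
    monoidal
  rw [← tensorHom_comp_tensorHom, Category.assoc, Category.assoc, tensorμ_natural_assoc,
    reassoc_of% h, tensorHom_comp_tensorHom_assoc, tensorHom_comp_tensorHom_assoc,
    id_tensorHom, tensorHom_id, Category.assoc, Category.assoc, e_comp_id, e_id_comp, id_tensorHom_id]
  exact (Category.id_comp _).symm

/-- The factorisation in the other order, at the cost of one braiding. -/
theorem map_eq_snd_fst (P : EnrichedFunctor V (TensorCat C C') E) (x y : C) (x' y' : C') :
    P.map ⟨x, x'⟩ ⟨y, y'⟩ = (β_ _ _).hom ≫
      ((partialSnd P x).map x' y' ⊗ₘ (partialFst P y').map x y) ≫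
        eComp V (P.obj ⟨x, x'⟩) (P.obj ⟨x, y'⟩) (P.obj ⟨y, y'⟩) := by
  rw [← tensorHom_comp_tensorHom, Category.assoc, ← P.map_comp]
  change _ = _ ≫ _ ≫ (tensorμ _ _ _ _ ≫ (eComp V _ _ _ ⊗ₘ eComp V _ _ _)) ≫ _
  have h : ((λ_ (x' ⟶[V] y')).inv ⊗ₘ (ρ_ (x ⟶[V] y)).inv) ≫ tensorμ _ _ _ _ =
      (β_ _ _).hom ≫ ((λ_ (x ⟶[V] y)).inv ⊗ₘ (ρ_ (x' ⟶[V] y')).inv) := by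
    simp only [tensorμ]
    monoidal
  rw [← tensorHom_comp_tensorHom, Category.assoc, Category.assoc, tensorμ_natural_assoc,
    reassoc_of% h, tensorHom_comp_tensorHom_assoc, tensorHom_comp_tensorHom_assoc,
    id_tensorHom, tensorHom_id, Category.assoc, Category.assoc, e_comp_id, e_id_comp, id_tensorHom_id,
    SymmetricCategory.symmetry_assoc]
  exact (Category.id_comp _).symm

end TwoVar
end
end EnrichedKan

namespace EnrichedKan

noncomputable section

variable {V : Type v} [Category.{w} V] [MonoidalCategory V] [SymmetricCategory V]

/-! ### Iterated colimits, one variable at a time. -/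

section TwoVar

variable {C : Type*} {C' : Type*} {E : Type*} [EnrichedCategory V C]
  [EnrichedCategory V C'] [EnrichedCategory V E]

theorem tensorHom_map_eq_fst_snd (P : EnrichedFunctor V (TensorCat C C') E) {x y : C} {x' y' : C'}
    {Z Z' : V} (g : Z ⟶ (x ⟶[V] y)) (f : Z' ⟶ (x' ⟶[V] y')) :
    (g ⊗ₘ f) ≫ P.map ⟨x, x'⟩ ⟨y, y'⟩ =
      (g ≫ (partialFst P x').map x y ⊗ₘ f ≫ (partialSnd P y).map x' y') ≫
        eComp V (P.obj ⟨x, x'⟩) (P.obj ⟨y, x'⟩) (P.obj ⟨y, y'⟩) := by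
  rw [map_eq_fst_snd, tensorHom_comp_tensorHom_assoc]

theorem tensorHom_map_eq_snd_fst (P : EnrichedFunctor V (TensorCat C C') E) {x y : C} {x' y' : C'}
    {Z Z' : V} (g : Z ⟶ (x ⟶[V] y)) (f : Z' ⟶ (x' ⟶[V] y')) :
    (g ⊗ₘ f) ≫ P.map ⟨x, x'⟩ ⟨y, y'⟩ = (β_ Z Z').hom ≫
      (f ≫ (partialSnd P x).map x' y' ⊗ₘ g ≫ (partialFst P y').map x y) ≫
        eComp V (P.obj ⟨x, x'⟩) (P.obj ⟨x, y'⟩) (P.obj ⟨y, y'⟩) := by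
  rw [map_eq_snd_fst, BraidedCategory.braiding_naturality_assoc, tensorHom_comp_tensorHom_assoc]

theorem partial_interchange (P : EnrichedFunctor V (TensorCat C C') E) {x y : C} {x' y' : C'}
    {Z Z' : V} (g : Z ⟶ (x ⟶[V] y)) (f : Z' ⟶ (x' ⟶[V] y')) :
    (f ≫ (partialSnd P x).map x' y' ⊗ₘ g ≫ (partialFst P y').map x y) ≫
        eComp V (P.obj ⟨x, x'⟩) (P.obj ⟨x, y'⟩) (P.obj ⟨y, y'⟩) =
      (β_ Z' Z).hom ≫ (g ≫ (partialFst P x').map x y ⊗ₘ f ≫ (partialSnd P y).map x' y') ≫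
        eComp V (P.obj ⟨x, x'⟩) (P.obj ⟨y, x'⟩) (P.obj ⟨y, y'⟩) := by
  rw [← tensorHom_map_eq_fst_snd, tensorHom_map_eq_snd_fst, SymmetricCategory.symmetry_assoc]

/-- Cancel the first variable with parameter `Z`, then the second with parameter `W i ⊗ Z`. This
iteration is why joint epimorphy is demanded for all parameter objects. -/
theorem JointEpi.tensor (P : EnrichedFunctor V (TensorCat C C') E) {I I' : Type*} {W : I → V}
    {W' : I' → V} {G : I → C} {G' : I' → C'} {x : C} {x' : C'} {l : ∀ i, W i ⟶ (G i ⟶[V] x)}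
    {l' : ∀ i, W' i ⟶ (G' i ⟶[V] x')}
    (h : JointEpi fun i => l i ≫ (partialFst P x').map (G i) x)
    (h' : ∀ i, JointEpi fun j => l' j ≫ (partialSnd P (G i)).map (G' j) x') :
    JointEpi fun p : TensorCat I I' =>
      (l p.fst ⊗ₘ l' p.snd) ≫ P.map ⟨G p.fst, G' p.snd⟩ ⟨x, x'⟩ := by
  intro y Z f g hfg
  refine h y Z f g fun i => h' i y _ _ _ fun j => ?_
  have key (f : Z ⟶ (P.obj ⟨x, x'⟩ ⟶[V] y)) :
      ((l i ⊗ₘ l' j) ≫ P.map ⟨G i, G' j⟩ ⟨x, x'⟩ ⊗ₘ f) ≫ eComp V _ _ y =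
        (β_ _ _).hom ▷ Z ≫ (α_ _ _ _).hom ≫ (l' j ≫ (partialSnd P (G i)).map (G' j) x' ⊗ₘ
          (l i ≫ (partialFst P x').map (G i) x ⊗ₘ f) ≫ eComp V _ _ y) ≫ eComp V _ _ y := by
    rw [tensorHom_map_eq_snd_fst, ← whiskerRight_comp_tensorHom, Category.assoc,
      eComp_assoc_tensorHom]
  have h1 := hfg ⟨i, j⟩
  rw [key, key, cancel_epi, cancel_epi] at h1
  exact h1

variable {D : Type*} {D' : Type*} {B : Type*} {B' : Type*} [EnrichedCategory V D]
  [EnrichedCategory V D'] [EnrichedCategory V B] [EnrichedCategory V B']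
  {J : EnrichedFunctor V D B} {b : B} {F : EnrichedFunctor V D C}
  {J' : EnrichedFunctor V D' B'} {b' : B'} {F' : EnrichedFunctor V D' C'}
  {P : EnrichedFunctor V (TensorCat C C') E} {y : E}
  {m : ∀ p : TensorCat D D', ((tensorFunctor J J').obj p ⟶[V] ⟨b, b'⟩) ⟶
    ((tensorFunctor F F' ⋙ᵥ P).obj p ⟶[V] y)}

/-- Joint naturality is evaluated at the identity of `d` in the first variable. The braiding appears
because `D'(d₁, d₂)` has to cross `B(J d, b)`. -/
theorem IsNat.snd (hm : IsNat (tensorFunctor J J') (tensorFunctor F F' ⋙ᵥ P) ⟨b, b'⟩ y m)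
    (d : D) (d₁ d₂ : D') :
    (J.obj d ⟶[V] b) ◁ (J'.map d₁ d₂ ▷ (J'.obj d₂ ⟶[V] b') ≫ eComp V _ _ _) ≫ m ⟨d, d₁⟩ =
      (α_ _ _ _).inv ≫ (β_ _ _).hom ▷ _ ≫ (α_ _ _ _).hom ≫
        ((F' ⋙ᵥ partialSnd P (F.obj d)).map d₁ d₂ ⊗ₘ m ⟨d, d₂⟩) ≫ eComp V _ _ _ := by
  have h : (J.map d d ⊗ₘ J'.map d₁ d₂) ▷ _ ≫ (tensorμ _ _ _ _ ≫
      (eComp V (J.obj d) (J.obj d) b ⊗ₘ eComp V (J'.obj d₁) (J'.obj d₂) b')) ≫ m ⟨d, d₁⟩ =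
      ((F.map d d ⊗ₘ F'.map d₁ d₂) ≫ P.map ⟨_, _⟩ ⟨_, _⟩ ⊗ₘ m ⟨d, d₂⟩) ≫ eComp V _ _ _ :=
    hm ⟨d, d₁⟩ ⟨d, d₂⟩
  have h1 := ((λ_ (d₁ ⟶[V] d₂)).inv ≫ (eId V d ⊗ₘ 𝟙 _)) ▷ _ ≫= h
  have h2 : (λ_ (d₁ ⟶[V] d₂)).inv ▷ ((J.obj d ⟶[V] b) ⊗ (J'.obj d₂ ⟶[V] b')) ≫ tensorμ _ _ _ _ =
      (α_ _ _ _).inv ≫ (β_ _ _).hom ▷ _ ≫ (α_ _ _ _).hom ≫ ((λ_ _).inv ⊗ₘ 𝟙 _) := by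
    simp only [tensorμ]
    monoidal
  have h3 : (λ_ (J.obj d ⟶[V] b)).inv ≫ eId V (J.obj d) ▷ _ ≫ eComp V (J.obj d) (J.obj d) b =
    𝟙 _ := e_id_comp V _ _
  rw [← comp_whiskerRight_assoc, Category.assoc, tensorHom_comp_tensorHom, J.map_id,
    Category.id_comp, comp_whiskerRight_assoc, Category.assoc, tensorμ_natural_left_assoc,
    reassoc_of% h2, tensorHom_comp_tensorHom_assoc, tensorHom_comp_tensorHom_assoc,
    Category.assoc, h3, Category.id_comp, id_tensorHom, whiskerRight_comp_tensorHom_assoc,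
    Category.assoc, tensorHom_comp_tensorHom_assoc] at h1
  have h4 : (λ_ (d₁ ⟶[V] d₂)).inv ≫ (eId V d ≫ F.map d d ⊗ₘ 𝟙 _ ≫ F'.map d₁ d₂) ≫
      P.map ⟨F.obj d, F'.obj d₁⟩ ⟨F.obj d, F'.obj d₂⟩ =
      (F' ⋙ᵥ partialSnd P (F.obj d)).map d₁ d₂ := by
    change _ = F'.map d₁ d₂ ≫ ((λ_ _).inv ≫ (eId V (F.obj d) ⊗ₘ 𝟙 _)) ≫
      P.map ⟨F.obj d, F'.obj d₁⟩ ⟨F.obj d, F'.obj d₂⟩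
    rw [F.map_id, Category.id_comp, Category.assoc, leftUnitor_inv_naturality_assoc,
      whiskerLeft_comp_tensorHom_assoc, Category.comp_id]
  rw [← h4]
  -- Prefixing `h1` with these isomorphisms undoes the ones introduced through `h2`; symmetry of the
  -- braiding is used here.
  refine Eq.trans ?_ (congrArg (fun t => (α_ _ _ _).inv ≫ (β_ (J.obj d ⟶[V] b)
    (d₁ ⟶[V] d₂)).hom ▷ (J'.obj d₂ ⟶[V] b') ≫ (α_ _ _ _).hom ≫ t) h1)
  dsimp only
  rw [Iso.hom_inv_id_assoc, ← comp_whiskerRight_assoc, SymmetricCategory.symmetry,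
    id_whiskerRight, Category.id_comp, Iso.inv_hom_id_assoc]

theorem IsNat.fst (hm : IsNat (tensorFunctor J J') (tensorFunctor F F' ⋙ᵥ P) ⟨b, b'⟩ y m)
    (d₁ d₂ : D) (d' : D') :
    (J.map d₁ d₂ ▷ (J.obj d₂ ⟶[V] b) ≫ eComp V _ _ _) ▷ (J'.obj d' ⟶[V] b') ≫ m ⟨d₁, d'⟩ =
      (α_ _ _ _).hom ≫
        ((F ⋙ᵥ partialFst P (F'.obj d')).map d₁ d₂ ⊗ₘ m ⟨d₂, d'⟩) ≫ eComp V _ _ _ := by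
  have h : (J.map d₁ d₂ ⊗ₘ J'.map d' d') ▷ _ ≫ (tensorμ _ _ _ _ ≫
      (eComp V (J.obj d₁) (J.obj d₂) b ⊗ₘ eComp V (J'.obj d') (J'.obj d') b')) ≫ m ⟨d₁, d'⟩ =
      ((F.map d₁ d₂ ⊗ₘ F'.map d' d') ≫ P.map ⟨_, _⟩ ⟨_, _⟩ ⊗ₘ m ⟨d₂, d'⟩) ≫ eComp V _ _ _ :=
    hm ⟨d₁, d'⟩ ⟨d₂, d'⟩
  have h1 := ((ρ_ (d₁ ⟶[V] d₂)).inv ≫ (𝟙 _ ⊗ₘ eId V d')) ▷ _ ≫= h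
  have h2 : (ρ_ (d₁ ⟶[V] d₂)).inv ▷ ((J.obj d₂ ⟶[V] b) ⊗ (J'.obj d' ⟶[V] b')) ≫
      tensorμ _ _ _ _ = (α_ _ _ _).inv ≫ (𝟙 _ ⊗ₘ (λ_ _).inv) := by
    simp only [tensorμ, braiding_tensorUnit_left]
    monoidal
  have h3 : (λ_ (J'.obj d' ⟶[V] b')).inv ≫ eId V (J'.obj d') ▷ _ ≫
      eComp V (J'.obj d') (J'.obj d') b' = 𝟙 _ := e_id_comp V _ _
  rw [← comp_whiskerRight_assoc, Category.assoc, tensorHom_comp_tensorHom, J'.map_id,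
    Category.id_comp, comp_whiskerRight_assoc, Category.assoc, tensorμ_natural_left_assoc,
    reassoc_of% h2, tensorHom_comp_tensorHom_assoc, tensorHom_comp_tensorHom_assoc,
    Category.assoc, Category.assoc, h3, Category.id_comp, tensorHom_id, whiskerRight_comp_tensorHom_assoc,
    Category.assoc, tensorHom_comp_tensorHom_assoc] at h1
  have h4 : (ρ_ (d₁ ⟶[V] d₂)).inv ≫ (𝟙 _ ≫ F.map d₁ d₂ ⊗ₘ eId V d' ≫ F'.map d' d') ≫
      P.map ⟨F.obj d₁, F'.obj d'⟩ ⟨F.obj d₂, F'.obj d'⟩ =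
      (F ⋙ᵥ partialFst P (F'.obj d')).map d₁ d₂ := by
    change _ = F.map d₁ d₂ ≫ ((ρ_ _).inv ≫ (𝟙 _ ⊗ₘ eId V (F'.obj d'))) ≫
      P.map ⟨F.obj d₁, F'.obj d'⟩ ⟨F.obj d₂, F'.obj d'⟩
    rw [F'.map_id, Category.id_comp, Category.assoc, rightUnitor_inv_naturality_assoc,
      whiskerRight_comp_tensorHom_assoc, Category.comp_id]
  rw [← h4]
  refine Eq.trans ?_ (congrArg (fun t => (α_ (d₁ ⟶[V] d₂) (J.obj d₂ ⟶[V] b)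
    (J'.obj d' ⟶[V] b')).hom ≫ t) h1)
  dsimp only
  rw [Iso.hom_inv_id_assoc]

/-- Fubini: a family in two variables is factored through the inner colimit in `d'` and then through
the outer colimit in `d`. The inner factorisation carries a parameter, which is why `HasParamDesc`
is needed there. -/
theorem IsColim.tensor {x : C} {x' : C'} {l : ∀ d, (J.obj d ⟶[V] b) ⟶ (F.obj d ⟶[V] x)}
    {l' : ∀ d, (J'.obj d ⟶[V] b') ⟶ (F'.obj d ⟶[V] x')} (P : EnrichedFunctor V (TensorCat C C') E)
    (hl : IsNat J F b x l) (hl' : IsNat J' F' b' x' l')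
    (h : JointEpi fun d => l d ≫ (partialFst P x').map (F.obj d) x)
    (h' : ∀ d, JointEpi fun j => l' j ≫ (partialSnd P (F.obj d)).map (F'.obj j) x')
    (hd : HasParamDesc J b (F ⋙ᵥ partialFst P x') (P.obj ⟨x, x'⟩)
      fun d => l d ≫ (partialFst P x').map (F.obj d) x)
    (hd' : ∀ d, HasParamDesc J' b' (F' ⋙ᵥ partialSnd P (F.obj d)) (P.obj ⟨F.obj d, x'⟩)
      fun j => l' j ≫ (partialSnd P (F.obj d)).map (F'.obj j) x') :
    IsColim (tensorFunctor J J') ⟨b, b'⟩ (tensorFunctor F F' ⋙ᵥ P) (P.obj ⟨x, x'⟩)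
      fun p => (l p.fst ⊗ₘ l' p.snd) ≫ P.map ⟨F.obj p.fst, F'.obj p.snd⟩ ⟨x, x'⟩ where
  nat := (hl.tensor hl').comp (isNat_map (tensorFunctor F F') P ⟨x, x'⟩)
  jointEpi := JointEpi.tensor P h h'
  desc y m hm := by
    -- For fixed `d`, the inner colimit is used with parameter `J.obj d ⟶[V] b`; the braiding puts
    -- this parameter on the right.
    have hg d : ∃ g : (J.obj d ⟶[V] b) ⟶ (P.obj ⟨F.obj d, x'⟩ ⟶[V] y), ∀ d',
        (l' d' ≫ (partialSnd P (F.obj d)).map (F'.obj d') x' ⊗ₘ g) ≫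
          eComp V _ (P.obj ⟨F.obj d, x'⟩) _ = (β_ (J'.obj d' ⟶[V] b') (J.obj d ⟶[V] b)).hom ≫ m ⟨d, d'⟩ := by
      refine hd' d y _ (fun d' => (β_ (J'.obj d' ⟶[V] b') (J.obj d ⟶[V] b)).hom ≫ m ⟨d, d'⟩) fun d₁ d₂ => ?_
      have h1 := hm.snd d d₁ d₂
      rw [BraidedCategory.braiding_naturality_left_assoc, h1]
      dsimp only
      rw [← whiskerLeft_comp_tensorHom_assoc]
      simp only [← Category.assoc]
      congr 2
      simp only [BraidedCategory.braiding_tensor_left_hom, Category.assoc, Iso.hom_inv_id_assoc]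
      rw [← comp_whiskerRight_assoc, SymmetricCategory.symmetry, id_whiskerRight, Category.id_comp,
        Iso.inv_hom_id, Category.comp_id]
    choose g hg using hg
    -- The family `g` is natural because it may be tested on the inner colimit, where both sides
    -- reduce to `m` by `hg`, by naturality of `m` in the first variable, and by the interchange of
    -- partial functors.
    have hgn : IsNat J (F ⋙ᵥ partialFst P x') b y g := by
      intro d₁ d₂
      refine h' d₁ _ _ _ _ fun d' => ?_
      have h1 := hm.fst d₁ d₂ d'
      have h2 := partial_interchange P (F.map d₁ d₂) (l' d')
      have h3 := hg d₁ d'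
      have h4 := hg d₂ d'
      have e1 : (l' d' ≫ (partialSnd P (F.obj d₁)).map (F'.obj d') x' ⊗ₘ
          J.map d₁ d₂ ▷ (J.obj d₂ ⟶[V] b) ≫ eComp V (J.obj d₁) (J.obj d₂) b ≫ g d₁) ≫
            eComp V _ (P.obj ⟨F.obj d₁, x'⟩) _ =
          (β_ (J'.obj d' ⟶[V] b') _).hom ≫ (α_ _ _ _).hom ≫
            ((F ⋙ᵥ partialFst P (F'.obj d')).map d₁ d₂ ⊗ₘ m ⟨d₂, d'⟩) ≫ eComp V _ _ _ := by
        rw [← Category.assoc (J.map d₁ d₂ ▷ _), ← whiskerLeft_comp_tensorHom, Category.assoc, h3,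
          BraidedCategory.braiding_naturality_right_assoc, h1]
      have e2 : (l' d' ≫ (partialSnd P (F.obj d₁)).map (F'.obj d') x' ⊗ₘ
          (F.map d₁ d₂ ≫ (partialFst P x').map (F.obj d₁) (F.obj d₂) ⊗ₘ g d₂) ≫
            eComp V _ (P.obj ⟨F.obj d₂, x'⟩) _) ≫ eComp V _ (P.obj ⟨F.obj d₁, x'⟩) _ =
          (α_ _ _ _).inv ≫ (β_ (J'.obj d' ⟶[V] b') _).hom ▷ _ ≫ (α_ _ _ _).hom ≫
            ((F.map d₁ d₂ ≫ (partialFst P (F'.obj d')).map (F.obj d₁) (F.obj d₂)) ⊗ₘ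
              (β_ _ _).hom ≫ m ⟨d₂, d'⟩) ≫ eComp V _ _ _ := by
        rw [← h4, ← eComp_assoc_tensorHom, whiskerRight_comp_tensorHom_assoc, ← h2,
          eComp_assoc_tensorHom, Iso.inv_hom_id_assoc]
      refine e1.trans (Eq.trans ?_ e2.symm)
      rw [← whiskerLeft_comp_tensorHom_assoc]
      simp only [← Category.assoc]
      congr 2
      simp
    -- The outer colimit now turns the natural family `g` into a single morphism.
    obtain ⟨f, hf⟩ := hd.desc y g hgn
    refine ⟨f, fun p => ?_⟩
    rw [tensorHom_map_eq_snd_fst, Category.assoc, Category.assoc, ← whiskerLeft_post_eComp,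
      tensorHom_comp_whiskerLeft_assoc, hf, hg, SymmetricCategory.symmetry_assoc]

end TwoVar
end
end EnrichedKan

namespace EnrichedKan

noncomputable section

variable {V : Type v} [Category.{w} V] [MonoidalCategory V] [SymmetricCategory V]

/-! ### Tensor products of adjunctions and composites of mates -/

namespace VAdjunction

omit [SymmetricCategory V] in
theorem homIso_hom_pre {C : Type*} {D : Type*} [EnrichedCategory V C] [EnrichedCategory V D]
    {L : EnrichedFunctor V D C} {R : EnrichedFunctor V C D} (h : VAdjunction L R) {d d' : D}
    (u : 𝟙_ V ⟶ (d ⟶[V] d')) (c : C) :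
    pre (u ≫ L.map d d') c ≫ (h.homIso d c).hom = (h.homIso d' c).hom ≫ pre u (R.obj c) := by
  have h1 := h.natural_left d d' c
  rw [pre, comp_whiskerRight, Category.assoc, Category.assoc, Category.assoc, h1, pre,
    leftUnitor_inv_naturality_assoc, whisker_exchange_assoc]

/-- The identity adjunction. -/
def refl (C : Type*) [EnrichedCategory V C] : VAdjunction (vid V C) (vid V C) where
  homIso _ _ := Iso.refl _
  natural_right _ _ _ := by simp
  natural_left _ _ _ := by simp

variable {C : Type*} {C' : Type*} {D : Type*} {D' : Type*} [EnrichedCategory V C]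
  [EnrichedCategory V C'] [EnrichedCategory V D] [EnrichedCategory V D']
  {L : EnrichedFunctor V D C} {R : EnrichedFunctor V C D}
  {L' : EnrichedFunctor V D' C'} {R' : EnrichedFunctor V C' D'}

/-- The tensor product of two `V`-adjunctions. -/
def tensor (h : VAdjunction L R) (h' : VAdjunction L' R') :
    VAdjunction (tensorFunctor L L') (tensorFunctor R R') where
  homIso d c := h.homIso d.fst c.fst ⊗ᵢ h'.homIso d.snd c.snd
  natural_right d c c' := by
    change (tensorμ _ _ _ _ ≫ (_ ⊗ₘ _)) ≫ (_ ⊗ₘ _) =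
      ((_ ⊗ₘ _) ⊗ₘ (_ ⊗ₘ _)) ≫ tensorμ _ _ _ _ ≫ (_ ⊗ₘ _)
    rw [Category.assoc, tensorHom_comp_tensorHom, tensorμ_natural_assoc, tensorHom_comp_tensorHom,
      h.natural_right, h'.natural_right]
  natural_left d d' c := by
    change (_ ⊗ₘ _) ▷ _ ≫ (tensorμ _ _ _ _ ≫ (_ ⊗ₘ _)) ≫ (_ ⊗ₘ _) =
      _ ◁ (_ ⊗ₘ _) ≫ tensorμ _ _ _ _ ≫ (_ ⊗ₘ _)
    rw [Category.assoc, tensorμ_natural_left_assoc, tensorHom_comp_tensorHom,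
      tensorHom_comp_tensorHom, tensorμ_natural_right_assoc, tensorHom_comp_tensorHom,
      h.natural_left, h'.natural_left]

end VAdjunction

/-! ### Mates and their pasting. -/

section Squares

variable {A : Type*} {A₂ : Type*} {A₃ : Type*} {B : Type*} {B₂ : Type*} {B₃ : Type*}
  [EnrichedCategory V A] [EnrichedCategory V A₂] [EnrichedCategory V A₃]
  [EnrichedCategory V B] [EnrichedCategory V B₂] [EnrichedCategory V B₃]
  {LA : EnrichedFunctor V A A₂} {RA : EnrichedFunctor V A₂ A} {hA : VAdjunction LA RA}
  {LB : EnrichedFunctor V B B₂} {RB : EnrichedFunctor V B₂ B} {hB : VAdjunction LB RB}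
  {J : EnrichedFunctor V A B} {J₂ : EnrichedFunctor V A₂ B₂}

/-- The families `ψ : L J ⟶ J₂ L` and `χ : J R ⟶ R J₂` are mates of each other. -/
def AreMates (hA : VAdjunction LA RA) (hB : VAdjunction LB RB) (J : EnrichedFunctor V A B)
    (J₂ : EnrichedFunctor V A₂ B₂)
    (ψ : ∀ a, 𝟙_ V ⟶ (LB.obj (J.obj a) ⟶[V] J₂.obj (LA.obj a)))
    (χ : ∀ p, 𝟙_ V ⟶ (J.obj (RA.obj p) ⟶[V] RB.obj (J₂.obj p))) : Prop :=
  ∀ a p, (hA.homIso a p).hom ≫ J.map a (RA.obj p) ≫ post _ (χ p) =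
    J₂.map (LA.obj a) p ≫ pre (ψ a) (J₂.obj p) ≫ (hB.homIso (J.obj a) (J₂.obj p)).hom

/-- Write both transpositions through units; naturality of the mate and `unit_mate` then identify
the two sides. -/
theorem areMates_mate {ψ : ∀ a, 𝟙_ V ⟶ (LB.obj (J.obj a) ⟶[V] J₂.obj (LA.obj a))}
    (hψ : IsVTrans (J ⋙ᵥ LB) (LA ⋙ᵥ J₂) ψ) : AreMates hA hB J J₂ ψ (mate hA hB ψ) := by
  intro a p
  have h1 := isVTrans_mate hA hB hψ (LA.obj a) p
  simp only [Category.assoc] at h1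
  rw [hA.homIso_hom, hB.homIso_hom, Category.assoc, pre_map_assoc, pre_post, reassoc_of% h1,
    ← pre_comp, unit_mate hA hB hψ, pre_comp, pre_map_assoc]

omit [SymmetricCategory V] in
theorem areMates_refl (J : EnrichedFunctor V A B) :
    AreMates (VAdjunction.refl A) (VAdjunction.refl B) J J (fun _ => eId V _) fun _ => eId V _ := by
  intro a p
  rw [post_id, pre_id]
  change 𝟙 _ ≫ J.map a p ≫ 𝟙 _ = J.map a p ≫ 𝟙 _ ≫ 𝟙 _
  simp only [Category.comp_id, Category.id_comp]

variable {LA' : EnrichedFunctor V A₂ A₃} {RA' : EnrichedFunctor V A₃ A₂} {hA' : VAdjunction LA' RA'}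
  {LB' : EnrichedFunctor V B₂ B₃} {RB' : EnrichedFunctor V B₃ B₂} {hB' : VAdjunction LB' RB'}
  {J₃ : EnrichedFunctor V A₃ B₃}
  {ψ : ∀ a, 𝟙_ V ⟶ (LB.obj (J.obj a) ⟶[V] J₂.obj (LA.obj a))}
  {χ : ∀ p, 𝟙_ V ⟶ (J.obj (RA.obj p) ⟶[V] RB.obj (J₂.obj p))}
  {ψ' : ∀ a, 𝟙_ V ⟶ (LB'.obj (J₂.obj a) ⟶[V] J₃.obj (LA'.obj a))}
  {χ' : ∀ p, 𝟙_ V ⟶ (J₂.obj (RA'.obj p) ⟶[V] RB'.obj (J₃.obj p))}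

/-- Pasting of two squares: naturality of transposition moves the second constraint past the first
adjunction, after which each mate equation applies once. -/
theorem AreMates.comp (h : AreMates hA hB J J₂ ψ χ) (h' : AreMates hA' hB' J₂ J₃ ψ' χ')
    (a : A) (p : A₃) :
    (hA'.homIso (LA.obj a) p).hom ≫ (hA.homIso a (RA'.obj p)).hom ≫ J.map _ _ ≫
        post _ (χ (RA'.obj p)) ≫ post _ (χ' p ≫ RB.map _ _) =
      J₃.map _ _ ≫ pre (ψ' (LA.obj a)) _ ≫ pre (ψ a ≫ LB'.map _ _) _ ≫
        (hB'.homIso (LB.obj (J.obj a)) (J₃.obj p)).hom ≫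
          (hB.homIso (J.obj a) (RB'.obj (J₃.obj p))).hom := by
  have h1 := h a (RA'.obj p)
  have h2 := h' (LA.obj a) p
  rw [reassoc_of% h1, ← hB.homIso_hom_post, pre_post_assoc, reassoc_of% h2,
    ← reassoc_of% (hB'.homIso_hom_pre (ψ a) (J₃.obj p))]

end Squares

section

variable {A : Type*} {A₂ : Type*} {A' : Type*} {A₂' : Type*} {B : Type*} {B₂ : Type*} {B' : Type*}
  {B₂' : Type*}
  [EnrichedCategory V A] [EnrichedCategory V A₂] [EnrichedCategory V A'] [EnrichedCategory V A₂']
  [EnrichedCategory V B] [EnrichedCategory V B₂] [EnrichedCategory V B'] [EnrichedCategory V B₂']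
  {LA : EnrichedFunctor V A A₂} {RA : EnrichedFunctor V A₂ A} {hA : VAdjunction LA RA}
  {LB : EnrichedFunctor V B B₂} {RB : EnrichedFunctor V B₂ B} {hB : VAdjunction LB RB}
  {LA' : EnrichedFunctor V A' A₂'} {RA' : EnrichedFunctor V A₂' A'} {hA' : VAdjunction LA' RA'}
  {LB' : EnrichedFunctor V B' B₂'} {RB' : EnrichedFunctor V B₂' B'} {hB' : VAdjunction LB' RB'}
  {J : EnrichedFunctor V A B} {J₂ : EnrichedFunctor V A₂ B₂}
  {J' : EnrichedFunctor V A' B'} {J₂' : EnrichedFunctor V A₂' B₂'}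
  {ψ : ∀ a, 𝟙_ V ⟶ (LB.obj (J.obj a) ⟶[V] J₂.obj (LA.obj a))}
  {χ : ∀ p, 𝟙_ V ⟶ (J.obj (RA.obj p) ⟶[V] RB.obj (J₂.obj p))}
  {ψ' : ∀ a, 𝟙_ V ⟶ (LB'.obj (J'.obj a) ⟶[V] J₂'.obj (LA'.obj a))}
  {χ' : ∀ p, 𝟙_ V ⟶ (J'.obj (RA'.obj p) ⟶[V] RB'.obj (J₂'.obj p))}

theorem AreMates.tensor (h : AreMates hA hB J J₂ ψ χ) (h' : AreMates hA' hB' J' J₂' ψ' χ') :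
    AreMates (hA.tensor hA') (hB.tensor hB') (tensorFunctor J J') (tensorFunctor J₂ J₂')
      (fun a => upair (ψ a.fst) (ψ' a.snd)) fun p => upair (χ p.fst) (χ' p.snd) := by
  intro a p
  rw [pre_upair, post_upair]
  change (_ ⊗ₘ _) ≫ (_ ⊗ₘ _) ≫ (_ ⊗ₘ _) = (_ ⊗ₘ _) ≫ (_ ⊗ₘ _) ≫ (_ ⊗ₘ _)
  rw [tensorHom_comp_tensorHom, tensorHom_comp_tensorHom, tensorHom_comp_tensorHom,
    tensorHom_comp_tensorHom, h, h']

end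

end
end EnrichedKan

namespace EnrichedKan

noncomputable section

variable {V : Type v} [Category.{w} V] [MonoidalCategory V] [SymmetricCategory V]

section

variable {A : Type*} {B : Type*} [EnrichedCategory V A] [EnrichedCategory V B]

theorem homTo_pairHom_id {x y : A} (f : ForgetEnrichment.of V x ⟶ ForgetEnrichment.of V y) (b : B) :
    (ForgetEnrichment.homTo V (pairHom f (𝟙 (ForgetEnrichment.of V b))) :
      𝟙_ V ⟶ ((⟨x, b⟩ : TensorCat A B) ⟶[V] ⟨y, b⟩)) =
      upair (ForgetEnrichment.homTo V f : 𝟙_ V ⟶ (x ⟶[V] y)) (eId V b) :=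
  congrArg (upair (ForgetEnrichment.homTo V f : 𝟙_ V ⟶ (x ⟶[V] y)))
    (ForgetEnrichment.homTo_id V (ForgetEnrichment.of V b))

theorem homTo_pairHom_id' {x y : B} (a : A)
    (f : ForgetEnrichment.of V x ⟶ ForgetEnrichment.of V y) :
    (ForgetEnrichment.homTo V (pairHom (𝟙 (ForgetEnrichment.of V a)) f) :
      𝟙_ V ⟶ ((⟨a, x⟩ : TensorCat A B) ⟶[V] ⟨a, y⟩)) =
      upair (eId V a) (ForgetEnrichment.homTo V f : 𝟙_ V ⟶ (x ⟶[V] y)) :=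
  congrArg (fun t => upair t (ForgetEnrichment.homTo V f : 𝟙_ V ⟶ (x ⟶[V] y)))
    (ForgetEnrichment.homTo_id V (ForgetEnrichment.of V a))

end

/-! ### Monoidal structures in terms of underlying morphisms -/

section Monoidal

variable (V) {A : Type u} [EnrichedCategory V A] [MonoidalVCategory V A]

/-- The tensor product of objects. -/
abbrev tobj (x y : A) : A := (MonoidalVCategory.tensor (V := V)).obj ⟨x, y⟩

/-- The action of the tensor product on hom-objects. -/
abbrev tmap (x x' y y' : A) :
    (x ⟶[V] y) ⊗ (x' ⟶[V] y') ⟶ (tobj V x x' ⟶[V] tobj V y y') :=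
  (MonoidalVCategory.tensor (V := V)).map ⟨x, x'⟩ ⟨y, y'⟩

variable (A) in
/-- The unit object. -/
abbrev uobj : A := (MonoidalVCategory.unit (V := V)).obj ⟨⟩

variable {V} in
/-- The tensor product of underlying morphisms. -/
def utensor {x x' y y' : A} (f : 𝟙_ V ⟶ (x ⟶[V] y)) (g : 𝟙_ V ⟶ (x' ⟶[V] y')) :
    𝟙_ V ⟶ (tobj V x x' ⟶[V] tobj V y y') :=
  upair f g ≫ tmap V x x' y y'

/-- The associator. -/
def assocHom (x y z : A) : 𝟙_ V ⟶ (tobj V (tobj V x y) z ⟶[V] tobj V x (tobj V y z)) :=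
  (MonoidalVCategory.associator (V := V) (A := A)).hom ⟨⟨x, y⟩, z⟩

/-- The inverse of the associator. -/
def assocInv (x y z : A) : 𝟙_ V ⟶ (tobj V x (tobj V y z) ⟶[V] tobj V (tobj V x y) z) :=
  (MonoidalVCategory.associator (V := V) (A := A)).inv ⟨⟨x, y⟩, z⟩

/-- The left unitor. -/
def leftHom (x : A) : 𝟙_ V ⟶ (tobj V (uobj V A) x ⟶[V] x) :=
  (MonoidalVCategory.leftUnitor (V := V) (A := A)).hom ⟨⟨⟩, x⟩

/-- The inverse of the left unitor. -/
def leftInv (x : A) : 𝟙_ V ⟶ (x ⟶[V] tobj V (uobj V A) x) :=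
  (MonoidalVCategory.leftUnitor (V := V) (A := A)).inv ⟨⟨⟩, x⟩

/-- The right unitor. -/
def rightHom (x : A) : 𝟙_ V ⟶ (tobj V x (uobj V A) ⟶[V] x) :=
  (MonoidalVCategory.rightUnitor (V := V) (A := A)).hom ⟨x, ⟨⟩⟩

/-- The inverse of the right unitor. -/
def rightInv (x : A) : 𝟙_ V ⟶ (x ⟶[V] tobj V x (uobj V A)) :=
  (MonoidalVCategory.rightUnitor (V := V) (A := A)).inv ⟨x, ⟨⟩⟩

theorem isInverse_assoc (x y z : A) : IsInverse (assocHom V x y z) (assocInv V x y z) :=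
  (MonoidalVCategory.associator (V := V) (A := A)).isInverse _

theorem isInverse_left (x : A) : IsInverse (leftHom V x) (leftInv V x) :=
  (MonoidalVCategory.leftUnitor (V := V) (A := A)).isInverse _

theorem isInverse_right (x : A) : IsInverse (rightHom V x) (rightInv V x) :=
  (MonoidalVCategory.rightUnitor (V := V) (A := A)).isInverse _

theorem assocHom_naturality (x y z x' y' z' : A) :
    tmap V x y x' y' ▷ _ ≫ tmap V (tobj V x y) z (tobj V x' y') z' ≫
        post _ (assocHom V x' y' z') =
      (α_ _ _ _).hom ≫ _ ◁ tmap V y z y' z' ≫ tmap V x (tobj V y z) x' (tobj V y' z') ≫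
        pre (assocHom V x y z) _ := by
  have h := (MonoidalVCategory.associator (V := V) (A := A)).isVTrans_hom ⟨⟨x, y⟩, z⟩ ⟨⟨x', y'⟩, z'⟩
  rw [← tensorHom_id, ← id_tensorHom, ← Category.assoc, ← Category.assoc (𝟙 _ ⊗ₘ _),
    ← Category.assoc (α_ _ _ _).hom]
  exact h

theorem assocHom_naturality_assoc (x y z x' y' z' : A) {Z : V}
    (k : (tobj V (tobj V x y) z ⟶[V] tobj V x' (tobj V y' z')) ⟶ Z) :
    tmap V x y x' y' ▷ _ ≫ tmap V (tobj V x y) z (tobj V x' y') z' ≫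
        post _ (assocHom V x' y' z') ≫ k =
      (α_ _ _ _).hom ≫ _ ◁ tmap V y z y' z' ≫ tmap V x (tobj V y z) x' (tobj V y' z') ≫
        pre (assocHom V x y z) _ ≫ k := by
  simpa only [Category.assoc] using assocHom_naturality V x y z x' y' z' =≫ k

/-- The inverse is needed because the coassociativity constraint of `(Δ, E)` corresponds to the
inverse associator. -/
theorem assocInv_naturality (x y z x' y' z' : A) :
    (α_ _ _ _).inv ≫ tmap V x y x' y' ▷ _ ≫ tmap V (tobj V x y) z (tobj V x' y') z' ≫
        pre (assocInv V x y z) _ =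
      _ ◁ tmap V y z y' z' ≫ tmap V x (tobj V y z) x' (tobj V y' z') ≫
        post _ (assocInv V x' y' z') := by
  have h := (α_ _ _ _).inv ≫= assocHom_naturality V x y z x' y' z' =≫
    (post _ (assocInv V x' y' z') ≫ pre (assocInv V x y z) _)
  simp only [Category.assoc] at h
  rw [(isInverse_assoc V x' y' z').post_post_assoc, pre_post_assoc,
    (isInverse_assoc V x y z).pre_pre, Iso.inv_hom_id_assoc, Category.comp_id] at h
  exact h

theorem unit_map (A : Type u) [EnrichedCategory V A] [MonoidalVCategory V A] :
    (MonoidalVCategory.unit (V := V) (A := A)).map ⟨⟩ ⟨⟩ = eId V (uobj V A) :=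
  (Category.id_comp _).symm.trans ((MonoidalVCategory.unit (V := V) (A := A)).map_id ⟨⟩)

theorem leftHom_naturality (x y : A) :
    (λ_ _).inv ≫ eId V (uobj V A) ▷ _ ≫ tmap V (uobj V A) x (uobj V A) y ≫
      post _ (leftHom V y) = pre (leftHom V x) y := by
  have h := (MonoidalVCategory.leftUnitor (V := V) (A := A)).isVTrans_hom ⟨⟨⟩, x⟩ ⟨⟨⟩, y⟩
  rw [← cancel_epi (λ_ (x ⟶[V] y)).hom, Iso.hom_inv_id_assoc, ← unit_map, ← tensorHom_id,
    ← Category.assoc]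
  exact h

theorem rightHom_naturality (x y : A) :
    (ρ_ _).inv ≫ _ ◁ eId V (uobj V A) ≫ tmap V x (uobj V A) y (uobj V A) ≫
      post _ (rightHom V y) = pre (rightHom V x) y := by
  have h := (MonoidalVCategory.rightUnitor (V := V) (A := A)).isVTrans_hom ⟨x, ⟨⟩⟩ ⟨y, ⟨⟩⟩
  rw [← cancel_epi (ρ_ (x ⟶[V] y)).hom, Iso.hom_inv_id_assoc, ← unit_map, ← id_tensorHom,
    ← Category.assoc]
  exact h

end Monoidal

/-! ### The comonoidal structure of a cartesian monoidal `V`-category -/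

section Cartesian

open CartesianVCategory

variable {A : Type u} [EnrichedCategory V A] [CartesianVCategory V A]

/-- The left counit constraint, as a morphism of `V`. -/
def counitLeftHom (a : A) : 𝟙_ V ⟶ ((tensorFunctor (aug (V := V)) (vid V A)).obj
    ((diag (V := V)).obj a) ⟶[V] (⟨⟨⟩, a⟩ : TensorCat UnitCat A)) :=
  ForgetEnrichment.homTo V (counitLeft V a)

/-- The right counit constraint, as a morphism of `V`. -/
def counitRightHom (a : A) : 𝟙_ V ⟶ ((tensorFunctor (vid V A) (aug (V := V))).obj
    ((diag (V := V)).obj a) ⟶[V] (⟨a, ⟨⟩⟩ : TensorCat A UnitCat)) :=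
  ForgetEnrichment.homTo V (counitRight V a)

/-- The constraint is defined as an inverse transpose, so transposing it cancels. The adjunction is
put in the form `E ⊗ 1` followed by `Δ`, to which `AreMates.comp` applies. -/
theorem counitLeftHom_homIso (a : A) :
    counitLeftHom a ≫ (((augAdj (V := V)).tensor (VAdjunction.refl A)).homIso
      ((diag (V := V)).obj a) ⟨⟨⟩, a⟩).hom ≫ (diagAdj.homIso a ⟨uobj V A, a⟩).hom =
      leftInv V a := by
  have h : counitLeftHom a ≫ (counitLeftIso V a a).hom = leftInv V a := by
    refine (Category.assoc _ _ _).trans ?_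
    exact (congrArg (fun t => leftInv V a ≫ t) (counitLeftIso V a a).inv_hom_id).trans
      (Category.comp_id _)
  rw [← h]
  change _ ≫ (_ ⊗ₘ 𝟙 _) ≫ _ = _ ≫ _ ▷ _ ≫ _
  rw [tensorHom_id]

theorem counitRightHom_homIso (a : A) :
    counitRightHom a ≫ (((VAdjunction.refl A).tensor (augAdj (V := V))).homIso
      ((diag (V := V)).obj a) ⟨a, ⟨⟩⟩).hom ≫ (diagAdj.homIso a ⟨a, uobj V A⟩).hom =
      rightInv V a := by
  have h : counitRightHom a ≫ (counitRightIso V a a).hom = rightInv V a := by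
    refine (Category.assoc _ _ _).trans ?_
    exact (congrArg (fun t => rightInv V a ≫ t) (counitRightIso V a a).inv_hom_id).trans
      (Category.comp_id _)
  rw [← h]
  change _ ≫ (𝟙 _ ⊗ₘ _) ≫ _ = _ ≫ _ ◁ _ ≫ _
  rw [id_tensorHom]

end Cartesian

/-! ### The colax monoidal structure on a strong comonoidal `V`-functor -/

namespace StrongComonoidal

open CartesianVCategory

variable {A : Type u₁} {B : Type u₂} [EnrichedCategory V A] [EnrichedCategory V B]
  [CartesianVCategory V A] [CartesianVCategory V B] {J : EnrichedFunctor V A B}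
  (hJ : StrongComonoidal J)

/-- The constraint `Δ J ⟶ (J ⊗ J) Δ`. -/
def ψHom (a : A) : 𝟙_ V ⟶ ((diag (V := V)).obj (J.obj a) ⟶[V]
    (tensorFunctor J J).obj ((diag (V := V)).obj a)) :=
  hJ.ψ.hom a

/-- The constraint `E J ⟶ E`. -/
def ψ₀Hom (a : A) : 𝟙_ V ⟶ ((aug (V := V)).obj (J.obj a) ⟶[V] (aug (V := V)).obj a) :=
  hJ.ψ₀.hom a

/-- The constraint `J (x ⋆ y) ⟶ J x ⋆ J y`. -/
def χ (p : TensorCat A A) :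
    𝟙_ V ⟶ (J.obj ((MonoidalVCategory.tensor (V := V)).obj p) ⟶[V]
      (MonoidalVCategory.tensor (V := V)).obj ((tensorFunctor J J).obj p)) :=
  mate (diagAdj (V := V) (A := A)) (diagAdj (V := V) (A := B)) (J₂ := tensorFunctor J J) hJ.ψHom p

/-- The constraint `J N ⟶ N`. -/
def χ₀ (p : UnitCat) : 𝟙_ V ⟶ (J.obj ((MonoidalVCategory.unit (V := V)).obj p) ⟶[V]
      (MonoidalVCategory.unit (V := V)).obj p) :=
  mate (augAdj (V := V) (A := A)) (augAdj (V := V) (A := B)) (J₂ := vid V UnitCat) hJ.ψ₀Hom p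

theorem areMates_χ : AreMates (diagAdj (V := V) (A := A)) (diagAdj (V := V) (A := B)) J
    (tensorFunctor J J) hJ.ψHom hJ.χ :=
  areMates_mate hJ.ψ.isVTrans_hom

/-- The identity of the unit `V`-category is inserted so that the constraint has the shape `L J ⟶ J₂
L` required of a square. -/
theorem isVTrans_ψ₀ : IsVTrans (J ⋙ᵥ aug (V := V) (A := B))
    (aug (V := V) (A := A) ⋙ᵥ vid V UnitCat) hJ.ψ₀Hom := by
  intro d d'
  have h := hJ.ψ₀.isVTrans_hom d d'
  refine h.trans ?_
  change _ = ((aug (V := V) (A := A)).map d d' ≫ 𝟙 _) ≫ _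
  rw [Category.comp_id]
  rfl

theorem areMates_χ₀ : AreMates (augAdj (V := V) (A := A)) (augAdj (V := V) (A := B)) J
    (vid V UnitCat) hJ.ψ₀Hom hJ.χ₀ :=
  areMates_mate hJ.isVTrans_ψ₀

/-- The inverse left unitor is the transpose of the counit constraint. Pasted mates carry this
transposition from `A` to `B`, where the counit axiom of `J` identifies the result. -/
theorem leftInv_map_χ (a : A) :
    leftInv V a ≫ J.map a _ ≫ post _ (hJ.χ ⟨uobj V A, a⟩) ≫
      post _ (utensor (hJ.χ₀ ⟨⟩) (eId V (J.obj a))) = leftInv V (J.obj a) := by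
  have h1 := hJ.areMates_χ.comp (hJ.areMates_χ₀.tensor (areMates_refl J)) a ⟨⟨⟩, a⟩
  -- The counit axiom, rewritten with precompositions so that it fits the right-hand side of `h1`.
  have h3 : (counitLeftHom a ≫ (tensorFunctor (vid V UnitCat) J).map _ _) ≫ pre (upair (hJ.ψ₀Hom _) (eId V _)) _ ≫
      pre (hJ.ψHom a ≫ (tensorFunctor (aug (V := V)) (vid V B)).map _ _) ⟨⟨⟩, J.obj a⟩ =
      counitLeftHom (J.obj a) := by
    rw [comp_pre_assoc, ← Category.assoc, comp_pre]
    refine Eq.trans ?_ (congrArg (fun f => (ForgetEnrichment.homTo V f : 𝟙_ V ⟶ _))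
      (hJ.left_counitality a))
    refine Eq.trans ?_ (homTo_comp' (V := V) (C := TensorCat UnitCat B) _ _).symm
    refine congrArg (fun t => (hJ.ψHom a ≫ (tensorFunctor (aug (V := V)) (vid V B)).map _ _) ≫
      post ((tensorFunctor (aug (V := V)) (vid V B)).obj ((diag (V := V)).obj (J.obj a))) t) ?_
    refine Eq.trans ?_ (homTo_comp' (pairHom (hJ.ψ₀.iso ((diag (V := V)).obj a).fst).hom
      (𝟙 (ForgetEnrichment.of V (J.obj ((diag (V := V)).obj a).snd))))
      ((tensorFunctor (EnrichedFunctor.id V UnitCat) J).forget.map (counitLeft V a))).symm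
    exact congrArg (fun t => t ≫ post _ _) (homTo_pairHom_id _ _).symm
  rw [← counitLeftHom_homIso, ← counitLeftHom_homIso]
  simp only [Category.assoc]
  refine (counitLeftHom a ≫= h1).trans ?_
  rw [← h3]
  simp only [Category.assoc]

theorem rightInv_map_χ (a : A) :
    rightInv V a ≫ J.map a _ ≫ post _ (hJ.χ ⟨a, uobj V A⟩) ≫
      post _ (utensor (eId V (J.obj a)) (hJ.χ₀ ⟨⟩)) = rightInv V (J.obj a) := by
  have h1 := hJ.areMates_χ.comp ((areMates_refl J).tensor hJ.areMates_χ₀) a ⟨a, ⟨⟩⟩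
  have h3 : (counitRightHom a ≫ (tensorFunctor J (vid V UnitCat)).map _ _) ≫
      pre (upair (eId V _) (hJ.ψ₀Hom _)) _ ≫
      pre (hJ.ψHom a ≫ (tensorFunctor (vid V B) (aug (V := V))).map _ _) ⟨J.obj a, ⟨⟩⟩ =
      counitRightHom (J.obj a) := by
    rw [comp_pre_assoc, ← Category.assoc, comp_pre]
    refine Eq.trans ?_ (congrArg (fun f => (ForgetEnrichment.homTo V f : 𝟙_ V ⟶ _))
      (hJ.right_counitality a))
    refine Eq.trans ?_ (homTo_comp' (V := V) (C := TensorCat B UnitCat) _ _).symm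
    refine congrArg (fun t => (hJ.ψHom a ≫ (tensorFunctor (vid V B) (aug (V := V))).map _ _) ≫
      post ((tensorFunctor (vid V B) (aug (V := V))).obj ((diag (V := V)).obj (J.obj a))) t) ?_
    refine Eq.trans ?_ (homTo_comp' (pairHom
      (𝟙 (ForgetEnrichment.of V (J.obj ((diag (V := V)).obj a).fst)))
      (hJ.ψ₀.iso ((diag (V := V)).obj a).snd).hom)
      ((tensorFunctor J (EnrichedFunctor.id V UnitCat)).forget.map (counitRight V a))).symm
    exact congrArg (fun t => t ≫ post _ _) (homTo_pairHom_id' _ _).symm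
  rw [← counitRightHom_homIso, ← counitRightHom_homIso]
  simp only [Category.assoc]
  refine (counitRightHom a ≫= h1).trans ?_
  rw [← h3]
  simp only [Category.assoc]

end StrongComonoidal

end
end EnrichedKan

namespace EnrichedKan

noncomputable section

variable {V : Type v} [Category.{w} V] [MonoidalCategory V] [SymmetricCategory V]

/-! ### Coassociativity and its transpose. -/

section Cartesian

open CartesianVCategory

variable {A : Type u} [EnrichedCategory V A] [CartesianVCategory V A]

variable (V) in
/-- The value of `(Δ ⊗ 1) Δ`, reassociated. -/
abbrev diagLeftObj (a : A) : TensorCat A (TensorCat A A) :=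
  (assocFunctor V A A A).obj ((tensorFunctor (diag (V := V)) (vid V A)).obj ((diag (V := V)).obj a))

variable (V) in
/-- The value of `(1 ⊗ Δ) Δ`. -/
abbrev diagRightObj (a : A) : TensorCat A (TensorCat A A) :=
  (tensorFunctor (vid V A) (diag (V := V))).obj ((diag (V := V)).obj a)

variable (V) in
/-- Transposition along `(Δ ⊗ 1) Δ ⊣ (- ⋆ -) ⋆ -`. -/
def leftTranspose (a x y z : A) : (diagLeftObj V a ⟶[V] ⟨x, ⟨y, z⟩⟩) ⟶
    (a ⟶[V] tobj V (tobj V x y) z) :=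
  (α_ _ _ _).inv ≫ (((diagAdj (V := V)).tensor (VAdjunction.refl A)).homIso
    ((diag (V := V)).obj a) ⟨⟨x, y⟩, z⟩).hom ≫ (diagAdj.homIso a ⟨tobj V x y, z⟩).hom

variable (V) in
/-- Transposition along `(1 ⊗ Δ) Δ ⊣ - ⋆ (- ⋆ -)`. -/
def rightTranspose (a x y z : A) : (diagRightObj V a ⟶[V] ⟨x, ⟨y, z⟩⟩) ⟶
    (a ⟶[V] tobj V x (tobj V y z)) :=
  (((VAdjunction.refl A).tensor (diagAdj (V := V))).homIso
    ((diag (V := V)).obj a) ⟨x, ⟨y, z⟩⟩).hom ≫ (diagAdj.homIso a ⟨x, tobj V y z⟩).hom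

/-- The coassociativity constraint, as a morphism of `V`. -/
def coassocHom (a : A) : 𝟙_ V ⟶ (diagLeftObj V a ⟶[V] diagRightObj V a) :=
  ForgetEnrichment.homTo V (coassoc V a)

theorem coassocHom_leftTranspose (a : A) :
    coassocHom a ≫ leftTranspose V a _ _ _ =
      (eId V (diagRightObj V a) ≫ rightTranspose V a _ _ _) ≫ post a (assocInv V _ _ _) := by
  have h : coassocHom a ≫ (diagLeftIso V a _ _ _).hom =
      ForgetEnrichment.homTo V (diagRightUnit V a ≫
        ((MonoidalVCategory.associator (V := V) (A := A)).iso ⟨⟨_, _⟩, _⟩).inv) := by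
    refine (Category.assoc _ _ _).trans ?_
    exact (congrArg (fun t => _ ≫ t) (diagLeftIso V a _ _ _).inv_hom_id).trans
      (Category.comp_id _)
  have h1 : (diagLeftIso V a _ _ _).hom = leftTranspose V a
      ((diag (V := V)).obj a).fst ((diag (V := V)).obj ((diag (V := V)).obj a).snd).fst
      ((diag (V := V)).obj ((diag (V := V)).obj a).snd).snd := by
    change _ ≫ _ ▷ _ ≫ _ = _ ≫ (_ ⊗ₘ 𝟙 _) ≫ _
    rw [tensorHom_id]
    rfl
  have h2 : (diagRightIso V a _ _ _).hom = rightTranspose V a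
      ((diag (V := V)).obj a).fst ((diag (V := V)).obj ((diag (V := V)).obj a).snd).fst
      ((diag (V := V)).obj ((diag (V := V)).obj a).snd).snd := by
    change _ ◁ _ ≫ _ = (𝟙 _ ⊗ₘ _) ≫ _
    rw [id_tensorHom]
  rw [← h1, ← h2]
  exact h.trans (homTo_comp' _ _)

/-- This is `post_map` for the associativity `V`-functor, which acts on hom-objects by `α`, read
through the inverse of `α`. -/
theorem post_assocInv {C : Type*} {C' : Type*} {C'' : Type*} [EnrichedCategory V C]
    [EnrichedCategory V C'] [EnrichedCategory V C''] (p q r : TensorCat (TensorCat C C') C'')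
    (k : 𝟙_ V ⟶ ((assocFunctor V C C' C'').obj q ⟶[V] (assocFunctor V C C' C'').obj r)) :
    post ((assocFunctor V C C' C'').obj p) k ≫ (α_ _ _ _).inv =
      (α_ _ _ _).inv ≫ post p (k ≫ (α_ _ _ _).inv : 𝟙_ V ⟶ (q ⟶[V] r)) := by
  have h := post_map (assocFunctor V C C' C'') p (k ≫ (α_ _ _ _).inv : 𝟙_ V ⟶ (q ⟶[V] r))
  rw [Category.assoc, Iso.inv_hom_id, Category.comp_id] at h
  exact (Iso.eq_inv_comp _).2 ((Category.assoc _ _ _).symm.trans ((Iso.comp_inv_eq _).2 h.symm))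

theorem pre_assocInv {C : Type*} {C' : Type*} {C'' : Type*} [EnrichedCategory V C]
    [EnrichedCategory V C'] [EnrichedCategory V C''] (p q r : TensorCat (TensorCat C C') C'')
    (k : 𝟙_ V ⟶ (p ⟶[V] q)) :
    pre (k ≫ (α_ _ _ _).hom : 𝟙_ V ⟶ ((assocFunctor V C C' C'').obj p ⟶[V]
      (assocFunctor V C C' C'').obj q)) ((assocFunctor V C C' C'').obj r) ≫ (α_ _ _ _).inv =
      (α_ _ _ _).inv ≫ pre k r := by
  have h := pre_map (assocFunctor V C C' C'') k r
  exact (Iso.eq_inv_comp _).2 ((Category.assoc _ _ _).symm.trans ((Iso.comp_inv_eq _).2 h.symm))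

theorem pre_assocInv_assoc {C : Type*} {C' : Type*} {C'' : Type*} [EnrichedCategory V C]
    [EnrichedCategory V C'] [EnrichedCategory V C''] (p q r : TensorCat (TensorCat C C') C'')
    (k : 𝟙_ V ⟶ (p ⟶[V] q)) {Z : V} (g : (p ⟶[V] r) ⟶ Z) :
    pre (k ≫ (assocFunctor V C C' C'').map p q) ((assocFunctor V C C' C'').obj r) ≫
      (α_ _ _ _).inv ≫ g = (α_ _ _ _).inv ≫ pre k r ≫ g :=
  (Category.assoc _ _ _).symm.trans ((eq_whisker (pre_assocInv p q r k) g).trans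
    (Category.assoc _ _ _))

theorem post_leftTranspose (a : A) {x y z x' y' z' : A}
    (k : 𝟙_ V ⟶ ((⟨x, ⟨y, z⟩⟩ : TensorCat A (TensorCat A A)) ⟶[V] ⟨x', ⟨y', z'⟩⟩)) :
    post (diagLeftObj V a) k ≫ leftTranspose V a x' y' z' = leftTranspose V a x y z ≫
      post a (k ≫ (α_ _ _ _).inv ≫ tmap V x y x' y' ▷ _ ≫
        tmap V (tobj V x y) z (tobj V x' y') z') := by
  have h1 := post_assocInv ((tensorFunctor (diag (V := V)) (vid V A)).obj
    ((diag (V := V)).obj a)) ⟨⟨x, y⟩, z⟩ ⟨⟨x', y'⟩, z'⟩ k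
  have h2 := ((diagAdj (V := V)).tensor (VAdjunction.refl A)).homIso_hom_post
    ((diag (V := V)).obj a) (k ≫ (α_ _ _ _).inv :
      𝟙_ V ⟶ ((⟨⟨x, y⟩, z⟩ : TensorCat (TensorCat A A) A) ⟶[V] ⟨⟨x', y'⟩, z'⟩))
  dsimp only at h2
  rw [tensorHom_id] at h2
  have h3 := (diagAdj (V := V) (A := A)).homIso_hom_post a
    ((k ≫ (α_ _ _ _).inv) ≫ tmap V x y x' y' ▷ _ :
      𝟙_ V ⟶ ((⟨tobj V x y, z⟩ : TensorCat A A) ⟶[V] ⟨tobj V x' y', z'⟩))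
  simp only [Category.assoc] at h3
  rw [leftTranspose, leftTranspose, reassoc_of% h1, reassoc_of% h2, Category.assoc,
    Category.assoc, ← h3]

theorem post_rightTranspose (a : A) {x y z x' y' z' : A}
    (k : 𝟙_ V ⟶ ((⟨x, ⟨y, z⟩⟩ : TensorCat A (TensorCat A A)) ⟶[V] ⟨x', ⟨y', z'⟩⟩)) :
    post (diagRightObj V a) k ≫ rightTranspose V a x' y' z' = rightTranspose V a x y z ≫
      post a (k ≫ _ ◁ tmap V y z y' z' ≫ tmap V x (tobj V y z) x' (tobj V y' z')) := by
  have h2 := ((VAdjunction.refl A).tensor (diagAdj (V := V))).homIso_hom_post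
    ((diag (V := V)).obj a) k
  dsimp only at h2
  rw [id_tensorHom] at h2
  have h3 := (diagAdj (V := V) (A := A)).homIso_hom_post a
    (k ≫ _ ◁ tmap V y z y' z' :
      𝟙_ V ⟶ ((⟨x, tobj V y z⟩ : TensorCat A A) ⟶[V] ⟨x', tobj V y' z'⟩))
  rw [Category.assoc] at h3
  rw [rightTranspose, rightTranspose, reassoc_of% h2, Category.assoc, ← h3]

/-- Yoneda: `coassocHom_leftTranspose` is the case of an identity, and naturality of both
transpositions and of the associator extends it to every `k`. -/
theorem pre_coassocHom_leftTranspose (a : A) {x y z : A}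
    (k : 𝟙_ V ⟶ (diagRightObj V a ⟶[V] ⟨x, ⟨y, z⟩⟩)) :
    k ≫ pre (coassocHom a) _ ≫ leftTranspose V a x y z =
      k ≫ rightTranspose V a x y z ≫ post a (assocInv V x y z) := by
  have h1 := k ≫= assocInv_naturality V _ _ _ x y z
  have h2 := comp_pre (assocInv V _ _ _) (k ≫ (α_ _ _ _).inv ≫ tmap V _ _ x y ▷ _ ≫
    tmap V (tobj V _ _) _ (tobj V x y) z)
  have h3 := post_rightTranspose a k
  have h4 := post_comp a (k ≫ _ ◁ tmap V _ _ y z ≫ tmap V _ (tobj V _ _) x (tobj V y z))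
    (assocInv V x y z)
  simp only [Category.assoc] at h1 h2 h4
  rw [comp_pre_assoc, post_leftTranspose, ← Category.assoc, coassocHom_leftTranspose,
    Category.assoc, ← post_comp, ← h2, h1, h4, Category.assoc, ← reassoc_of% h3, eId_post_assoc]

end Cartesian

namespace StrongComonoidal

open CartesianVCategory

variable {A : Type u₁} {B : Type u₂} [EnrichedCategory V A] [EnrichedCategory V B]
  [CartesianVCategory V A] [CartesianVCategory V B] {J : EnrichedFunctor V A B}
  (hJ : StrongComonoidal J)

theorem coassocHom_map (a : A) :
    ((hJ.ψHom a ≫ (tensorFunctor (diag (V := V)) (vid V B)).map _ _) ≫ (assocFunctor V B B B).map _ _) ≫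
      post (diagLeftObj V (J.obj a)) ((upair (hJ.ψHom ((diag (V := V)).obj a).fst)
        (eId V (J.obj ((diag (V := V)).obj a).snd)) ≫ (assocFunctor V B B B).map _ _) ≫
        post ((assocFunctor V B B B).obj ((tensorFunctor (diag (V := V)) (vid V B)).obj
          ((tensorFunctor J J).obj ((diag (V := V)).obj a))))
          (coassocHom a ≫ (tensorFunctor J (tensorFunctor J J)).map _ _)) =
    coassocHom (J.obj a) ≫ post (diagLeftObj V (J.obj a))
      ((hJ.ψHom a ≫ (tensorFunctor (vid V B) (diag (V := V))).map _ _) ≫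
        post (diagRightObj V (J.obj a)) (upair (eId V (J.obj ((diag (V := V)).obj a).fst))
          (hJ.ψHom ((diag (V := V)).obj a).snd))) := by
  have h := congrArg (fun f => (ForgetEnrichment.homTo V f : 𝟙_ V ⟶ _)) (hJ.coassociativity a)
  have h0 : upair (hJ.ψHom ((diag (V := V)).obj a).fst)
      (eId V (J.obj ((diag (V := V)).obj a).snd)) = _ :=
    (homTo_pairHom_id (hJ.ψ.iso ((diag (V := V) (A := A)).obj a).fst).hom
      (J.obj ((diag (V := V)).obj a).snd)).symm
  have h0' : upair (eId V (J.obj ((diag (V := V)).obj a).fst))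
      (hJ.ψHom ((diag (V := V)).obj a).snd) = _ :=
    (homTo_pairHom_id' (J.obj ((diag (V := V)).obj a).fst)
      (hJ.ψ.iso ((diag (V := V) (A := A)).obj a).snd).hom).symm
  rw [h0, h0']
  have h1 := homTo_comp' ((assocFunctor V B B B).forget.map (pairHom
    (hJ.ψ.iso ((diag (V := V) (A := A)).obj a).fst).hom
      (𝟙 (ForgetEnrichment.of V (J.obj ((diag (V := V) (A := A)).obj a).snd)))))
    ((tensorFunctor J (tensorFunctor J J)).forget.map (coassoc V a))
  have h2 := homTo_comp' ((tensorFunctor (EnrichedFunctor.id V B)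
    (diag (V := V) (A := B))).forget.map (hJ.ψ.iso a).hom)
    (pairHom (𝟙 (ForgetEnrichment.of V (J.obj ((diag (V := V) (A := A)).obj a).fst)))
      (hJ.ψ.iso ((diag (V := V) (A := A)).obj a).snd).hom)
  refine Eq.trans ?_ (h.trans ?_)
  · refine Eq.trans ?_ (homTo_comp' _ _).symm
    exact congrArg (fun t => _ ≫ post (diagLeftObj V (J.obj a)) t) h1.symm
  · refine (homTo_comp' _ _).trans ?_
    exact congrArg (fun t => _ ≫ post (diagLeftObj V (J.obj a)) t) h2

/-- Pasting of the square for `χ` with the square for `χ ⊗ 1`; the inverse associator of `V` is then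
carried past the precompositions and past `J ⊗ (J ⊗ J)`. -/
theorem leftTranspose_map_χ (a x y z : A) :
    leftTranspose V a x y z ≫ J.map _ _ ≫ post _ (hJ.χ ⟨tobj V x y, z⟩) ≫
      post _ (utensor (hJ.χ ⟨x, y⟩) (eId V (J.obj z))) =
    (tensorFunctor J (tensorFunctor J J)).map _ _ ≫
      pre (upair (hJ.ψHom ((diag (V := V)).obj a).fst)
        (eId V (J.obj ((diag (V := V)).obj a).snd)) ≫ (assocFunctor V B B B).map _ _) _ ≫
      pre ((hJ.ψHom a ≫ (tensorFunctor (diag (V := V)) (vid V B)).map _ _) ≫ (assocFunctor V B B B).map _ _) _ ≫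
      leftTranspose V (J.obj a) (J.obj x) (J.obj y) (J.obj z) := by
  have h1 := hJ.areMates_χ.comp (hJ.areMates_χ.tensor (areMates_refl J)) a ⟨⟨x, y⟩, z⟩
  rw [leftTranspose, leftTranspose, Category.assoc, Category.assoc]
  refine (_ ≫= h1).trans ?_
  rw [pre_assocInv_assoc _ _ ⟨⟨J.obj x, J.obj y⟩, J.obj z⟩ (hJ.ψHom a ≫
      (tensorFunctor (diag (V := V)) (vid V B)).map _ _),
    pre_assocInv_assoc _ _ ⟨⟨J.obj x, J.obj y⟩, J.obj z⟩
      (upair (hJ.ψHom ((diag (V := V)).obj a).fst) (eId V (J.obj ((diag (V := V)).obj a).snd)))]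
  exact (associator_inv_naturality_assoc _ _ _ _).symm

theorem rightTranspose_map_χ (a x y z : A) :
    rightTranspose V a x y z ≫ J.map _ _ ≫ post _ (hJ.χ ⟨x, tobj V y z⟩) ≫
      post _ (utensor (eId V (J.obj x)) (hJ.χ ⟨y, z⟩)) =
    (tensorFunctor J (tensorFunctor J J)).map _ _ ≫
      pre (upair (eId V (J.obj ((diag (V := V)).obj a).fst))
        (hJ.ψHom ((diag (V := V)).obj a).snd)) _ ≫
      pre (hJ.ψHom a ≫ (tensorFunctor (vid V B) (diag (V := V))).map _ _) _ ≫
      rightTranspose V (J.obj a) (J.obj x) (J.obj y) (J.obj z) := by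
  have h1 := hJ.areMates_χ.comp ((areMates_refl J).tensor hJ.areMates_χ) a ⟨x, ⟨y, z⟩⟩
  rw [rightTranspose, Category.assoc]
  exact h1

/-- The left and right transpositions are carried across `J` by pasted mates. The coassociativity
constraints mediate between the two on each side of `J`, and the coassociativity axiom of `J` says
that these agree. -/
theorem assocInv_map_χ (x y z : A) :
    assocInv V x y z ≫ J.map _ _ ≫ post _ (hJ.χ ⟨tobj V x y, z⟩) ≫
      post _ (utensor (hJ.χ ⟨x, y⟩) (eId V (J.obj z))) =
    (hJ.χ ⟨x, tobj V y z⟩ ≫ post _ (utensor (eId V (J.obj x)) (hJ.χ ⟨y, z⟩))) ≫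
      post _ (assocInv V (J.obj x) (J.obj y) (J.obj z)) := by
  -- The element `k` is the inverse transpose of the identity of `x ⋆ (y ⋆ z)`, so an equation of
  -- transposes evaluated at `k` becomes one about the associator itself.
  obtain ⟨k, hk⟩ : ∃ k : 𝟙_ V ⟶ (diagRightObj V (tobj V x (tobj V y z)) ⟶[V] ⟨x, ⟨y, z⟩⟩),
      k ≫ rightTranspose V _ x y z = eId V _ :=
    ⟨eId V _ ≫ (diagAdj.homIso _ ⟨x, tobj V y z⟩).inv ≫
      (((VAdjunction.refl A).tensor (diagAdj (V := V))).homIso _ ⟨x, ⟨y, z⟩⟩).inv, by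
      simp [rightTranspose]⟩
  have h1 := pre_coassocHom_leftTranspose _ k
  have h2 := hJ.leftTranspose_map_χ (tobj V x (tobj V y z)) x y z
  have h3 := k ≫= hJ.rightTranspose_map_χ (tobj V x (tobj V y z)) x y z
  rw [reassoc_of% hk, EnrichedFunctor.map_id_assoc, eId_post_assoc] at h3
  rw [reassoc_of% hk, eId_post] at h1
  have h4 := pre_map (tensorFunctor J (tensorFunctor J J)) (coassocHom (tobj V x (tobj V y z)))
    ⟨x, ⟨y, z⟩⟩
  have h5 := pre_coassocHom_leftTranspose (V := V) (J.obj (tobj V x (tobj V y z)))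
    (x := J.obj x) (y := J.obj y) (z := J.obj z)
    (((k ≫ (tensorFunctor J (tensorFunctor J J)).map _ _) ≫
      pre (upair (eId V (J.obj ((diag (V := V)).obj _).fst))
        (hJ.ψHom ((diag (V := V)).obj _).snd)) _) ≫
      pre (hJ.ψHom _ ≫ (tensorFunctor (vid V B) (diag (V := V))).map _ _) ⟨J.obj x, ⟨J.obj y, J.obj z⟩⟩)
  rw [h3, ← h1]
  simp only [Category.assoc] at h5 ⊢
  rw [h2, ← h5, reassoc_of% h4, ← pre_comp_assoc, ← pre_comp_assoc, ← pre_comp_assoc,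
    ← pre_comp_assoc, hJ.coassocHom_map]

end StrongComonoidal

end
end EnrichedKan

namespace EnrichedKan

noncomputable section

variable {V : Type v} [Category.{w} V] [MonoidalCategory V] [SymmetricCategory V]

/-! ### Tensor powers of a pointwise left Kan extension -/

theorem IsConat.vid_tensor {B : Type*} {B' : Type*} {X : Type*} {X' : Type*} [EnrichedCategory V B]
    [EnrichedCategory V B'] [EnrichedCategory V X] [EnrichedCategory V X']
    {K : EnrichedFunctor V B X} {K' : EnrichedFunctor V B' X'} {b : B} {b' : B'} {x : X} {x' : X'}
    {κ : ∀ c, (b ⟶[V] c) ⟶ (x ⟶[V] K.obj c)} {κ' : ∀ c, (b' ⟶[V] c) ⟶ (x' ⟶[V] K'.obj c)}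
    (h : IsConat (vid V B) K b x κ) (h' : IsConat (vid V B') K' b' x' κ') :
    IsConat (vid V (TensorCat B B')) (tensorFunctor K K') ⟨b, b'⟩ ⟨x, x'⟩
      fun c => κ c.fst ⊗ₘ κ' c.snd := by
  intro c d
  have h1 := h.tensor h' c d
  change _ ◁ (𝟙 _ ⊗ₘ 𝟙 _) ≫ _ = _ at h1
  rw [id_tensorHom_id] at h1
  exact h1

section Lan

variable [MonoidalClosed V] {A : Type u₁} {B : Type u₂} {X : Type u₃}
  [EnrichedCategory V A] [EnrichedCategory V B] [EnrichedCategory V X]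
  {J : EnrichedFunctor V A B} {F : EnrichedFunctor V A X} {K : EnrichedFunctor V B X}
  (hK : PointwiseLeftKanExtension J F K)

namespace PointwiseLeftKanExtension

theorem isConat (a : A) : IsConat (vid V B) K (J.obj a) (F.obj a) fun b => hK.κ b a := by
  intro b b'
  rw [MonoidalCategory.whiskerLeft_id, Category.id_comp]
  exact hK.natural a b b'

/-- Descent is kept only for global elements, whereas joint epimorphy is kept for all parameters;
this is what `exists_comparison` uses. -/
theorem isKan : IsKan J F K hK.κ where
  conat := hK.isConat
  isColim b :=
    { nat := (hK.isColimit b).isNat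
      jointEpi := (hK.isColimit b).jointEpi
      desc := (hK.isColimit b).hasParamDesc.desc }

variable [MonoidalVCategory V X]

/-- The family exhibiting `K ⋆ K` as a left Kan extension of `F ⋆ F` along `J ⊗ J`. -/
def κ₂ (q : TensorCat B B) (p : TensorCat A A) : ((tensorFunctor J J).obj p ⟶[V] q) ⟶
    ((tensorFunctor F F ⋙ᵥ MonoidalVCategory.tensor (V := V)).obj p ⟶[V]
      (tensorFunctor K K ⋙ᵥ MonoidalVCategory.tensor (V := V)).obj q) :=
  (hK.κ q.fst p.fst ⊗ₘ hK.κ q.snd p.snd) ≫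
    tmap V (F.obj p.fst) (F.obj p.snd) (K.obj q.fst) (K.obj q.snd)

section

variable (hL : ∀ x : X, PreservesColimits.{w, v, u₁} (tensorLeftFunctor V x))
  (hR : ∀ x : X, PreservesColimits.{w, v, u₁} (tensorRightFunctor V x))
include hL hR

/-- The outer colimit is preserved by `- ⋆ K b'` and the inner one by `F a ⋆ -`. The only preserved
colimits used are those indexed by `A`. -/
theorem isKan_κ₂ : IsKan (tensorFunctor J J)
    (tensorFunctor F F ⋙ᵥ MonoidalVCategory.tensor (V := V))
    (tensorFunctor K K ⋙ᵥ MonoidalVCategory.tensor (V := V)) hK.κ₂ where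
  conat p := ((hK.isConat p.fst).vid_tensor (hK.isConat p.snd)).comp
    (isConat_map (tensorFunctor K K) (MonoidalVCategory.tensor (V := V)) ⟨F.obj p.fst, F.obj p.snd⟩)
  isColim q := IsColim.tensor (MonoidalVCategory.tensor (V := V) (A := X))
    (hK.isColimit q.fst).isNat (hK.isColimit q.snd).isNat
    -- The partial functors of `⋆` agree definitionally with the functors in `hL` and `hR`.
    (hR _ A _ _ _ _ (hK.isColimit q.fst)).jointEpi
    (fun _ => (hL _ A _ _ _ _ (hK.isColimit q.snd)).jointEpi)
    (hR _ A _ _ _ _ (hK.isColimit q.fst)).hasParamDesc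
    (fun _ => (hL _ A _ _ _ _ (hK.isColimit q.snd)).hasParamDesc)

/-- For the associativity axiom only uniqueness on triple tensors is needed. Two successive
tensorings preserve the colimits in the first two variables, and `F a ⋆ F a' ⋆ -` is handled by one
more. -/
theorem jointEpi_κ₃ (x y z : B) :
    JointEpi fun p : TensorCat (TensorCat A A) A => (hK.κ₂ ⟨x, y⟩ p.fst ⊗ₘ hK.κ z p.snd) ≫
      tmap V _ (F.obj p.snd) (tobj V (K.obj x) (K.obj y)) (K.obj z) := by
  refine JointEpi.tensor (MonoidalVCategory.tensor (V := V) (A := X)) (G := fun p : TensorCat A A =>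
    tobj V (F.obj p.fst) (F.obj p.snd)) (G' := F.obj) (l := hK.κ₂ ⟨x, y⟩) (l' := hK.κ z) ?_
    (fun _ => (hL _ A _ _ _ _ (hK.isColimit z)).jointEpi)
  have h := JointEpi.tensor (MonoidalVCategory.tensor (V := V) (A := X) ⋙ᵥ
    partialFst (MonoidalVCategory.tensor (V := V) (A := X)) (K.obj z)) (G := F.obj) (G' := F.obj)
    (l := hK.κ x) (l' := hK.κ y)
    (by
      have h := (hR (K.obj z) A _ _ _ _ (hR (K.obj y) A _ _ _ _ (hK.isColimit x))).jointEpi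
      refine Eq.mp (congrArg JointEpi (funext fun a => ?_)) h
      exact (Category.assoc _ _ _).trans (congrArg (hK.κ x a ≫ ·) (Category.assoc _ _ _)))
    (fun a => by
      have h := (hR (K.obj z) A _ _ _ _ (hL (F.obj a) A _ _ _ _ (hK.isColimit y))).jointEpi
      refine Eq.mp (congrArg JointEpi (funext fun a => ?_)) h
      exact (Category.assoc _ _ _).trans (congrArg (hK.κ y a ≫ ·) (Category.assoc _ _ _)))
  refine Eq.mp (congrArg JointEpi (funext fun a => ?_)) h
  exact (Category.assoc _ _ _).symm

omit hR in
theorem jointEpi_left (b : B) (x : X) : JointEpi fun a => (λ_ _).inv ≫ eId V x ▷ _ ≫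
    _ ◁ hK.κ b a ≫ tmap V x (F.obj a) x (K.obj b) := by
  have h := (hL x A _ _ _ _ (hK.isColimit b)).jointEpi
  refine Eq.mp (congrArg JointEpi (funext fun a => ?_)) h
  have e : hK.κ b a ≫ ((λ_ _).inv ≫ (eId V x ⊗ₘ 𝟙 _)) ≫ tmap V x (F.obj a) x (K.obj b) =
      (λ_ _).inv ≫ eId V x ▷ _ ≫ _ ◁ hK.κ b a ≫ tmap V x (F.obj a) x (K.obj b) := by
    rw [Category.assoc, leftUnitor_inv_naturality_assoc, tensorHom_id, whisker_exchange_assoc]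
  exact e

omit hL in
theorem jointEpi_right (b : B) (x : X) : JointEpi fun a => (ρ_ _).inv ≫ _ ◁ eId V x ≫
    hK.κ b a ▷ _ ≫ tmap V (F.obj a) x (K.obj b) x := by
  have h := (hR x A _ _ _ _ (hK.isColimit b)).jointEpi
  refine Eq.mp (congrArg JointEpi (funext fun a => ?_)) h
  have e : hK.κ b a ≫ ((ρ_ _).inv ≫ (𝟙 _ ⊗ₘ eId V x)) ≫ tmap V (F.obj a) x (K.obj b) x =
      (ρ_ _).inv ≫ _ ◁ eId V x ≫ hK.κ b a ▷ _ ≫ tmap V (F.obj a) x (K.obj b) x := by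
    rw [Category.assoc, rightUnitor_inv_naturality_assoc, id_tensorHom, whisker_exchange_assoc]
  exact e

end

end PointwiseLeftKanExtension

end Lan

/-! ### Kan extension along the identity of the unit `V`-category. -/

section Unit

omit [SymmetricCategory V] in
-- The weight is the unit of `V` and the only component of the family is an identity, so a map out
-- of the colimit is the same as the family it induces.
theorem isKan_unit {X : Type*} [EnrichedCategory V X] (F : EnrichedFunctor V UnitCat X) :
    IsKan (vid V UnitCat) F F fun q p => F.map p q where
  conat p := isConat_vid_map F p
  isColim q :=
    { nat := by
        have h := isNat_map (vid V UnitCat) F q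
        intro d d'
        have h1 := h d d'
        simp only [Category.id_comp] at h1
        exact h1
      jointEpi := by
        intro y Z f g h
        have h1 (f : Z ⟶ (F.obj q ⟶[V] y)) :
            (λ_ Z).inv ≫ (F.map q q ⊗ₘ f) ≫ eComp V (F.obj q) (F.obj q) y = f := by
          have h2 : F.map q q = eId V (F.obj q) := (Category.id_comp _).symm.trans (F.map_id q)
          rw [h2]
          change (λ_ Z).inv ≫ ((eId V (F.obj q) : 𝟙_ V ⟶ _) ⊗ₘ f) ≫ _ = _
          rw [MonoidalCategory.tensorHom_def', Category.assoc, ← leftUnitor_inv_naturality_assoc,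
            e_id_comp, Category.comp_id]
        rw [← h1 f, ← h1 g, h q]
      desc := by
        intro y m hm
        refine ⟨m q, fun d => ?_⟩
        have h2 : F.map d q = eId V (F.obj q) := (Category.id_comp _).symm.trans (F.map_id q)
        rw [h2]
        exact eId_post (m q) }

end Unit

end
end EnrichedKan

namespace EnrichedKan

noncomputable section

variable {V : Type v} [Category.{w} V] [MonoidalCategory V] [SymmetricCategory V]

/-! ### Coherence of the comparison morphisms -/

section Calculus

variable {A : Type u} [EnrichedCategory V A] [MonoidalVCategory V A]

theorem tmap_post (x x' : A) {y y' z z' : A} (f : 𝟙_ V ⟶ (y ⟶[V] z)) (g : 𝟙_ V ⟶ (y' ⟶[V] z')) :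
    tmap V x x' y y' ≫ post _ (utensor f g) = (post x f ⊗ₘ post x' g) ≫ tmap V x x' z z' := by
  have h := post_map (MonoidalVCategory.tensor (V := V) (A := A)) ⟨x, x'⟩ (upair f g)
  rw [post_upair] at h
  exact h.symm

theorem tmap_pre {x x' y y' : A} (z z' : A) (f : 𝟙_ V ⟶ (x ⟶[V] y)) (g : 𝟙_ V ⟶ (x' ⟶[V] y')) :
    tmap V y y' z z' ≫ pre (utensor f g) _ = (pre f z ⊗ₘ pre g z') ≫ tmap V x x' z z' := by
  have h := pre_map (MonoidalVCategory.tensor (V := V) (A := A)) (upair f g) ⟨z, z'⟩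
  rw [pre_upair] at h
  exact h.symm

theorem tmap_pre_assoc {x x' y y' : A} (z z' : A) (f : 𝟙_ V ⟶ (x ⟶[V] y))
    (g : 𝟙_ V ⟶ (x' ⟶[V] y')) {Z : V} (k : (tobj V x x' ⟶[V] tobj V z z') ⟶ Z) :
    tmap V y y' z z' ≫ pre (utensor f g) _ ≫ k =
      (pre f z ⊗ₘ pre g z') ≫ tmap V x x' z z' ≫ k := by
  rw [← Category.assoc, tmap_pre, Category.assoc]

end Calculus

section Coherence

variable {A : Type u₁} {B : Type u₂} {X : Type u₃}
  [EnrichedCategory V A] [EnrichedCategory V B] [EnrichedCategory V X]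
  [MonoidalVCategory V A] [MonoidalVCategory V B] [MonoidalVCategory V X]
  {J : EnrichedFunctor V A B} {F : EnrichedFunctor V A X} {K : EnrichedFunctor V B X}
  {κ : ∀ b a, (J.obj a ⟶[V] b) ⟶ (F.obj a ⟶[V] K.obj b)} (hκ : IsKan J F K κ)
  {χ : ∀ a a', 𝟙_ V ⟶ (J.obj (tobj V a a') ⟶[V] tobj V (J.obj a) (J.obj a'))}
  {μ : ∀ a a', 𝟙_ V ⟶ (tobj V (F.obj a) (F.obj a') ⟶[V] F.obj (tobj V a a'))}
  {M : ∀ b b', 𝟙_ V ⟶ (tobj V (K.obj b) (K.obj b') ⟶[V] K.obj (tobj V b b'))}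
  (hM : ∀ b b' a a', (κ b a ⊗ₘ κ b' a') ≫ tmap V _ _ _ _ ≫ post _ (M b b') =
    tmap V _ _ _ _ ≫ pre (χ a a') _ ≫ κ (tobj V b b') (tobj V a a') ≫ pre (μ a a') _)
include hκ hM

/-- Each `M` crosses the colimiting family by `hM`, and the associator of `B` crosses `κ` by
naturality in `b`. Everything about `J` ends up before `κ` and everything about `F` after it, ready
for the two coherence hypotheses. -/
theorem comparison_left (x y z : B) (a a' a'' : A) :
    ((κ x a ⊗ₘ κ y a') ≫ tmap V _ _ _ _ ⊗ₘ κ z a'') ≫ tmap V _ _ _ _ ≫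
      post _ (utensor (M x y) (eId V (K.obj z))) ≫ post _ (M (tobj V x y) z) ≫
        post _ (assocHom V x y z ≫ K.map _ _) =
    (α_ _ _ _).hom ≫ _ ◁ tmap V _ _ _ _ ≫ tmap V _ _ _ _ ≫
      pre (assocHom V (J.obj a) (J.obj a') (J.obj a'')) _ ≫
      pre (utensor (χ a a') (eId V (J.obj a''))) _ ≫ pre (χ (tobj V a a') a'') _ ≫
      κ (tobj V x (tobj V y z)) (tobj V (tobj V a a') a'') ≫
      pre (μ (tobj V a a') a'') _ ≫ pre (utensor (μ a a') (eId V (F.obj a''))) _ := by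
  have h1 := hM x y a a'
  have h2 := hM (tobj V x y) z (tobj V a a') a''
  have h3 := (hκ.conat (tobj V (tobj V a a') a'')).post (assocHom V x y z)
  have h4 : ((κ x a ⊗ₘ κ y a') ≫ tmap V _ _ _ _ ⊗ₘ κ z a'') ≫ tmap V _ _ _ _ ≫
      post _ (utensor (M x y) (eId V (K.obj z))) = tmap V _ _ _ _ ▷ _ ≫
        (pre (χ a a') _ ⊗ₘ 𝟙 _) ≫ (κ (tobj V x y) (tobj V a a') ⊗ₘ κ z a'') ≫
          tmap V _ _ _ _ ≫ pre (utensor (μ a a') (eId V (F.obj a''))) _ := by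
    rw [tmap_post, tmap_pre, tensorHom_comp_tensorHom_assoc, tensorHom_comp_tensorHom_assoc,
      Category.assoc, h1, tensorHom_comp_tensorHom_assoc, whiskerRight_comp_tensorHom_assoc,
      post_id, pre_id, Category.id_comp, Category.assoc]
  have h5 : tmap V _ _ _ _ ▷ _ ≫ (pre (χ a a') (tobj V x y) ⊗ₘ 𝟙 _) ≫ tmap V _ _ _ z ≫
      post _ (assocHom V x y z) = (α_ _ _ _).hom ≫ _ ◁ tmap V _ _ _ _ ≫ tmap V _ _ _ _ ≫
        pre (assocHom V (J.obj a) (J.obj a') (J.obj a'')) _ ≫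
          pre (utensor (χ a a') (eId V (J.obj a''))) _ := by
    rw [← pre_id (J.obj a''), ← tmap_pre_assoc, pre_post, assocHom_naturality_assoc]
  rw [reassoc_of% h4, pre_post_assoc, pre_post, reassoc_of% h2, pre_post_assoc, ← reassoc_of% h3,
    pre_post_assoc, reassoc_of% h5]

omit hκ in
-- Here the associator of `X` is first moved past the colimiting family to the side of `F`; then
-- each `M` crosses by `hM`.
theorem comparison_right (x y z : B) (a a' a'' : A) :
    ((κ x a ⊗ₘ κ y a') ≫ tmap V _ _ _ _ ⊗ₘ κ z a'') ≫ tmap V _ _ _ _ ≫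
      post _ (assocHom V (K.obj x) (K.obj y) (K.obj z)) ≫
      post _ (utensor (eId V (K.obj x)) (M y z)) ≫ post _ (M x (tobj V y z)) =
    (α_ _ _ _).hom ≫ _ ◁ tmap V _ _ _ _ ≫ tmap V _ _ _ _ ≫
      pre (utensor (eId V (J.obj a)) (χ a' a'')) _ ≫ pre (χ a (tobj V a' a'')) _ ≫
      κ (tobj V x (tobj V y z)) (tobj V a (tobj V a' a'')) ≫
      pre (μ a (tobj V a' a'')) _ ≫ pre (utensor (eId V (F.obj a)) (μ a' a'')) _ ≫
      pre (assocHom V (F.obj a) (F.obj a') (F.obj a'')) _ := by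
  have h1 := hM y z a' a''
  have h2 := hM x (tobj V y z) a (tobj V a' a'')
  have h4 : (κ x a ⊗ₘ (κ y a' ⊗ₘ κ z a'') ≫ tmap V _ _ _ _) ≫ tmap V _ _ _ _ ≫
      post _ (utensor (eId V (K.obj x)) (M y z)) = _ ◁ tmap V _ _ _ _ ≫
        (𝟙 _ ⊗ₘ pre (χ a' a'') _) ≫ (κ x a ⊗ₘ κ (tobj V y z) (tobj V a' a'')) ≫
          tmap V _ _ _ _ ≫ pre (utensor (eId V (F.obj a)) (μ a' a'')) _ := by
    rw [tmap_post, tmap_pre, tensorHom_comp_tensorHom_assoc, tensorHom_comp_tensorHom_assoc,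
      Category.assoc, h1, tensorHom_comp_tensorHom_assoc, whiskerLeft_comp_tensorHom_assoc,
      post_id, pre_id, Category.id_comp, Category.assoc]
  have h5 : (𝟙 _ ⊗ₘ pre (χ a' a'') (tobj V y z)) ≫ tmap V (J.obj a) _ x _ =
      tmap V _ _ _ _ ≫ pre (utensor (eId V (J.obj a)) (χ a' a'')) _ := by
    rw [← pre_id (J.obj a), ← tmap_pre]
  have h6 : ((κ x a ⊗ₘ κ y a') ≫ tmap V _ _ _ _ ⊗ₘ κ z a'') ≫ tmap V _ _ _ _ ≫
      post _ (assocHom V (K.obj x) (K.obj y) (K.obj z)) =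
      (α_ _ _ _).hom ≫ (κ x a ⊗ₘ (κ y a' ⊗ₘ κ z a'') ≫ tmap V _ _ _ _) ≫ tmap V _ _ _ _ ≫
        pre (assocHom V (F.obj a) (F.obj a') (F.obj a'')) _ := by
    rw [← tensorHom_comp_whiskerRight_assoc, assocHom_naturality, associator_naturality_assoc,
      tensorHom_comp_whiskerLeft_assoc]
  rw [reassoc_of% h6, pre_post_assoc, pre_post, reassoc_of% h4, pre_post_assoc, reassoc_of% h2,
    reassoc_of% h5]

/-- On the triple colimiting family, `hJ` rewrites the part before `κ` and `hF` the part after it;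
naturality of `κ` in `a` carries the associator of `A` from one part to the other. -/
theorem comparison_associativity {x y z : B}
    (hJ : ∀ a a' a'', (assocHom V a a' a'' ≫ J.map _ _) ≫ post _ (χ a (tobj V a' a'') ≫
      post _ (utensor (eId V (J.obj a)) (χ a' a''))) =
      χ (tobj V a a') a'' ≫ post _ (utensor (χ a a') (eId V (J.obj a'')) ≫
        post _ (assocHom V (J.obj a) (J.obj a') (J.obj a''))))
    (hF : ∀ a a' a'', utensor (μ a a') (eId V (F.obj a'')) ≫ post _ (μ (tobj V a a') a'' ≫
      post _ (assocHom V a a' a'' ≫ F.map _ _)) =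
      assocHom V (F.obj a) (F.obj a') (F.obj a'') ≫ post _ (utensor (eId V (F.obj a)) (μ a' a'') ≫
        post _ (μ a (tobj V a' a''))))
    (hepi : JointEpi fun p : TensorCat (TensorCat A A) A =>
      ((κ x p.fst.fst ⊗ₘ κ y p.fst.snd) ≫ tmap V _ _ _ _ ⊗ₘ κ z p.snd) ≫
        tmap V (tobj V (F.obj p.fst.fst) (F.obj p.fst.snd)) (F.obj p.snd)
          (tobj V (K.obj x) (K.obj y)) (K.obj z)) :
    utensor (M x y) (eId V (K.obj z)) ≫ post _ (M (tobj V x y) z ≫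
      post _ (assocHom V x y z ≫ K.map _ _)) =
      assocHom V (K.obj x) (K.obj y) (K.obj z) ≫ post _ (utensor (eId V (K.obj x)) (M y z) ≫
        post _ (M x (tobj V y z))) := by
  refine hepi.ext fun p => ?_
  obtain ⟨⟨a, a'⟩, a''⟩ := p
  have h1 := congrArg (fun t => pre t (tobj V x (tobj V y z))) (hJ a a' a'')
  have h2 := congrArg (fun t => pre t (K.obj (tobj V x (tobj V y z)))) (hF a a' a'')
  have h3 := (hκ.isColim (tobj V x (tobj V y z))).nat.pre (assocHom V a a' a'')
  simp only [pre_comp] at h1 h2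
  simp only [Category.assoc] at h1 h2
  dsimp only
  rw [post_comp, post_comp, post_comp, post_comp, Category.assoc, Category.assoc,
    comparison_left hκ hM, comparison_right hM, ← reassoc_of% h1, ← h2, ← reassoc_of% h3]

/-- By `he`, inserting `e` amounts to evaluating the colimiting family for `(N, b)` at `χ₀`; then
`hM` applies, and the unit axioms for `χ` and for `F` meet across `κ`. -/
theorem comparison_leftUnitor {χ₀ : 𝟙_ V ⟶ (J.obj (uobj V A) ⟶[V] uobj V B)}
    {ε : 𝟙_ V ⟶ (uobj V X ⟶[V] F.obj (uobj V A))} {e : 𝟙_ V ⟶ (uobj V X ⟶[V] K.obj (uobj V B))}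
    {b : B} (he : e = χ₀ ≫ κ (uobj V B) (uobj V A) ≫ pre ε _)
    (hJ : ∀ a, χ (uobj V A) a ≫ post _ (utensor χ₀ (eId V (J.obj a)) ≫
      post _ (leftHom V (J.obj a))) = leftHom V a ≫ J.map _ _)
    (hF : ∀ a, utensor ε (eId V (F.obj a)) ≫ post _ (μ (uobj V A) a ≫
      post _ (leftHom V a ≫ F.map _ _)) = leftHom V (F.obj a))
    (hepi : JointEpi fun a => (λ_ _).inv ≫ eId V (uobj V X) ▷ _ ≫
      _ ◁ κ b a ≫ tmap V (uobj V X) (F.obj a) (uobj V X) (K.obj b)) :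
    utensor e (eId V (K.obj b)) ≫ post _ (M (uobj V B) b ≫ post _ (leftHom V b ≫ K.map _ _)) =
      leftHom V (K.obj b) := by
  refine hepi.ext fun a => ?_
  have h0 := hM (uobj V B) b (uobj V A) a
  have h1 := congrArg (fun t => pre t b) (hJ a)
  have h2 := congrArg (fun t => pre t (K.obj b)) (hF a)
  have h3 := (hκ.isColim b).nat.pre (leftHom V a)
  have h4 := (hκ.conat (tobj V (uobj V A) a)).post (leftHom V b)
  have h5 : (λ_ _).inv ≫ eId V (uobj V X) ▷ _ ≫ _ ◁ κ b a ≫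
      tmap V (uobj V X) (F.obj a) (uobj V X) (K.obj b) ≫ post _ (utensor e (eId V (K.obj b))) =
      (λ_ _).inv ≫ χ₀ ▷ _ ≫ (κ (uobj V B) (uobj V A) ⊗ₘ κ b a) ≫ tmap V _ _ _ _ ≫
        pre (utensor ε (eId V (F.obj a))) _ := by
    rw [tmap_post, tmap_pre, post_id, pre_id]
    simp only [← tensorHom_id, ← id_tensorHom, tensorHom_comp_tensorHom_assoc, Category.id_comp,
      Category.comp_id, eId_post, he]
  -- Naturality of the left unitor of `B`, with `χ₀` in place of the identity of `N`.
  have h6 : (λ_ _).inv ≫ χ₀ ▷ _ ≫ tmap V (J.obj (uobj V A)) (J.obj a) (uobj V B) b ≫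
      post _ (leftHom V b) = pre (utensor χ₀ (eId V (J.obj a)) ≫ post _ (leftHom V (J.obj a))) b := by
    rw [pre_comp, ← leftHom_naturality]
    simp only [Category.assoc]
    rw [← pre_post, tmap_pre_assoc, pre_id, tensorHom_id, ← comp_whiskerRight_assoc, eId_pre]
  simp only [pre_comp] at h1 h2 h6
  simp only [Category.assoc] at h1 h2
  rw [post_comp, post_comp]
  simp only [Category.assoc]
  rw [reassoc_of% h5, pre_post_assoc, pre_post, reassoc_of% h0, pre_post_assoc,
    ← reassoc_of% h4, pre_post_assoc, reassoc_of% h6, reassoc_of% h1, reassoc_of% h3, h2,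
    ← whisker_exchange_assoc, ← leftUnitor_inv_naturality_assoc, leftHom_naturality]

theorem comparison_rightUnitor {χ₀ : 𝟙_ V ⟶ (J.obj (uobj V A) ⟶[V] uobj V B)}
    {ε : 𝟙_ V ⟶ (uobj V X ⟶[V] F.obj (uobj V A))} {e : 𝟙_ V ⟶ (uobj V X ⟶[V] K.obj (uobj V B))}
    {b : B} (he : e = χ₀ ≫ κ (uobj V B) (uobj V A) ≫ pre ε _)
    (hJ : ∀ a, χ a (uobj V A) ≫ post _ (utensor (eId V (J.obj a)) χ₀ ≫
      post _ (rightHom V (J.obj a))) = rightHom V a ≫ J.map _ _)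
    (hF : ∀ a, utensor (eId V (F.obj a)) ε ≫ post _ (μ a (uobj V A) ≫
      post _ (rightHom V a ≫ F.map _ _)) = rightHom V (F.obj a))
    (hepi : JointEpi fun a => (ρ_ _).inv ≫ _ ◁ eId V (uobj V X) ≫
      κ b a ▷ _ ≫ tmap V (F.obj a) (uobj V X) (K.obj b) (uobj V X)) :
    utensor (eId V (K.obj b)) e ≫ post _ (M b (uobj V B) ≫ post _ (rightHom V b ≫ K.map _ _)) =
      rightHom V (K.obj b) := by
  refine hepi.ext fun a => ?_
  have h0 := hM b (uobj V B) a (uobj V A)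
  have h1 := congrArg (fun t => pre t b) (hJ a)
  have h2 := congrArg (fun t => pre t (K.obj b)) (hF a)
  have h3 := (hκ.isColim b).nat.pre (rightHom V a)
  have h4 := (hκ.conat (tobj V a (uobj V A))).post (rightHom V b)
  have h5 : (ρ_ _).inv ≫ _ ◁ eId V (uobj V X) ≫ κ b a ▷ _ ≫
      tmap V (F.obj a) (uobj V X) (K.obj b) (uobj V X) ≫ post _ (utensor (eId V (K.obj b)) e) =
      (ρ_ _).inv ≫ _ ◁ χ₀ ≫ (κ b a ⊗ₘ κ (uobj V B) (uobj V A)) ≫ tmap V _ _ _ _ ≫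
        pre (utensor (eId V (F.obj a)) ε) _ := by
    rw [tmap_post, tmap_pre, post_id, pre_id]
    simp only [← tensorHom_id, ← id_tensorHom, tensorHom_comp_tensorHom_assoc, Category.id_comp,
      Category.comp_id, eId_post, he]
  have h6 : (ρ_ _).inv ≫ _ ◁ χ₀ ≫ tmap V (J.obj a) (J.obj (uobj V A)) b (uobj V B) ≫
      post _ (rightHom V b) =
        pre (utensor (eId V (J.obj a)) χ₀ ≫ post _ (rightHom V (J.obj a))) b := by
    rw [pre_comp, ← rightHom_naturality]
    simp only [Category.assoc]
    rw [← pre_post, tmap_pre_assoc, pre_id, id_tensorHom,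
      ← MonoidalCategory.whiskerLeft_comp_assoc, eId_pre]
  simp only [pre_comp] at h1 h2 h6
  simp only [Category.assoc] at h1 h2
  rw [post_comp, post_comp]
  simp only [Category.assoc]
  rw [reassoc_of% h5, pre_post_assoc, pre_post, reassoc_of% h0, pre_post_assoc,
    ← reassoc_of% h4, pre_post_assoc, reassoc_of% h6, reassoc_of% h1, reassoc_of% h3, h2,
    whisker_exchange_assoc, ← rightUnitor_inv_naturality_assoc, rightHom_naturality]

end Coherence

end
end EnrichedKan

namespace EnrichedKan

noncomputable section

section

variable {V : Type v} [Category.{w} V] [MonoidalCategory V] [SymmetricCategory V]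
  {A : Type u₁} {X : Type u₂} [EnrichedCategory V A] [EnrichedCategory V X]
  [MonoidalVCategory V A] [MonoidalVCategory V X] {F : EnrichedFunctor V A X}

/-! ### Strong monoidal `V`-functors in terms of underlying morphisms -/

omit [SymmetricCategory V] in
theorem homTo_eq_iff {C : Type*} [EnrichedCategory V C] {x y : C}
    {f g : ForgetEnrichment.of V x ⟶ ForgetEnrichment.of V y} {f' g' : 𝟙_ V ⟶ (x ⟶[V] y)}
    (hf : ForgetEnrichment.homTo V f = f') (hg : ForgetEnrichment.homTo V g = g') :
    f = g ↔ f' = g' :=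
  ⟨fun h => hf.symm.trans ((congrArg (ForgetEnrichment.homTo V) h).trans hg),
    fun h => congrArg (ForgetEnrichment.homOf V) (hf.trans (h.trans hg.symm))⟩

theorem homTo_tensor_pairHom_id {x y : X}
    (f : ForgetEnrichment.of V x ⟶ ForgetEnrichment.of V y) (z : X) :
    (ForgetEnrichment.homTo V ((MonoidalVCategory.tensor (V := V) (A := X)).forget.map
      (pairHom f (𝟙 (ForgetEnrichment.of V z)))) : 𝟙_ V ⟶ (tobj V x z ⟶[V] tobj V y z)) =
      utensor (ForgetEnrichment.homTo V f) (eId V z) :=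
  congrArg (fun t => t ≫ tmap V x z y z) (homTo_pairHom_id f z)

theorem homTo_tensor_pairHom_id' {x y : X} (z : X)
    (f : ForgetEnrichment.of V x ⟶ ForgetEnrichment.of V y) :
    (ForgetEnrichment.homTo V ((MonoidalVCategory.tensor (V := V) (A := X)).forget.map
      (pairHom (𝟙 (ForgetEnrichment.of V z)) f)) : 𝟙_ V ⟶ (tobj V z x ⟶[V] tobj V z y)) =
      utensor (eId V z) (ForgetEnrichment.homTo V f) :=
  congrArg (fun t => t ≫ tmap V z x z y) (homTo_pairHom_id' z f)

omit [SymmetricCategory V] in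
theorem homTo_comp_of_eq {C : Type*} [EnrichedCategory V C] {x y z : C}
    {f : ForgetEnrichment.of V x ⟶ ForgetEnrichment.of V y}
    {g : ForgetEnrichment.of V y ⟶ ForgetEnrichment.of V z}
    {f' : 𝟙_ V ⟶ (x ⟶[V] y)} {g' : 𝟙_ V ⟶ (y ⟶[V] z)}
    (hf : ForgetEnrichment.homTo V f = f') (hg : ForgetEnrichment.homTo V g = g') :
    (ForgetEnrichment.homTo V (f ≫ g) : 𝟙_ V ⟶ (x ⟶[V] z)) = f' ≫ post x g' := by
  rw [homTo_comp', hf, hg]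

variable (μ : VNatIso ((tensorFunctor F F).comp V (MonoidalVCategory.tensor (V := V) (A := X)))
    ((MonoidalVCategory.tensor (V := V) (A := A)).comp V F))
  (ε : VNatIso (MonoidalVCategory.unit (V := V) (A := X))
    ((MonoidalVCategory.unit (V := V) (A := A)).comp V F))

/-- The associativity axiom, in terms of underlying morphisms. -/
theorem associativity_iff (x y z : A) :
    ((MonoidalVCategory.tensor (V := V) (A := X)).forget.map
        (pairHom (μ.iso ⟨x, y⟩).hom (𝟙 (ForgetEnrichment.of V (F.obj z)))) ≫
      (μ.iso ⟨(MonoidalVCategory.tensor (V := V) (A := A)).obj ⟨x, y⟩, z⟩).hom ≫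
      F.forget.map ((MonoidalVCategory.associator (V := V) (A := A)).iso ⟨⟨x, y⟩, z⟩).hom =
    ((MonoidalVCategory.associator (V := V) (A := X)).iso ⟨⟨F.obj x, F.obj y⟩, F.obj z⟩).hom ≫
      (MonoidalVCategory.tensor (V := V) (A := X)).forget.map
        (pairHom (𝟙 (ForgetEnrichment.of V (F.obj x))) (μ.iso ⟨y, z⟩).hom) ≫
      (μ.iso ⟨x, (MonoidalVCategory.tensor (V := V) (A := A)).obj ⟨y, z⟩⟩).hom) ↔
    utensor (μ.hom ⟨x, y⟩) (eId V (F.obj z)) ≫ post _ (μ.hom ⟨tobj V x y, z⟩ ≫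
      post _ (assocHom V x y z ≫ F.map _ _)) =
      assocHom V (F.obj x) (F.obj y) (F.obj z) ≫ post _ (utensor (eId V (F.obj x)) (μ.hom ⟨y, z⟩) ≫
        post _ (μ.hom ⟨x, tobj V y z⟩)) :=
  homTo_eq_iff (C := X)
    (homTo_comp_of_eq (homTo_tensor_pairHom_id (μ.iso ⟨x, y⟩).hom (F.obj z))
      (homTo_comp_of_eq (y := F.obj (tobj V (tobj V x y) z)) (f := (μ.iso ⟨tobj V x y, z⟩).hom)
        (g := F.forget.map ((MonoidalVCategory.associator (V := V) (A := A)).iso ⟨⟨x, y⟩, z⟩).hom)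
        rfl rfl))
    (homTo_comp_of_eq
      (f := ((MonoidalVCategory.associator (V := V) (A := X)).iso
        ⟨⟨F.obj x, F.obj y⟩, F.obj z⟩).hom) rfl
      (homTo_comp_of_eq (homTo_tensor_pairHom_id' (F.obj x) (μ.iso ⟨y, z⟩).hom)
        (g := (μ.iso ⟨x, tobj V y z⟩).hom) rfl))

/-- The left unit axiom, in terms of underlying morphisms. -/
theorem left_unitality_iff (x : A) :
    ((MonoidalVCategory.tensor (V := V) (A := X)).forget.map
        (pairHom (ε.iso ⟨⟩).hom (𝟙 (ForgetEnrichment.of V (F.obj x)))) ≫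
      (μ.iso ⟨(MonoidalVCategory.unit (V := V) (A := A)).obj ⟨⟩, x⟩).hom ≫
      F.forget.map ((MonoidalVCategory.leftUnitor (V := V) (A := A)).iso ⟨⟨⟩, x⟩).hom =
    ((MonoidalVCategory.leftUnitor (V := V) (A := X)).iso ⟨⟨⟩, F.obj x⟩).hom) ↔
    utensor (ε.hom ⟨⟩) (eId V (F.obj x)) ≫ post _ (μ.hom ⟨uobj V A, x⟩ ≫
      post _ (leftHom V x ≫ F.map _ _)) = leftHom V (F.obj x) :=
  homTo_eq_iff (C := X)
    (homTo_comp_of_eq (homTo_tensor_pairHom_id (ε.iso ⟨⟩).hom (F.obj x))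
      (homTo_comp_of_eq (y := F.obj (tobj V (uobj V A) x)) (f := (μ.iso ⟨uobj V A, x⟩).hom)
        (g := F.forget.map ((MonoidalVCategory.leftUnitor (V := V) (A := A)).iso ⟨⟨⟩, x⟩).hom)
        rfl rfl))
    rfl

/-- The right unit axiom, in terms of underlying morphisms. -/
theorem right_unitality_iff (x : A) :
    ((MonoidalVCategory.tensor (V := V) (A := X)).forget.map
        (pairHom (𝟙 (ForgetEnrichment.of V (F.obj x))) (ε.iso ⟨⟩).hom) ≫
      (μ.iso ⟨x, (MonoidalVCategory.unit (V := V) (A := A)).obj ⟨⟩⟩).hom ≫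
      F.forget.map ((MonoidalVCategory.rightUnitor (V := V) (A := A)).iso ⟨x, ⟨⟩⟩).hom =
    ((MonoidalVCategory.rightUnitor (V := V) (A := X)).iso ⟨F.obj x, ⟨⟩⟩).hom) ↔
    utensor (eId V (F.obj x)) (ε.hom ⟨⟩) ≫ post _ (μ.hom ⟨x, uobj V A⟩ ≫
      post _ (rightHom V x ≫ F.map _ _)) = rightHom V (F.obj x) :=
  homTo_eq_iff (C := X)
    (homTo_comp_of_eq (homTo_tensor_pairHom_id' (F.obj x) (ε.iso ⟨⟩).hom)
      (homTo_comp_of_eq (y := F.obj (tobj V x (uobj V A))) (f := (μ.iso ⟨x, uobj V A⟩).hom)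
        (g := F.forget.map ((MonoidalVCategory.rightUnitor (V := V) (A := A)).iso ⟨x, ⟨⟩⟩).hom)
        rfl rfl))
    rfl

end

/-- The comonoidal constraints are defined from inverse monoidal constraints, so coherence of `χ` is
first obtained for inverses; conjugation returns it to the direct form. -/
theorem IsInverse.comp_post_of_inv {V : Type v} [Category.{w} V] [MonoidalCategory V] {C : Type*}
    [EnrichedCategory V C] {x y z t : C} {u : 𝟙_ V ⟶ (x ⟶[V] y)} {v : 𝟙_ V ⟶ (y ⟶[V] x)}
    (h : IsInverse u v) {u' : 𝟙_ V ⟶ (z ⟶[V] t)} {v' : 𝟙_ V ⟶ (t ⟶[V] z)} (h' : IsInverse u' v')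
    {f : 𝟙_ V ⟶ (x ⟶[V] z)} {g : 𝟙_ V ⟶ (y ⟶[V] t)} (e : v ≫ post y f = g ≫ post y v') :
    u ≫ post x g = f ≫ post x u' := by
  have h1 := u ≫= congrArg (post x) e =≫ post x u'
  rw [post_comp, post_comp, Category.assoc, Category.assoc,
    h'.symm.post_post, Category.comp_id, reassoc_of% h.hom_inv, eId_post_assoc] at h1
  exact h1.symm

/-! ### Colax monoidal coherence of `χ` in direct form. -/

namespace StrongComonoidal

open CartesianVCategory

variable {V : Type v} [Category.{w} V] [MonoidalCategory V] [SymmetricCategory V]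
  {A : Type u₁} {B : Type u₂} [EnrichedCategory V A] [EnrichedCategory V B]
  [CartesianVCategory V A] [CartesianVCategory V B] {J : EnrichedFunctor V A B}
  (hJ : StrongComonoidal J)

theorem χ_assocHom (x y z : A) :
    (assocHom V x y z ≫ J.map _ _) ≫ post _ (hJ.χ ⟨x, tobj V y z⟩ ≫
      post _ (utensor (eId V (J.obj x)) (hJ.χ ⟨y, z⟩))) =
      hJ.χ ⟨tobj V x y, z⟩ ≫ post _ (utensor (hJ.χ ⟨x, y⟩) (eId V (J.obj z)) ≫
        post _ (assocHom V (J.obj x) (J.obj y) (J.obj z))) := by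
  have h := ((isInverse_assoc V x y z).map J).comp_post_of_inv
    (isInverse_assoc V (J.obj x) (J.obj y) (J.obj z))
    (f := hJ.χ ⟨tobj V x y, z⟩ ≫ post _ (utensor (hJ.χ ⟨x, y⟩) (eId V (J.obj z))))
    (by rw [post_comp, Category.assoc]; exact hJ.assocInv_map_χ x y z)
  rw [h, post_comp, Category.assoc]

theorem χ_leftHom (a : A) : hJ.χ ⟨uobj V A, a⟩ ≫ post _ (utensor (hJ.χ₀ ⟨⟩) (eId V (J.obj a)) ≫
      post _ (leftHom V (J.obj a))) = leftHom V a ≫ J.map _ _ := by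
  have h := ((isInverse_left V a).map J).comp_post_of_inv (isInverse_left V (J.obj a))
    (f := hJ.χ ⟨uobj V A, a⟩ ≫ post _ (utensor (hJ.χ₀ ⟨⟩) (eId V (J.obj a))))
    (g := eId V (J.obj a))
    (by rw [eId_post, post_comp, Category.assoc]; exact hJ.leftInv_map_χ a)
  rw [post_id, Category.comp_id] at h
  rw [h, post_comp, Category.assoc]

theorem χ_rightHom (a : A) : hJ.χ ⟨a, uobj V A⟩ ≫ post _ (utensor (eId V (J.obj a)) (hJ.χ₀ ⟨⟩) ≫
      post _ (rightHom V (J.obj a))) = rightHom V a ≫ J.map _ _ := by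
  have h := ((isInverse_right V a).map J).comp_post_of_inv (isInverse_right V (J.obj a))
    (f := hJ.χ ⟨a, uobj V A⟩ ≫ post _ (utensor (eId V (J.obj a)) (hJ.χ₀ ⟨⟩)))
    (g := eId V (J.obj a))
    (by rw [eId_post, post_comp, Category.assoc]; exact hJ.rightInv_map_χ a)
  rw [post_id, Category.comp_id] at h
  rw [h, post_comp, Category.assoc]

end StrongComonoidal

end
end EnrichedKan

namespace EnrichedKan

noncomputable section

variable {V : Type v} [Category.{w} V] [MonoidalCategory V] [SymmetricCategory V] [MonoidalClosed V]
  {A : Type u₁} {B : Type u₂} {X : Type u₃}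
  [EnrichedCategory V A] [EnrichedCategory V B] [EnrichedCategory V X]
  [CartesianVCategory V A] [CartesianVCategory V B] [MonoidalVCategory V X]
  {J : EnrichedFunctor V A B} {F : EnrichedFunctor V A X} {K : EnrichedFunctor V B X}

open CartesianVCategory

/-! ### The strong monoidal structure on `K`. -/

namespace PointwiseLeftKanExtension

variable (hK : PointwiseLeftKanExtension J F K) (hJ : StrongComonoidal J) (hF : StrongMonoidal F)

/-- The general comparison for `Δ ⊣ ⋆` in `A` and in `B`, with `J ⊗ J` as second functor and the
constraint of `F` as `φ`. -/
theorem exists_μ (hL : ∀ x : X, PreservesColimits.{w, v, u₁} (tensorLeftFunctor V x))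
    (hR : ∀ x : X, PreservesColimits.{w, v, u₁} (tensorRightFunctor V x)) :
    ∃ μ : VNatIso ((tensorFunctor K K).comp V (MonoidalVCategory.tensor (V := V) (A := X)))
      ((MonoidalVCategory.tensor (V := V) (A := B)).comp V K),
      ∀ b b' a a', (hK.κ b a ⊗ₘ hK.κ b' a') ≫ tmap V _ _ _ _ ≫ post _ (μ.hom ⟨b, b'⟩) =
        tmap V _ _ _ _ ≫ pre (hJ.χ ⟨a, a'⟩) _ ≫ hK.κ (tobj V b b') (tobj V a a') ≫
          pre (hF.μ.hom ⟨a, a'⟩) _ := by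
  obtain ⟨M, N, hMN, hM, h⟩ := exists_comparison (diagAdj (V := V) (A := A))
    (diagAdj (V := V) (A := B)) (J₂ := tensorFunctor J J) (ψ := hJ.ψHom)
    hJ.ψ.isVTrans_hom hJ.ψ.isInverse hF.μ.isVTrans_hom hF.μ.isInverse hK.isKan (hK.isKan_κ₂ hL hR)
  exact ⟨VNatIso.mk' M N hMN hM, fun b b' a a' =>
    (Category.assoc _ _ _).symm.trans (h ⟨b, b'⟩ ⟨a, a'⟩)⟩

/-- The general comparison for `E ⊣ N`; on the other side stands the unit of `X`, an extension of
itself along the identity. -/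
theorem exists_ε :
    ∃ ε : VNatIso (MonoidalVCategory.unit (V := V) (A := X))
      ((MonoidalVCategory.unit (V := V) (A := B)).comp V K),
      ε.hom ⟨⟩ = hJ.χ₀ ⟨⟩ ≫ hK.κ (uobj V B) (uobj V A) ≫ pre (hF.ε.hom ⟨⟩) _ := by
  obtain ⟨M, N, hMN, hM, h⟩ := exists_comparison (augAdj (V := V) (A := A))
    (augAdj (V := V) (A := B)) (J₂ := vid V UnitCat) (ψ := hJ.ψ₀Hom)
    hJ.isVTrans_ψ₀ hJ.ψ₀.isInverse hF.ε.isVTrans_hom hF.ε.isInverse hK.isKan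
    (isKan_unit (MonoidalVCategory.unit (V := V) (A := X)))
  refine ⟨VNatIso.mk' M N hMN hM, ?_⟩
  -- The unit `V`-category has a single object, on whose hom-object `N` acts by an identity, so the
  -- equation on families becomes a formula for the comparison itself.
  have h1 := h ⟨⟩ ⟨⟩
  dsimp only at h1
  rw [unit_map, unit_map, eId_post, eId_pre_assoc] at h1
  exact h1

include hK in
theorem nonempty_strongMonoidal
    (hL : ∀ x : X, PreservesColimits.{w, v, u₁} (tensorLeftFunctor V x))
    (hR : ∀ x : X, PreservesColimits.{w, v, u₁} (tensorRightFunctor V x))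
    (hJ : StrongComonoidal J) (hF : StrongMonoidal F) : Nonempty (StrongMonoidal K) := by
  obtain ⟨μ, hμ⟩ := hK.exists_μ hJ hF hL hR
  obtain ⟨ε, hε⟩ := hK.exists_ε hJ hF
  exact ⟨{
    μ := μ
    ε := ε
    associativity := fun x y z => (associativity_iff μ x y z).2
      (comparison_associativity hK.isKan (χ := fun a a' => hJ.χ ⟨a, a'⟩)
        (μ := fun a a' => hF.μ.hom ⟨a, a'⟩) (M := fun b b' => μ.hom ⟨b, b'⟩) hμ
        hJ.χ_assocHom (fun a a' a'' => (associativity_iff hF.μ a a' a'').1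
          (hF.associativity a a' a'')) (hK.jointEpi_κ₃ hL hR x y z))
    left_unitality := fun x => (left_unitality_iff μ ε x).2
      (comparison_leftUnitor hK.isKan (χ := fun a a' => hJ.χ ⟨a, a'⟩)
        (μ := fun a a' => hF.μ.hom ⟨a, a'⟩) (M := fun b b' => μ.hom ⟨b, b'⟩) hμ hε
        hJ.χ_leftHom (fun a => (left_unitality_iff hF.μ hF.ε a).1 (hF.left_unitality a))
        (hK.jointEpi_left hL x (uobj V X)))
    right_unitality := fun x => (right_unitality_iff μ ε x).2
      (comparison_rightUnitor hK.isKan (χ := fun a a' => hJ.χ ⟨a, a'⟩)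
        (μ := fun a a' => hF.μ.hom ⟨a, a'⟩) (M := fun b b' => μ.hom ⟨b, b'⟩) hμ hε
        hJ.χ_rightHom (fun a => (right_unitality_iff hF.μ hF.ε a).1 (hF.right_unitality a))
        (hK.jointEpi_right hR x (uobj V X))) }⟩

end PointwiseLeftKanExtension

end
end EnrichedKan

theorem mainTheorem1 {V : Type v} [Category.{w} V] [MonoidalCategory V] [SymmetricCategory V]
    [MonoidalClosed V]
    {A : Type u₁} {B : Type u₂} {X : Type u₃}
    [EnrichedCategory V A] [EnrichedCategory V B] [EnrichedCategory V X]
    [EnrichedKan.CartesianVCategory V A] [EnrichedKan.CartesianVCategory V B]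
    [EnrichedKan.MonoidalVCategory V X]
    (tensorLeft_preserves : ∀ x : X,
      EnrichedKan.PreservesColimits.{w, v, u₁} (EnrichedKan.tensorLeftFunctor V x))
    (tensorRight_preserves : ∀ x : X,
      EnrichedKan.PreservesColimits.{w, v, u₁} (EnrichedKan.tensorRightFunctor V x))
    (J : EnrichedFunctor V A B) (J_comonoidal : EnrichedKan.StrongComonoidal J)
    (F : EnrichedFunctor V A X) (F_monoidal : EnrichedKan.StrongMonoidal F)
    (K : EnrichedFunctor V B X) (K_lan : EnrichedKan.PointwiseLeftKanExtension J F K) :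
    Nonempty (EnrichedKan.StrongMonoidal K) :=
  K_lan.nonempty_strongMonoidal tensorLeft_preserves tensorRight_preserves J_comonoidal F_monoidal
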